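/- **Setting.** For $\rho,T>0$ and $u,v\in\mathbb R^3$ let $M(\rho,T,u;v)=\rho\,(2\pi T)^{-3/2}e^{-|v-u|^2/(2T)}$, and let $M=M(1,1,0;\cdot)$ be the standard Maxwellian. For $T>0$ put $\mu_T=M(1,T,0;\cdot)$ and let $\mathcal L_Tf=2Q(\mu_T,f)$, where $$Q(f,g)(v)=\tfrac12\int_{\mathbb R^3}dv_*\int_{S^2}dn\,\tfrac12|(v-v_*)\cdot n|\,\{f'_*g'+f'g'_*-f_*g-g_*f\}$$ is the hard sphere collision integral, with $v'=v-n\,(v-v_*)\cdot n$ and $v_*'=v_*+n\,(v-v_*)\cdot n$. In the Hilbert space with inner product $(f,g)_T=\int\mu_T^{-1}fg\,dv$, let $\mathfrak A_T,\mathfrak B_T$ be the solutions, orthogonal to the span of $\mu_T,\ v_x\mu_T,\ v_y\mu_T,\ v_z\mu_T,\ |v|^2\mu_T$, of $$\mathcal L_T\mathfrak A_T=\frac{|v|^2-5T}{2T^2}\,v_y\mu_T,\qquad \mathcal L_T\mathfrak B_T=\frac{v_xv_y}{T}\,\mu_T .$$ The viscosity and the heat conductivity are $$\eta(T)=-\int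 v_xv_y\,\mathfrak B_T\,dv,\qquad \kappa(T)=-\int \tfrac12(|v|^2-5T)\,v_y\,\mathfrak A_T\,dv .$$ Given $U_\pm\in\mathbb R$, $C>0$, $\delta>0$ and smooth functions $\sigma_1,\sigma_2$ on $(0,\infty)$, consider the following system (HD) on $(-\pi,\pi)$ for $(U,u_y,r,\tau,\mathcal P_2)$, with $\rho=1+\delta r>0$, $T=1+\delta\tau>0$, $\mathcal P=\rho T$, $\eta=\eta(T)$, $\kappa=\kappa(T)$, $\sigma_i=\sigma_i(T)$, $\eta_0=\eta(1)$, $\eta_\delta=\eta-\eta_0$: $$\partial_y(\rho u_y)=0,\qquad \partial_y[(1+\delta r)(1+\delta\tau)]=0,\qquad \rho u_y\partial_yU=\partial_y(\eta\,\partial_yU),$$ $$\tfrac52\rho u_y\partial_y\tau=\partial_y(\kappa\,\partial_y\tau)+\delta\,\eta\,(\partial_yU)^2,$$ $$\rho u_y\partial_yu_y+\partial_y\mathcal P_2-\frac1{C^2}\rho U^2=\eta_0\partial_y^2u_y+\partial_y\Big(\eta_\delta\partial_yu_y+\frac{\delta^2}{\mathcal P}\big[\sigma_1(\partial_y\tau)^2+\sigma_2(\partial_yU)^2\big]\Big),$$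 with $u_y(\pm\pi)=0$, $U(\pm\pi)=U_\pm$, $\tau(\pm\pi)=r(\pm\pi)=0$. All five unknowns are $C^\infty$ on $(-\pi,\pi)$, and $U,u_y,r,\tau$ are continuous on $[-\pi,\pi]$. Let $\bar U(y)=U_-+\frac{U_+-U_-}{2\pi}(y+\pi)$ be the laminar velocity, and for functions $f(y,v)$ let $$\|f\|_{q,2}=\Big(\int_{\mathbb R^3}dv\,M(v)\Big(\int_{[-\pi,\pi]}|f(y,v)|^q\,dy\Big)^{2/q}\Big)^{1/2}$$ (for $q=\infty$ the inner expression is $\operatorname{ess\,sup}_{y\in[-\pi,\pi]}|f(y,v)|^2$). **Corollary 2.2.** Let $U_-,U_+\in\mathbb R$. There are $\delta_0>0$ and $c>0$, depending only on $U_\pm$, such that for all $C>0$, all smooth $\sigma_1,\sigma_2$ on $(0,\infty)$ and all $0<\delta<\delta_0$ the system (HD) has a solution, its fields $U,u_y,r,\tau$ are uniquely determined on $[-\pi,\pi]$, and with $$M_\delta=M(1+\delta r,\,1+\delta\tau,\,(\delta U,0,0);v),\qquad M_\delta^0=M(1,\,1,\,(\delta\bar U,0,0);v)$$ one has, for $q=2$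 and $q=\infty$, $$\|M^{-1}[M_\delta-M_\delta^0]\|_{q,2}\le c\,\delta^2,\qquad \|M^{-1}[M_\delta^0-M]\|_{q,2}\le c\,\delta .$$ -/

import Mathlib

open MeasureTheory Set
open scoped ENNReal ContDiff

namespace GhostCouette

noncomputable section

/-- Velocity space `ℝ³` with its Euclidean norm; the coordinates `0, 1, 2` are `x, y, z`. -/
abbrev Vel : Type := EuclideanSpace ℝ (Fin 3)

/-- The Maxwellian `M(ρ, T, u; v)` with density `ρ`, temperature `T` and mean velocity `u`. -/
def maxwellian (ρ T : ℝ) (u v : Vel) : ℝ :=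
  ρ / (2 * Real.pi * T) ^ (3 / 2 : ℝ) * Real.exp (-(‖v - u‖ ^ 2 / (2 * T)))

/-- The standard Maxwellian: density and temperature `1`, mean velocity `0`. -/
def stdMaxwellian (v : Vel) : ℝ := maxwellian 1 1 0 v

/-! ### The hard sphere collision operator -/

/-- The unit sphere `S₂` of velocity space. -/
abbrev Sphere : Type := Metric.sphere (0 : Vel) 1

/-- The post-collisional velocity `v' = v - n (v - w)·n`. -/
def postVel (v w n : Vel) : Vel := v - (inner ℝ (v - w) n) • n

/-- The post-collisional velocity `w' = w + n (v - w)·n` of the collision partner. -/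
def postVelPartner (v w n : Vel) : Vel := w + (inner ℝ (v - w) n) • n

/-- The hard sphere cross section, `2 B(n, V) = |V·n|`. -/
def crossSection (n V : Vel) : ℝ := |inner ℝ V n| / 2

/-- The symmetrized Boltzmann collision integral for hard spheres; `dn` is the surface measure. -/
def collision (f g : Vel → ℝ) (v : Vel) : ℝ :=
  (1 / 2) * ∫ w : Vel, ∫ n : Sphere,
    crossSection n (v - w) *
      (f (postVelPartner v w n) * g (postVel v w n)
        + f (postVel v w n) * g (postVelPartner v w n)
        - f w * g v - g w * f v) ∂((volume : Measure Vel).toSphere)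

/-- The Maxwellian of temperature `T` with unit density and zero mean velocity, about which the
transport coefficients at temperature `T` are computed. -/
def centredMaxwellian (T : ℝ) (v : Vel) : ℝ := maxwellian 1 T 0 v

/-- The linearized collision operator `𝓛 f = 2 Q(M, f)` about that Maxwellian. -/
def linCollision (T : ℝ) (f : Vel → ℝ) (v : Vel) : ℝ :=
  2 * collision (centredMaxwellian T) f v

/-- The inner product `(f, g) = ∫ M⁻¹ f g dv`. -/
def hInner (T : ℝ) (f g : Vel → ℝ) : ℝ :=
  ∫ v : Vel, (centredMaxwellian T v)⁻¹ * (f v * g v)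

/-- Membership in the Hilbert space `𝓗` of measurable functions with `∫ M⁻¹ f² dv < ∞`. -/
def MemH (T : ℝ) (f : Vel → ℝ) : Prop :=
  Measurable f ∧ Integrable (fun v : Vel => (centredMaxwellian T v)⁻¹ * f v ^ 2)

/-- The collision invariants `1, v_x, v_y, v_z, |v|² / 2`. -/
def collInvariant (β : Fin 5) (v : Vel) : ℝ :=
  ![1, v 0, v 1, v 2, ‖v‖ ^ 2 / 2] β

/-- `f` is a solution of `𝓛 f = g` in the orthogonal complement, in `𝓗`, of the null space of `𝓛`,
which is spanned by `collInvariant β · M`. -/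
structure IsInverseImage (T : ℝ) (g f : Vel → ℝ) : Prop where
  mem : MemH T f
  orth : ∀ β : Fin 5, hInner T (fun v => collInvariant β v * centredMaxwellian T v) f = 0
  eq : ∀ᵐ v : Vel, linCollision T f v = g v

open Classical in
/-- `𝓛⁻¹ g`: the solution (unique up to null sets) of `𝓛 f = g` orthogonal to the null space. -/
def invLinCollision (T : ℝ) (g : Vel → ℝ) : Vel → ℝ :=
  if h : ∃ f, IsInverseImage T g f then h.choose else 0

/-! ### The transport coefficients

For a local Maxwellian `M` of constant pressure, with mean velocity `(δ U, 0, 0)` and temperature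
`T = 1 + δ τ`, one has `v_y ∂_y M = δ (viscSource ∂_y U + heatSource ∂_y τ)`. -/

/-- The source `v_x v_y M / T`, the coefficient of the velocity gradient. -/
def viscSource (T : ℝ) (v : Vel) : ℝ :=
  v 0 * v 1 / T * centredMaxwellian T v

/-- The source `(|v|² - 5 T) / (2 T²) v_y M`, the coefficient of the temperature gradient. -/
def heatSource (T : ℝ) (v : Vel) : ℝ :=
  (‖v‖ ^ 2 - 5 * T) / (2 * T ^ 2) * v 1 * centredMaxwellian T v

/-- The viscosity `η(T) = -∫ v_x v_y 𝓛⁻¹(viscSource) dv`, written with the inner product of `𝓗`. -/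
def viscosity (T : ℝ) : ℝ :=
  -(T * hInner T (invLinCollision T (viscSource T)) (viscSource T))

/-- The heat conductivity `κ(T) = -∫ v_y (|v|² - 5 T) / 2 · 𝓛⁻¹(heatSource) dv`, written with the
inner product of `𝓗`. -/
def conductivity (T : ℝ) : ℝ :=
  -(T ^ 2 * hInner T (invLinCollision T (heatSource T)) (heatSource T))

/-! ### The one-dimensional stationary hydrodynamic system -/

/-- The unknowns of the hydrodynamic system, as functions of `y`; only `-π ≤ y ≤ π` matters. -/
structure HydroFields where
  /-- the tangential velocity, in units of `δ` -/
  U : ℝ → ℝ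
  /-- the radial velocity `u_y` -/
  u : ℝ → ℝ
  /-- the density correction: the density is `1 + δ r` -/
  r : ℝ → ℝ
  /-- the temperature correction: the temperature is `1 + δ τ` -/
  τ : ℝ → ℝ
  /-- the pressure `𝓟₂` -/
  P₂ : ℝ → ℝ

namespace HydroFields

/-- The density `ρ = 1 + δ r`. -/
def density (W : HydroFields) (δ y : ℝ) : ℝ := 1 + δ * W.r y

/-- The temperature `T = 1 + δ τ`. -/
def temperature (W : HydroFields) (δ y : ℝ) : ℝ := 1 + δ * W.τ y

/-- The leading order pressure `𝓟 = ρ T`. -/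
def pressure (W : HydroFields) (δ y : ℝ) : ℝ := W.density δ y * W.temperature δ y

/-- `W` is a solution, smooth on `(-π, π)` and continuous on `[-π, π]`, of the stationary
hydrodynamic system with parameters `δ` and `C`, wall velocities `Um`, `Up` and higher order
transport coefficients `σ₁`, `σ₂` (functions of the temperature). -/
structure IsSolution (W : HydroFields) (σ₁ σ₂ : ℝ → ℝ) (C Um Up δ : ℝ) : Prop where
  smooth_U : ContDiffOn ℝ ∞ W.U (Ioo (-Real.pi) Real.pi)
  smooth_u : ContDiffOn ℝ ∞ W.u (Ioo (-Real.pi) Real.pi)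
  smooth_r : ContDiffOn ℝ ∞ W.r (Ioo (-Real.pi) Real.pi)
  smooth_τ : ContDiffOn ℝ ∞ W.τ (Ioo (-Real.pi) Real.pi)
  smooth_P₂ : ContDiffOn ℝ ∞ W.P₂ (Ioo (-Real.pi) Real.pi)
  cont_U : ContinuousOn W.U (Icc (-Real.pi) Real.pi)
  cont_u : ContinuousOn W.u (Icc (-Real.pi) Real.pi)
  cont_r : ContinuousOn W.r (Icc (-Real.pi) Real.pi)
  cont_τ : ContinuousOn W.τ (Icc (-Real.pi) Real.pi)
  density_pos : ∀ y ∈ Icc (-Real.pi) Real.pi, 0 < W.density δ y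
  temperature_pos : ∀ y ∈ Icc (-Real.pi) Real.pi, 0 < W.temperature δ y
  /-- `∂_y (ρ u_y) = 0` -/
  mass : ∀ y ∈ Ioo (-Real.pi) Real.pi, deriv (fun s => W.density δ s * W.u s) y = 0
  /-- `∂_y [(1 + δ r)(1 + δ τ)] = 0` -/
  const_pressure : ∀ y ∈ Ioo (-Real.pi) Real.pi, deriv (fun s => W.pressure δ s) y = 0
  /-- `ρ u_y ∂_y U = ∂_y (η ∂_y U)` -/
  tangential : ∀ y ∈ Ioo (-Real.pi) Real.pi,
    W.density δ y * W.u y * deriv W.U y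
      = deriv (fun s => viscosity (W.temperature δ s) * deriv W.U s) y
  /-- `(5/2) ρ u_y ∂_y τ = ∂_y (κ ∂_y τ) + δ η (∂_y U)²` -/
  energy : ∀ y ∈ Ioo (-Real.pi) Real.pi,
    5 / 2 * (W.density δ y * W.u y * deriv W.τ y)
      = deriv (fun s => conductivity (W.temperature δ s) * deriv W.τ s) y
        + δ * (viscosity (W.temperature δ y) * deriv W.U y ^ 2)
  /-- `ρ u_y ∂_y u_y + ∂_y 𝓟₂ - C⁻² ρ U² = η₀ ∂_y² u_y
  + ∂_y (η_δ ∂_y u_y + (δ² / 𝓟) [σ₁ (∂_y τ)² + σ₂ (∂_y U)²])`, where `η₀ = η(1)` and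
  `η_δ = η - η₀` -/
  radial : ∀ y ∈ Ioo (-Real.pi) Real.pi,
    W.density δ y * W.u y * deriv W.u y + deriv W.P₂ y
        - 1 / C ^ 2 * (W.density δ y * W.U y ^ 2)
      = viscosity 1 * deriv (deriv W.u) y
        + deriv (fun s => (viscosity (W.temperature δ s) - viscosity 1) * deriv W.u s
            + δ ^ 2 / W.pressure δ s
              * (σ₁ (W.temperature δ s) * deriv W.τ s ^ 2
                + σ₂ (W.temperature δ s) * deriv W.U s ^ 2)) y
  u_left : W.u (-Real.pi) = 0
  u_right : W.u Real.pi = 0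
  U_left : W.U (-Real.pi) = Um
  U_right : W.U Real.pi = Up
  τ_left : W.τ (-Real.pi) = 0
  τ_right : W.τ Real.pi = 0
  r_left : W.r (-Real.pi) = 0
  r_right : W.r Real.pi = 0

end HydroFields

/-- The laminar velocity: the solution of `∂_y² U = 0` with `U(-π) = Um`, `U(π) = Up`. -/
def laminarVelocity (Um Up y : ℝ) : ℝ :=
  Um + (Up - Um) / (2 * Real.pi) * (y + Real.pi)

/-- `M_δ = M(1 + δ r, 1 + δ τ, (δ U, 0, 0); v)` for hydrodynamic fields `W`. -/
def hydroMaxwellian (W : HydroFields) (δ y : ℝ) (v : Vel) : ℝ :=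
  maxwellian (W.density δ y) (W.temperature δ y) !₂[δ * W.U y, 0, 0] v

/-- `M_δ⁰ = M(1, 1, (δ U, 0, 0); v)` with `U` the laminar velocity. -/
def laminarMaxwellian (Um Up δ y : ℝ) (v : Vel) : ℝ :=
  maxwellian 1 1 !₂[δ * laminarVelocity Um Up y, 0, 0] v

/-- The mixed norm `(∫ M(v) (∫_{[-π,π]} |f(y,v)|^q dy)^(2/q) dv)^(1/2)`, with values in `[0, ∞]`;
for `q = ∞` the inner expression is the square of the essential supremum over `y`. -/
def mixedNorm (q : ℝ≥0∞) (f : ℝ → Vel → ℝ) : ℝ≥0∞ :=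
  (∫⁻ v : Vel, ENNReal.ofReal (stdMaxwellian v) *
    eLpNorm (fun y => f y v) q (volume.restrict (Icc (-Real.pi) Real.pi)) ^ 2) ^ (1 / 2 : ℝ)

end

end GhostCouette

/-!
The radial velocity vanishes: `ρ u_y` is constant and zero at the walls. Also `ρ T = 1`, so that the
system reduces to `(η U')' = 0` and `(κ τ')' + δ η U'² = 0`, with the equation for `𝓟₂` solved by
quadrature. Rescaling velocities in the hard sphere collision operator gives `η(T) = √T η(1)` and
`κ(T) = √T κ(1)` (`viscosity_eq`, `conductivity_eq`). Hence `√T U' = a` is constant, and so is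
`√T ψ'` for `ψ = κ(1) τ - (δ η(1) / 2) (U₊ - U) (U - U₋)`. As `ψ` is monotone and vanishes at both
walls, it vanishes identically: the temperature is the explicit function `couetteTemp` of the
velocity, and `T ≥ 1`. A primitive of `√T(U)` linearizes what is left of the velocity equation, which
gives existence and uniqueness for every `δ > 0` (`exists_isSolution`,
`HydroFields.IsSolution.unique`). Since `T - 1` is of order `δ²`, so is the distance of `U` from the
laminar profile (`IsProfile.abs_sub_laminar_le`), and the norm estimates follow by comparing
exponents, with a majorant in `v` that is square integrable against the standard Maxwellian
(`abs_exp_logRatio_sub_le`, `mixedNorm_le`).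

All of this requires `0 < η(1)` and `0 < κ(1)`, and hence the solvability of the linearized Boltzmann
equation, which takes up most of the file. Writing `f = √M F`, one has `𝓛 f = √M (K F - ν F)` with a
symmetric kernel for `K` that is dominated by an integrable, square integrable function of `v - w`
(`linCollision_one`, `abs_symKernel_le`). The kernel comes from polar coordinates about `v`
(`lintegral_postVel`) and from the fact that the two outgoing velocities have the same distribution
(`lintegral_sphere_exchange`). As `ν` grows linearly, `ν^(-1/2) K ν^(-1/2)` is compact, and the
Fredholm alternative applies (`exists_solves`). The dissipation identity
`-(F, K F - ν F) = ¼ ∫ (h(v') + h(w') - h(v) - h(w))²`, where `F = √M h`, shows that elements of the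
null space are summational invariants. A full classification of these is not needed: testing the
invariance with `⟪u, v⟫ p(⟪n, v⟫)`, where `u ⟂ n` and `p` has Gaussian mean zero, shows directly that
they are orthogonal to the two sources (`integral_invariant_mul`). The same identity makes the
transport coefficients positive.
-/

namespace GhostCouette

noncomputable section

/-! ### Polar, Cartesian and cylindrical coordinates in velocity space -/

/-- The surface measure of the unit sphere of velocity space. -/
abbrev surf : Measure Sphere := (volume : Measure Vel).toSphere

theorem norm_sphere (n : Sphere) : ‖(n : Vel)‖ = 1 := by
  simp

theorem lintegral_polar {f : Vel → ℝ≥0∞} (hf : Measurable f) :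
    ∫⁻ x : Vel, f x
      = ∫⁻ n : Sphere, (∫⁻ r in Ioi (0 : ℝ), ENNReal.ofReal (r ^ 2) * f (r • (n : Vel))) ∂surf := by
  have h1 : ∫⁻ x : Vel, f x = ∫⁻ x in ({0}ᶜ : Set Vel), f x := by
    rw [← lintegral_add_compl f (measurableSet_singleton (0 : Vel))]
    simp
  have hmp := (volume : Measure Vel).measurePreserving_homeomorphUnitSphereProd
  rw [h1, ← lintegral_subtype_comap (measurableSet_singleton _).compl]
  have hfin : Module.finrank ℝ Vel - 1 = 2 := by simp
  rw [hfin] at hmp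
  have h2 : ∀ x : ({0}ᶜ : Set Vel), f x
      = (fun p : Sphere × Ioi (0 : ℝ) => f ((p.2 : ℝ) • (p.1 : Vel)))
          (homeomorphUnitSphereProd Vel x) := by
    intro x
    have hx : ‖(x : Vel)‖ ≠ 0 := norm_ne_zero_iff.2 x.2
    simp [smul_smul, hx]
  have hmeas : Measurable (fun p : Sphere × Ioi (0 : ℝ) => f ((p.2 : ℝ) • (p.1 : Vel))) := by
    fun_prop
  simp_rw [h2]
  rw [hmp.lintegral_comp hmeas, lintegral_prod _ hmeas.aemeasurable]
  refine lintegral_congr fun n => ?_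
  simp only [Measure.volumeIoiPow]
  rw [lintegral_withDensity_eq_lintegral_mul _ (by fun_prop) (by fun_prop)]
  simp only [Pi.mul_apply]
  exact lintegral_subtype_comap measurableSet_Ioi
    (fun r : ℝ => ENNReal.ofReal (r ^ 2) * f (r • (n : Vel)))

/-- A unit vector is the first vector of an orthonormal basis. -/
theorem exists_orthonormalBasis_zero {n : Vel} (hn : ‖n‖ = 1) :
    ∃ b : OrthonormalBasis (Fin 3) ℝ Vel, b 0 = n := by
  obtain ⟨b, hb⟩ := Orthonormal.exists_orthonormalBasis_extension_of_card_eq (𝕜 := ℝ) (E := Vel)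
    (ι := Fin 3) (by simp) (v := fun _ => n) (s := {0})
    ⟨fun i => by simpa using hn, fun i j hij => (hij (Subsingleton.elim i j)).elim⟩
  exact ⟨b, hb 0 rfl⟩

theorem lintegral_coords (b : OrthonormalBasis (Fin 3) ℝ Vel) {f : ℝ × ℝ × ℝ → ℝ≥0∞}
    (hf : Measurable f) :
    ∫⁻ x : Vel, f (inner ℝ (b 0) x, inner ℝ (b 1) x, inner ℝ (b 2) x)
      = ∫⁻ a : ℝ, ∫⁻ p : ℝ × ℝ, f (a, p) := by
  have h1 := b.measurePreserving_repr
  have h2 := PiLp.volume_preserving_ofLp (Fin 3)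
  have h3 := volume_preserving_piFinSuccAbove (fun _ : Fin 3 => ℝ) 0
  have h4 := (MeasurePreserving.id (volume : Measure ℝ)).prod (volume_preserving_finTwoArrow ℝ)
  have h := h4.comp (h3.comp (h2.comp h1))
  have key := h.lintegral_comp hf
  have key2 : ∫⁻ p : ℝ × ℝ × ℝ, f p = ∫⁻ a : ℝ, ∫⁻ p : ℝ × ℝ, f (a, p) := by
    rw [Measure.volume_eq_prod, lintegral_prod _ hf.aemeasurable]
  refine Eq.trans (lintegral_congr fun x => ?_) (key.trans key2)
  congr 1
  simp only [MeasurableEquiv.piFinSuccAbove, MeasurableEquiv.finTwoArrow, MeasurableEquiv.piFinTwo,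
    ← b.repr_apply_apply]
  rfl

theorem norm_sq_coords (b : OrthonormalBasis (Fin 3) ℝ Vel) (x : Vel) :
    ‖x‖ ^ 2 = inner ℝ (b 0) x ^ 2 + inner ℝ (b 1) x ^ 2 + inner ℝ (b 2) x ^ 2 := by
  rw [← b.sum_sq_inner_right x, Fin.sum_univ_three]

theorem lintegral_cylindrical (b : OrthonormalBasis (Fin 3) ℝ Vel) {f : ℝ × ℝ × ℝ → ℝ≥0∞}
    (hf : Measurable f) :
    ∫⁻ x : Vel, f (inner ℝ (b 0) x, inner ℝ (b 1) x, inner ℝ (b 2) x)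
      = ∫⁻ θ in Ioo (-Real.pi) Real.pi, ∫⁻ a : ℝ, ∫⁻ r in Ioi (0 : ℝ),
          ENNReal.ofReal r * f (a, r * Real.cos θ, r * Real.sin θ) := by
  rw [lintegral_coords b hf]
  have h : ∀ a : ℝ, ∫⁻ p : ℝ × ℝ, f (a, p)
      = ∫⁻ θ in Ioo (-Real.pi) Real.pi, ∫⁻ r in Ioi (0 : ℝ),
          ENNReal.ofReal r * f (a, r * Real.cos θ, r * Real.sin θ) := by
    intro a
    rw [← lintegral_comp_polarCoord_symm]
    simp only [polarCoord_target, polarCoord_symm_apply, smul_eq_mul, Measure.volume_eq_prod]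
    rw [← Measure.prod_restrict, lintegral_prod_symm _ (by fun_prop)]
  simp_rw [h]
  rw [lintegral_lintegral_swap]
  fun_prop

/-! ### Isotropy of hard sphere scattering -/

/-- The radial mass `∫₀^∞ r² e^{-r²} dr`, as an extended nonnegative real. -/
def radialMass : ℝ≥0∞ :=
  ∫⁻ r in Ioi (0 : ℝ), ENNReal.ofReal (r ^ 2) * ENNReal.ofReal (Real.exp (-r ^ 2))

theorem radialMass_ne_zero : radialMass ≠ 0 := by
  refine (((setLIntegral_pos_iff (by fun_prop)).2 ?_)).ne'
  have : Ioi (0 : ℝ) ⊆ Function.support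
      (fun r : ℝ => ENNReal.ofReal (r ^ 2) * ENNReal.ofReal (Real.exp (-r ^ 2))) := by
    intro r hr
    have hr' : 0 < r := hr
    have : 0 < r ^ 2 := by positivity
    simpa [Real.exp_pos] using hr'.ne'
  rw [inter_eq_right.2 this]
  simp

theorem radialMass_ne_top : radialMass ≠ ⊤ := by
  have h := (integrableOn_rpow_mul_exp_neg_mul_sq (b := 1) one_pos (s := 2) (by norm_num))
  have h2 := h.lintegral_lt_top.ne
  convert! h2 using 1
  refine lintegral_congr fun r => ?_
  rw [ENNReal.ofReal_mul' (by positivity)]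
  simp

/-- Integration over the sphere, written as a Gaussian integral over the whole space. This allows
spherical integrals to be computed in other coordinates. -/
theorem lintegral_homogeneous {F : Vel → ℝ≥0∞} (hF : Measurable F)
    (hom : ∀ r : ℝ, 0 < r → ∀ n : Sphere, F (r • (n : Vel)) = F n) :
    ∫⁻ x : Vel, ENNReal.ofReal (Real.exp (-‖x‖ ^ 2)) * F x
      = radialMass * ∫⁻ n : Sphere, F n ∂surf := by
  rw [lintegral_polar (by fun_prop), ← lintegral_const_mul _ (by fun_prop)]
  refine lintegral_congr fun n => ?_
  rw [radialMass, ← lintegral_mul_const _ (by fun_prop)]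
  refine setLIntegral_congr_fun measurableSet_Ioi fun r hr => ?_
  have hr' : 0 < r := hr
  simp only [hom r hr' n, norm_smul, norm_sphere, Real.norm_eq_abs, mul_one, sq_abs]
  ring

theorem lintegral_real_eq_pos_add_neg {f : ℝ → ℝ≥0∞} (hf : Measurable f) :
    ∫⁻ a : ℝ, f a = ∫⁻ a in Ioi (0 : ℝ), (f a + f (-a)) := by
  rw [← lintegral_add_compl f (measurableSet_Ioi : MeasurableSet (Ioi (0 : ℝ))), compl_Ioi,
    lintegral_add_left hf]
  congr 1
  have h := (Measure.measurePreserving_neg (volume : Measure ℝ)).setLIntegral_comp_preimage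
    (s := Iic 0) measurableSet_Iic hf
  rw [← h]
  have : (Neg.neg ⁻¹' Iic (0 : ℝ)) = Ici 0 := by ext; simp
  rw [this]
  exact setLIntegral_congr Ioi_ae_eq_Ici.symm

/-- Invariance of a half-plane integral under an exchange of coordinates that maps the quadrants
`a > 0` and `a < 0` of the half-plane `r > 0` to one another, up to reflection. -/
theorem lintegral_quadrant_swap {f g : ℝ → ℝ → ℝ≥0∞} (hf : Measurable (Function.uncurry f))
    (hg : Measurable (Function.uncurry g))
    (h₁ : ∀ a > 0, ∀ r > 0, g a r = f (-r) a) (h₂ : ∀ a > 0, ∀ r > 0, g (-a) r = f r a) :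
    ∫⁻ a : ℝ, ∫⁻ r in Ioi (0 : ℝ), g a r = ∫⁻ a : ℝ, ∫⁻ r in Ioi (0 : ℝ), f a r := by
  rw [lintegral_real_eq_pos_add_neg hg.lintegral_prod_right,
    lintegral_real_eq_pos_add_neg hf.lintegral_prod_right]
  have e1 : ∀ a ∈ Ioi (0 : ℝ), (∫⁻ r in Ioi (0 : ℝ), g a r) + ∫⁻ r in Ioi (0 : ℝ), g (-a) r
      = ∫⁻ r in Ioi (0 : ℝ), (f r a + f (-r) a) := by
    intro a ha
    rw [lintegral_add_left (by fun_prop), add_comm]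
    congr 1
    · exact setLIntegral_congr_fun measurableSet_Ioi fun r hr => h₂ a ha r hr
    · exact setLIntegral_congr_fun measurableSet_Ioi fun r hr => h₁ a ha r hr
  rw [setLIntegral_congr_fun measurableSet_Ioi e1, lintegral_lintegral_swap (by fun_prop)]
  refine setLIntegral_congr_fun measurableSet_Ioi fun r hr => ?_
  exact lintegral_add_left (by fun_prop) _

/-- With hard sphere weights, `n (V·n)` and `V - n (V·n)` have the same distribution: the two
outgoing velocities of a collision are exchangeable.  In cylindrical coordinates about `V` the
identity amounts to exchanging the axial and the radial coordinate. -/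
theorem lintegral_sphere_exchange (V : Vel) {Φ : Vel → ℝ≥0∞} (hΦ : Measurable Φ) :
    ∫⁻ n : Sphere, ENNReal.ofReal |inner ℝ V (n : Vel)| * Φ ((inner ℝ V (n : Vel)) • (n : Vel)) ∂surf
      = ∫⁻ n : Sphere, ENNReal.ofReal |inner ℝ V (n : Vel)|
          * Φ (V - (inner ℝ V (n : Vel)) • (n : Vel)) ∂surf := by
  rcases eq_or_ne V 0 with rfl | hV
  · simp
  set ℓ := ‖V‖ with hℓ
  have hℓ0 : 0 < ℓ := norm_pos_iff.2 hV
  obtain ⟨b, hb⟩ := exists_orthonormalBasis_zero (n := ℓ⁻¹ • V) (by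
    rw [norm_smul, norm_inv, Real.norm_eq_abs, abs_of_pos hℓ0, inv_mul_cancel₀ hℓ0.ne'])
  have hVb : V = ℓ • b 0 := by rw [hb, smul_inv_smul₀ hℓ0.ne']
  -- a common form for both sides: `Ψ` is `Φ` or `Φ (V - ·)`
  have key : ∀ Ψ : Vel → ℝ≥0∞, Measurable Ψ →
      radialMass * ∫⁻ n : Sphere, ENNReal.ofReal |inner ℝ V (n : Vel)|
          * Ψ ((inner ℝ V (n : Vel)) • (n : Vel)) ∂surf
        = ∫⁻ θ in Ioo (-Real.pi) Real.pi, ∫⁻ a : ℝ, ∫⁻ r in Ioi (0 : ℝ),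
            ENNReal.ofReal r * (ENNReal.ofReal (Real.exp (-(a ^ 2 + r ^ 2)))
              * (ENNReal.ofReal (ℓ * |a| / √(a ^ 2 + r ^ 2))
              * Ψ ((ℓ * a / (a ^ 2 + r ^ 2)) •
                (a • b 0 + r • (Real.cos θ • b 1 + Real.sin θ • b 2))))) := by
    intro Ψ hΨ
    have h1 := lintegral_homogeneous
      (F := fun x => ENNReal.ofReal (|inner ℝ V x| / ‖x‖) * Ψ ((inner ℝ V x / ‖x‖ ^ 2) • x))
      (by fun_prop) (by
        intro r hr n
        simp only [inner_smul_right, norm_smul, norm_sphere, Real.norm_eq_abs, abs_of_pos hr,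
          abs_mul, smul_smul]
        congr 1
        · congr 1
          field_simp
        · congr 2
          field_simp)
    simp only [norm_sphere, div_one, one_pow] at h1
    rw [← h1]
    have h2 := lintegral_cylindrical b (f := fun p : ℝ × ℝ × ℝ =>
      ENNReal.ofReal (Real.exp (-(p.1 ^ 2 + p.2.1 ^ 2 + p.2.2 ^ 2)))
        * (ENNReal.ofReal (ℓ * |p.1| / √(p.1 ^ 2 + p.2.1 ^ 2 + p.2.2 ^ 2))
        * Ψ ((ℓ * p.1 / (p.1 ^ 2 + p.2.1 ^ 2 + p.2.2 ^ 2)) •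
          (p.1 • b 0 + (p.2.1 • b 1 + p.2.2 • b 2))))) (by fun_prop)
    have e : ∀ a r θ : ℝ, a ^ 2 + (r * Real.cos θ) ^ 2 + (r * Real.sin θ) ^ 2 = a ^ 2 + r ^ 2 := by
      intro a r θ
      linear_combination r ^ 2 * Real.cos_sq_add_sin_sq θ
    simp only [e] at h2
    simp only [smul_add, smul_smul] at h2 ⊢
    rw [← h2]
    refine lintegral_congr fun x => ?_
    have hin : inner ℝ V x = ℓ * inner ℝ (b 0) x := by rw [hVb, inner_smul_left]; simp
    have hx : x = inner ℝ (b 0) x • b 0 + (inner ℝ (b 1) x • b 1 + inner ℝ (b 2) x • b 2) := by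
      conv_lhs => rw [← b.sum_repr' x, Fin.sum_univ_three, add_assoc]
    have hn : ‖x‖ = √(inner ℝ (b 0) x ^ 2 + inner ℝ (b 1) x ^ 2 + inner ℝ (b 2) x ^ 2) := by
      rw [← norm_sq_coords b x, Real.sqrt_sq (norm_nonneg x)]
    rw [← norm_sq_coords b x] at *
    rw [hin, abs_mul, abs_of_pos hℓ0, Real.sqrt_sq (norm_nonneg x)]
    congr 3
    have := congrArg (fun y => (ℓ * inner ℝ (b 0) x / ‖x‖ ^ 2) • y) hx
    simpa only [smul_add, smul_smul] using this
  have k1 := key Φ hΦ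
  have k2 := key (fun x => Φ (V - x)) (by fun_prop)
  rw [← ENNReal.mul_right_inj radialMass_ne_zero radialMass_ne_top, k1, k2]
  refine lintegral_congr fun θ => ?_
  refine (lintegral_quadrant_swap (by fun_prop) (by fun_prop) ?_ ?_).symm
  all_goals
    intro a ha r hr
    have hs : 0 < a ^ 2 + r ^ 2 := by positivity
    have hs' : (a ^ 2 + r ^ 2) ≠ 0 := hs.ne'
    simp only [neg_sq, abs_neg, abs_of_pos ha, abs_of_pos hr, add_comm (r ^ 2) (a ^ 2)]
    rw [mul_left_comm, mul_left_comm (ENNReal.ofReal a), ← mul_assoc (ENNReal.ofReal r),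
      ← mul_assoc (ENNReal.ofReal a), ← ENNReal.ofReal_mul (le_of_lt hr),
      ← ENNReal.ofReal_mul (le_of_lt ha)]
    congr 3
    · ring
    · rw [hVb]
      match_scalars <;> field_simp <;> ring

/-! ### Gaussian marginals and the kernel of the gain operator -/

/-- The standard one-dimensional Gaussian density. -/
def gauss (t : ℝ) : ℝ := (√(2 * Real.pi))⁻¹ * Real.exp (-(t ^ 2 / 2))

theorem gauss_pos (t : ℝ) : 0 < gauss t := by
  unfold gauss; positivity

theorem gauss_neg (t : ℝ) : gauss (-t) = gauss t := by
  rw [gauss, neg_sq, ← gauss]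

@[fun_prop]
theorem continuous_gauss : Continuous gauss := by
  unfold gauss; fun_prop

@[fun_prop]
theorem measurable_gauss : Measurable gauss := continuous_gauss.measurable

theorem stdMaxwellian_eq (v : Vel) :
    stdMaxwellian v = (√(2 * Real.pi))⁻¹ ^ 3 * Real.exp (-(‖v‖ ^ 2 / 2)) := by
  have h : (2 * Real.pi * 1) ^ (3 / 2 : ℝ) = √(2 * Real.pi) ^ 3 := by
    rw [Real.sqrt_eq_rpow, ← Real.rpow_natCast, ← Real.rpow_mul (by positivity)]
    norm_num
  rw [stdMaxwellian, maxwellian, h, sub_zero, mul_one, inv_pow, one_div]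

theorem stdMaxwellian_pos (v : Vel) : 0 < stdMaxwellian v := by
  rw [stdMaxwellian_eq]; positivity

@[fun_prop]
theorem continuous_stdMaxwellian : Continuous stdMaxwellian := by
  have : stdMaxwellian = fun v : Vel => (√(2 * Real.pi))⁻¹ ^ 3 * Real.exp (-(‖v‖ ^ 2 / 2)) :=
    funext stdMaxwellian_eq
  rw [this]
  fun_prop

@[fun_prop]
theorem measurable_stdMaxwellian : Measurable stdMaxwellian := continuous_stdMaxwellian.measurable

theorem stdMaxwellian_coords (b : OrthonormalBasis (Fin 3) ℝ Vel) (v : Vel) :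
    stdMaxwellian v
      = gauss (inner ℝ (b 0) v) * (gauss (inner ℝ (b 1) v) * gauss (inner ℝ (b 2) v)) := by
  rw [stdMaxwellian_eq, norm_sq_coords b v, add_div, add_div, neg_add, neg_add, Real.exp_add,
    Real.exp_add]
  simp only [gauss]
  ring

theorem integrable_gauss : Integrable gauss := by
  have := (integrable_exp_neg_mul_sq (b := 1 / 2) (by norm_num)).const_mul (√(2 * Real.pi))⁻¹
  refine this.congr (ae_of_all _ fun t => ?_)
  simp only [gauss]
  ring_nf

theorem integral_gauss : ∫ t, gauss t = 1 := by
  have h : ∀ t, gauss t = (√(2 * Real.pi))⁻¹ * Real.exp (-(1 / 2) * t ^ 2) := by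
    intro t; simp only [gauss]; ring_nf
  simp_rw [h]
  rw [integral_const_mul, integral_gaussian]
  rw [show Real.pi / (1 / 2) = 2 * Real.pi by ring]
  exact inv_mul_cancel₀ (by positivity)

theorem lintegral_gauss : ∫⁻ t, ENNReal.ofReal (gauss t) = 1 := by
  rw [← ofReal_integral_eq_lintegral_ofReal integrable_gauss (ae_of_all _ fun t => (gauss_pos t).le),
    integral_gauss, ENNReal.ofReal_one]

theorem lintegral_gauss_prod :
    ∫⁻ p : ℝ × ℝ, ENNReal.ofReal (gauss p.1) * ENNReal.ofReal (gauss p.2) = 1 := by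
  have hm : AEMeasurable (fun t => ENNReal.ofReal (gauss t)) volume := by fun_prop
  rw [Measure.volume_eq_prod, lintegral_prod_mul hm hm, lintegral_gauss, one_mul]

/-- The component of a standard Gaussian vector along a unit vector is a standard Gaussian. -/
theorem lintegral_marginal {n : Vel} (hn : ‖n‖ = 1) {Ψ : ℝ → ℝ≥0∞} (hΨ : Measurable Ψ) :
    ∫⁻ w : Vel, ENNReal.ofReal (stdMaxwellian w) * Ψ (inner ℝ n w)
      = ∫⁻ t : ℝ, ENNReal.ofReal (gauss t) * Ψ t := by
  obtain ⟨b, rfl⟩ := exists_orthonormalBasis_zero hn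
  have h := lintegral_coords b (f := fun p : ℝ × ℝ × ℝ =>
    (ENNReal.ofReal (gauss p.1) * (ENNReal.ofReal (gauss p.2.1) * ENNReal.ofReal (gauss p.2.2)))
      * Ψ p.1) (by fun_prop)
  have h2 : ∀ w : Vel, ENNReal.ofReal (stdMaxwellian w)
      = ENNReal.ofReal (gauss (inner ℝ (b 0) w)) * (ENNReal.ofReal (gauss (inner ℝ (b 1) w))
        * ENNReal.ofReal (gauss (inner ℝ (b 2) w))) := by
    intro w
    rw [stdMaxwellian_coords b, ENNReal.ofReal_mul (gauss_pos _).le,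
      ENNReal.ofReal_mul (gauss_pos _).le]
  simp_rw [h2]
  rw [h]
  refine lintegral_congr fun t => ?_
  have h3 : ∀ p : ℝ × ℝ, (ENNReal.ofReal (gauss t) * (ENNReal.ofReal (gauss p.1)
      * ENNReal.ofReal (gauss p.2))) * Ψ t = (ENNReal.ofReal (gauss t) * Ψ t)
      * (ENNReal.ofReal (gauss p.1) * ENNReal.ofReal (gauss p.2)) := fun p => by ring
  simp only [h3]
  rw [lintegral_const_mul _ (by fun_prop), lintegral_gauss_prod, mul_one]

theorem lintegral_stdMaxwellian : ∫⁻ w : Vel, ENNReal.ofReal (stdMaxwellian w) = 1 := by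
  have := lintegral_marginal (n := EuclideanSpace.single 0 1) (by simp) (Ψ := 1) measurable_one
  simpa [lintegral_gauss] using this

theorem crossSection_nonneg (n V : Vel) : 0 ≤ crossSection n V := by
  unfold crossSection; positivity

@[fun_prop]
theorem measurable_crossSection_comp {α : Type*} [MeasurableSpace α] {f g : α → Vel}
    (hf : Measurable f) (hg : Measurable g) : Measurable fun x => crossSection (f x) (g x) := by
  unfold crossSection; fun_prop

@[fun_prop]
theorem measurable_postVel {α : Type*} [MeasurableSpace α] {f g h : α → Vel}
    (hf : Measurable f) (hg : Measurable g) (hh : Measurable h) :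
    Measurable fun x => postVel (f x) (g x) (h x) := by
  unfold postVel; fun_prop

@[fun_prop]
theorem measurable_postVelPartner {α : Type*} [MeasurableSpace α] {f g h : α → Vel}
    (hf : Measurable f) (hg : Measurable g) (hh : Measurable h) :
    Measurable fun x => postVelPartner (f x) (g x) (h x) := by
  unfold postVelPartner; fun_prop

/-- The kernel of the gain part of the linearized operator: the density at `w` of an outgoing
velocity when a particle of velocity `v` meets a standard Maxwellian gas. -/
def gainKernel (v w : Vel) : ℝ := ‖w - v‖⁻¹ * gauss (inner ℝ w (w - v) / ‖w - v‖)

theorem gainKernel_nonneg (v w : Vel) : 0 ≤ gainKernel v w :=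
  mul_nonneg (by positivity) (gauss_pos _).le

@[fun_prop]
theorem measurable_gainKernel {α : Type*} [MeasurableSpace α] {f g : α → Vel}
    (hf : Measurable f) (hg : Measurable g) : Measurable fun x => gainKernel (f x) (g x) := by
  unfold gainKernel; fun_prop

/-- The distribution of `v'` has density `gainKernel v`: given `n`, the velocity `v'` depends on `w`
only through `w·n`, a standard Gaussian, and `(n, (w - v)·n)` are polar coordinates of `v' - v`. -/
theorem lintegral_postVel (v : Vel) {φ : Vel → ℝ≥0∞} (hφ : Measurable φ) :
    ∫⁻ w : Vel, ∫⁻ n : Sphere,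
        ENNReal.ofReal (crossSection n (v - w) * stdMaxwellian w) * φ (postVel v w n) ∂surf
      = ∫⁻ w : Vel, ENNReal.ofReal (gainKernel v w) * φ w := by
  set Y : Vel → ℝ≥0∞ := fun p => ENNReal.ofReal (2⁻¹ * gainKernel v (v + p)) * φ (v + p) with hY
  have hYm : Measurable Y := by fun_prop
  have hn : ∀ n : Sphere, ∫⁻ w : Vel,
      ENNReal.ofReal (crossSection n (v - w) * stdMaxwellian w) * φ (postVel v w n)
      = ∫⁻ s in Ioi (0 : ℝ), (ENNReal.ofReal (s ^ 2) * Y (s • (n : Vel))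
          + ENNReal.ofReal (s ^ 2) * Y (-(s • (n : Vel)))) := by
    intro n
    have h1 := lintegral_marginal (norm_sphere n) (Ψ := fun t =>
      ENNReal.ofReal (|inner ℝ v (n : Vel) - t| / 2) * φ (v - (inner ℝ v (n : Vel) - t) • (n : Vel)))
      (by fun_prop)
    have h2 : ∀ w : Vel, ENNReal.ofReal (crossSection n (v - w) * stdMaxwellian w)
        * φ (postVel v w n) = ENNReal.ofReal (stdMaxwellian w) *
        (ENNReal.ofReal (|inner ℝ v (n : Vel) - inner ℝ (n : Vel) w| / 2)
          * φ (v - (inner ℝ v (n : Vel) - inner ℝ (n : Vel) w) • (n : Vel))) := by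
      intro w
      rw [ENNReal.ofReal_mul (crossSection_nonneg _ _), crossSection, postVel, inner_sub_left,
        real_inner_comm w (n : Vel)]
      ring
    simp_rw [h2]
    rw [h1, ← lintegral_add_left_eq_self _ (inner ℝ v (n : Vel)),
      lintegral_real_eq_pos_add_neg (by fun_prop)]
    have hnn : inner ℝ (n : Vel) (n : Vel) = 1 := by
      rw [real_inner_self_eq_norm_sq, norm_sphere, one_pow]
    refine setLIntegral_congr_fun measurableSet_Ioi fun s hs => ?_
    have hs' : 0 < s := hs
    have k1 : v + s • (n : Vel) - v = s • (n : Vel) := by abel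
    have k2 : v + -(s • (n : Vel)) - v = -(s • (n : Vel)) := by abel
    simp only [hY]
    rw [← mul_assoc, ← mul_assoc, ← mul_assoc, ← mul_assoc, ← ENNReal.ofReal_mul (gauss_pos _).le,
      ← ENNReal.ofReal_mul (gauss_pos _).le, ← ENNReal.ofReal_mul (by positivity),
      ← ENNReal.ofReal_mul (by positivity), gainKernel, gainKernel, k1, k2, norm_neg, norm_smul,
      norm_sphere, Real.norm_eq_abs, abs_of_pos hs', mul_one]
    congr 2
    · congr 1
      rw [inner_add_left, inner_smul_right, inner_smul_left, inner_smul_right, hnn]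
      simp only [sub_add_cancel_left, abs_neg, abs_of_pos hs', conj_trivial, mul_one]
      rw [show (s * inner ℝ v (n : Vel) + s * s) / s = inner ℝ v (n : Vel) + s by field_simp]
      field_simp
    · congr 1
      module
    · congr 1
      rw [inner_neg_right, inner_add_left, inner_smul_right, inner_neg_left, inner_smul_left,
        inner_smul_right, hnn]
      simp only [sub_add_cancel_left, abs_neg, abs_of_pos hs', conj_trivial, mul_one]
      rw [show -(s * inner ℝ v (n : Vel) + -(s * s)) / s = -(inner ℝ v (n : Vel) + -s) by
        field_simp, gauss_neg]
      field_simp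
    · congr 1
      module
  rw [lintegral_lintegral_swap (by fun_prop)]
  simp_rw [hn]
  have hsplit : ∀ n : Sphere, ∫⁻ s in Ioi (0 : ℝ), (ENNReal.ofReal (s ^ 2) * Y (s • (n : Vel))
          + ENNReal.ofReal (s ^ 2) * Y (-(s • (n : Vel))))
      = (∫⁻ s in Ioi (0 : ℝ), ENNReal.ofReal (s ^ 2) * Y (s • (n : Vel)))
        + ∫⁻ s in Ioi (0 : ℝ), ENNReal.ofReal (s ^ 2) * (fun p => Y (-p)) (s • (n : Vel)) :=
    fun n => lintegral_add_left (by fun_prop) _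
  simp_rw [hsplit]
  rw [lintegral_add_left (by fun_prop), ← lintegral_polar hYm,
    ← lintegral_polar (f := fun p => Y (-p)) (by fun_prop), lintegral_neg_eq_self,
    ← lintegral_add_left hYm,
    ← lintegral_add_left_eq_self (fun w => ENNReal.ofReal (gainKernel v w) * φ w) v]
  refine lintegral_congr fun p => ?_
  simp only [hY]
  have h2 : (2 : ℝ≥0∞) * ENNReal.ofReal 2⁻¹ = 1 := by
    rw [← ENNReal.ofReal_ofNat 2, ← ENNReal.ofReal_mul (by norm_num)]
    norm_num
  rw [ENNReal.ofReal_mul (by positivity), mul_assoc, ← two_mul, ← mul_assoc, h2, one_mul]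

theorem lintegral_postVelPartner (v : Vel) {φ : Vel → ℝ≥0∞} (hφ : Measurable φ) :
    ∫⁻ w : Vel, ∫⁻ n : Sphere,
        ENNReal.ofReal (crossSection n (v - w) * stdMaxwellian w) * φ (postVelPartner v w n) ∂surf
      = ∫⁻ w : Vel, ENNReal.ofReal (gainKernel v w) * φ w := by
  rw [← lintegral_postVel v hφ]
  refine lintegral_congr fun w => ?_
  have h := lintegral_sphere_exchange (v - w) (Φ := fun x => φ (v - x)) (by fun_prop)
  have e : ∀ (n : Sphere) (x : ℝ≥0∞),
      ENNReal.ofReal (crossSection n (v - w) * stdMaxwellian w) * x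
      = ENNReal.ofReal (stdMaxwellian w / 2)
        * (ENNReal.ofReal |inner ℝ (v - w) (n : Vel)| * x) := by
    intro n x
    rw [← mul_assoc, ← ENNReal.ofReal_mul (by have := stdMaxwellian_pos w; positivity),
      crossSection]
    congr 2
    ring
  simp_rw [e, postVel, postVelPartner]
  rw [lintegral_const_mul _ (by fun_prop), lintegral_const_mul _ (by fun_prop), h]
  congr 1
  refine lintegral_congr fun n => ?_
  congr 2
  abel

/-! ### The collision frequency and the symmetrized kernel -/

theorem integrable_norm_pow_mul_exp (k : ℕ) {a : ℝ} (ha : 0 < a) :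
    Integrable fun v : Vel => ‖v‖ ^ k * Real.exp (-(a * ‖v‖ ^ 2)) := by
  have h : IntegrableOn (fun r : ℝ => r ^ (Module.finrank ℝ Vel - 1) • (r ^ k * Real.exp (-(a * r ^ 2))))
      (Ioi 0) := by
    have := integrableOn_rpow_mul_exp_neg_mul_sq ha (s := (2 + k : ℕ))
      (by have : (0 : ℝ) ≤ ((2 + k : ℕ) : ℝ) := Nat.cast_nonneg _
          linarith)
    refine this.congr_fun (fun r hr => ?_) measurableSet_Ioi
    simp only [Real.rpow_natCast, smul_eq_mul]
    simp [pow_add]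
    ring
  exact (integrable_fun_norm_addHaar (volume : Measure Vel)).2 h

/-- An integrable and square integrable function of `v - w` that dominates the symmetrized kernel. -/
def decay (p : Vel) : ℝ := ‖p‖⁻¹ * Real.exp (-(‖p‖ ^ 2 / 16))

theorem decay_nonneg (p : Vel) : 0 ≤ decay p := by
  unfold decay; positivity

@[fun_prop]
theorem measurable_decay : Measurable decay := by
  unfold decay; fun_prop

theorem integrable_decay : Integrable decay := by
  have h : IntegrableOn (fun r : ℝ => r ^ (Module.finrank ℝ Vel - 1)
      • (r⁻¹ * Real.exp (-(r ^ 2 / 16)))) (Ioi 0) := by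
    have := integrableOn_rpow_mul_exp_neg_mul_sq (b := 1 / 16) (by norm_num) (s := 1) (by norm_num)
    refine this.congr_fun (fun r hr => ?_) measurableSet_Ioi
    have hr' : 0 < r := hr
    simp only [Real.rpow_one, smul_eq_mul, finrank_euclideanSpace, Fintype.card_fin]
    field_simp
  exact (integrable_fun_norm_addHaar (volume : Measure Vel)).2 h

theorem integrable_decay_sq : Integrable fun p => decay p ^ 2 := by
  have h : IntegrableOn (fun r : ℝ => r ^ (Module.finrank ℝ Vel - 1)
      • (r⁻¹ * Real.exp (-(r ^ 2 / 16))) ^ 2) (Ioi 0) := by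
    have := integrableOn_rpow_mul_exp_neg_mul_sq (b := 1 / 8) (by norm_num) (s := 0) (by norm_num)
    refine this.congr_fun (fun r hr => ?_) measurableSet_Ioi
    have hr' : 0 < r := hr
    simp only [Real.rpow_zero, smul_eq_mul, finrank_euclideanSpace, Fintype.card_fin, mul_pow,
      ← Real.exp_nat_mul]
    field_simp
    ring_nf
  exact (integrable_fun_norm_addHaar (volume : Measure Vel)).2 h

/-- The square root of the standard Maxwellian. -/
def sqrtMaxwellian (v : Vel) : ℝ := √(stdMaxwellian v)

theorem sqrtMaxwellian_pos (v : Vel) : 0 < sqrtMaxwellian v := Real.sqrt_pos.2 (stdMaxwellian_pos v)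

theorem sqrtMaxwellian_sq (v : Vel) : sqrtMaxwellian v ^ 2 = stdMaxwellian v :=
  Real.sq_sqrt (stdMaxwellian_pos v).le

@[fun_prop]
theorem continuous_sqrtMaxwellian : Continuous sqrtMaxwellian := by
  unfold sqrtMaxwellian; fun_prop

@[fun_prop]
theorem measurable_sqrtMaxwellian : Measurable sqrtMaxwellian := continuous_sqrtMaxwellian.measurable

theorem sqrtMaxwellian_eq (v : Vel) :
    sqrtMaxwellian v = sqrtMaxwellian 0 * Real.exp (-(‖v‖ ^ 2 / 4)) := by
  rw [sqrtMaxwellian, sqrtMaxwellian, stdMaxwellian_eq, stdMaxwellian_eq,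
    Real.sqrt_mul (by positivity), Real.sqrt_mul (by positivity),
    show -(‖v‖ ^ 2 / 2) = 2 * -(‖v‖ ^ 2 / 4) by ring, two_mul, Real.exp_add, Real.sqrt_mul_self
    (Real.exp_pos _).le]
  simp

theorem integrable_stdMaxwellian_mul_pow (k : ℕ) :
    Integrable fun v : Vel => stdMaxwellian v * ‖v‖ ^ k := by
  have := (integrable_norm_pow_mul_exp k (a := 1 / 2) (by norm_num)).const_mul ((√(2 * Real.pi))⁻¹ ^ 3)
  refine this.congr (ae_of_all _ fun v => ?_)
  simp only [stdMaxwellian_eq]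
  ring_nf

theorem integral_stdMaxwellian : ∫ v : Vel, stdMaxwellian v = 1 := by
  rw [integral_eq_lintegral_of_nonneg_ae (ae_of_all _ fun v => (stdMaxwellian_pos v).le)
    (by fun_prop), lintegral_stdMaxwellian, ENNReal.toReal_one]

theorem integrable_stdMaxwellian : Integrable stdMaxwellian := by
  simpa using integrable_stdMaxwellian_mul_pow 0

theorem continuous_crossSection (V : Vel) : Continuous fun n : Sphere => crossSection n V := by
  unfold crossSection; fun_prop

theorem integrable_crossSection (V : Vel) :
    Integrable (fun n : Sphere => crossSection n V) surf := by
  refine Integrable.of_bound (continuous_crossSection V).aestronglyMeasurable ‖V‖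
    (ae_of_all _ fun n => ?_)
  rw [Real.norm_of_nonneg (crossSection_nonneg _ _), crossSection]
  have := abs_real_inner_le_norm V n
  rw [norm_sphere, mul_one] at this
  have := norm_nonneg V
  linarith

/-- The total cross section at unit relative speed. -/
def totalCross : ℝ := ∫ n : Sphere, crossSection n (EuclideanSpace.single 0 1) ∂surf

theorem lintegral_crossSection (V : Vel) :
    ∫⁻ n : Sphere, ENNReal.ofReal (crossSection n V) ∂surf
      = ENNReal.ofReal ‖V‖
        * ∫⁻ n : Sphere, ENNReal.ofReal (crossSection n (EuclideanSpace.single 0 1)) ∂surf := by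
  -- for a unit vector, the integral in polar coordinates does not see the direction
  have key : ∀ b : OrthonormalBasis (Fin 3) ℝ Vel,
      radialMass * ∫⁻ n : Sphere, ENNReal.ofReal (crossSection n (b 0)) ∂surf
        = ∫⁻ a : ℝ, ∫⁻ p : ℝ × ℝ, ENNReal.ofReal (Real.exp (-(a ^ 2 + p.1 ^ 2 + p.2 ^ 2)))
          * ENNReal.ofReal (|a| / 2 / √(a ^ 2 + p.1 ^ 2 + p.2 ^ 2)) := by
    intro b
    have h1 := lintegral_homogeneous
      (F := fun x => ENNReal.ofReal (crossSection x (b 0) / ‖x‖)) (by fun_prop) (by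
        intro r hr n
        simp only [crossSection, inner_smul_right, norm_smul, norm_sphere, Real.norm_eq_abs,
          abs_of_pos hr, abs_mul]
        congr 1
        field_simp)
    simp only [norm_sphere, div_one] at h1
    rw [← h1]
    have h2 := lintegral_coords b (f := fun p : ℝ × ℝ × ℝ =>
      ENNReal.ofReal (Real.exp (-(p.1 ^ 2 + p.2.1 ^ 2 + p.2.2 ^ 2)))
          * ENNReal.ofReal (|p.1| / 2 / √(p.1 ^ 2 + p.2.1 ^ 2 + p.2.2 ^ 2))) (by fun_prop)
    rw [← h2]
    refine lintegral_congr fun x => ?_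
    rw [← norm_sq_coords b x, Real.sqrt_sq (norm_nonneg x), crossSection]
  rcases eq_or_ne V 0 with rfl | hV
  · simp [crossSection]
  have hV0 : 0 < ‖V‖ := norm_pos_iff.2 hV
  obtain ⟨b, hb⟩ := exists_orthonormalBasis_zero (n := ‖V‖⁻¹ • V) (by
    rw [norm_smul, norm_inv, norm_norm, inv_mul_cancel₀ hV0.ne'])
  obtain ⟨b', hb'⟩ := exists_orthonormalBasis_zero (n := EuclideanSpace.single (0 : Fin 3) (1 : ℝ))
    (by simp)
  have hVb : V = ‖V‖ • b 0 := by rw [hb, smul_inv_smul₀ hV0.ne']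
  have h := (key b).trans (key b').symm
  rw [ENNReal.mul_right_inj radialMass_ne_zero radialMass_ne_top] at h
  rw [← hb', ← h, ← lintegral_const_mul _ (by fun_prop)]
  refine lintegral_congr fun n => ?_
  rw [← ENNReal.ofReal_mul hV0.le]
  conv_lhs => rw [hVb]
  simp only [crossSection, inner_smul_left, abs_mul, conj_trivial, abs_norm, mul_div_assoc]

theorem integral_crossSection (V : Vel) :
    ∫ n : Sphere, crossSection n V ∂surf = totalCross * ‖V‖ := by
  have h := lintegral_crossSection V
  rw [← ofReal_integral_eq_lintegral_ofReal (integrable_crossSection _)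
    (ae_of_all _ fun n => crossSection_nonneg _ _),
    ← ofReal_integral_eq_lintegral_ofReal (integrable_crossSection _)
    (ae_of_all _ fun n => crossSection_nonneg _ _), ← ENNReal.ofReal_mul (norm_nonneg _)] at h
  rw [ENNReal.ofReal_eq_ofReal_iff (integral_nonneg fun n => crossSection_nonneg _ _)
    (mul_nonneg (norm_nonneg _) (integral_nonneg fun n => crossSection_nonneg _ _))] at h
  rw [h, totalCross, mul_comm]

theorem totalCross_pos : 0 < totalCross := by
  rw [totalCross, integral_pos_iff_support_of_nonneg (fun n => crossSection_nonneg _ _)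
    (integrable_crossSection _)]
  refine IsOpen.measure_pos _ ((continuous_crossSection _).isOpen_support)
    ⟨⟨EuclideanSpace.single 0 1, by simp⟩, ?_⟩
  simp [crossSection]

/-- The collision frequency of a particle of velocity `v` in the standard Maxwellian gas. -/
def freq (v : Vel) : ℝ := ∫ w : Vel, totalCross * ‖v - w‖ * stdMaxwellian w

theorem integrable_norm_sub_mul_stdMaxwellian (v : Vel) :
    Integrable fun w : Vel => ‖v - w‖ * stdMaxwellian w := by
  refine Integrable.mono' ((integrable_stdMaxwellian.const_mul ‖v‖).add
    (integrable_stdMaxwellian_mul_pow 1)) (by fun_prop) (ae_of_all _ fun w => ?_)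
  have h := stdMaxwellian_pos w
  rw [Real.norm_of_nonneg (by positivity)]
  have h2 := norm_sub_le v w
  simp only [Pi.add_apply, pow_one]
  nlinarith

theorem freq_eq (v : Vel) : freq v = totalCross * ∫ w : Vel, ‖v - w‖ * stdMaxwellian w := by
  rw [freq, ← integral_const_mul]
  simp only [mul_assoc]

theorem integral_norm_stdMaxwellian_pos : 0 < ∫ w : Vel, ‖w‖ * stdMaxwellian w := by
  have hc : Continuous fun w : Vel => ‖w‖ * stdMaxwellian w := by fun_prop
  have hi : Integrable fun w : Vel => ‖w‖ * stdMaxwellian w := by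
    simpa [mul_comm] using integrable_stdMaxwellian_mul_pow 1
  rw [integral_pos_iff_support_of_nonneg
    (fun w => mul_nonneg (norm_nonneg w) (stdMaxwellian_pos w).le) hi]
  refine IsOpen.measure_pos _ hc.isOpen_support ⟨EuclideanSpace.single 0 1, ?_⟩
  simpa using (stdMaxwellian_pos _).ne'

theorem stdMaxwellian_neg (w : Vel) : stdMaxwellian (-w) = stdMaxwellian w := by
  simp [stdMaxwellian_eq]

theorem integral_norm_add_stdMaxwellian (v : Vel) :
    ∫ w : Vel, ‖v + w‖ * stdMaxwellian w = ∫ w : Vel, ‖v - w‖ * stdMaxwellian w := by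
  rw [← integral_neg_eq_self]
  simp only [stdMaxwellian_neg, sub_eq_add_neg]

theorem integrable_norm_add_mul_stdMaxwellian (v : Vel) :
    Integrable fun w : Vel => ‖v + w‖ * stdMaxwellian w := by
  have := (integrable_norm_sub_mul_stdMaxwellian v).comp_neg
  simpa only [stdMaxwellian_neg, sub_neg_eq_add] using this

/-- The linear growth of the collision frequency is what makes the symmetrized operator compact. -/
theorem le_freq : ∃ c : ℝ, 0 < c ∧ ∀ v : Vel, c * (1 + ‖v‖) ≤ freq v := by
  set m := ∫ w : Vel, ‖w‖ * stdMaxwellian w with hm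
  have hm0 : 0 < m := integral_norm_stdMaxwellian_pos
  have hi : Integrable fun w : Vel => ‖w‖ * stdMaxwellian w := by
    simpa [mul_comm] using integrable_stdMaxwellian_mul_pow 1
  -- averaging over `w` and `-w`
  have hsum : ∀ v : Vel, 2 * ∫ w : Vel, ‖v - w‖ * stdMaxwellian w
      = ∫ w : Vel, (‖v - w‖ + ‖v + w‖) * stdMaxwellian w := by
    intro v
    simp_rw [add_mul]
    rw [integral_add (integrable_norm_sub_mul_stdMaxwellian v)
      (integrable_norm_add_mul_stdMaxwellian v), integral_norm_add_stdMaxwellian, two_mul]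
  have hint : ∀ v : Vel, Integrable fun w : Vel => (‖v - w‖ + ‖v + w‖) * stdMaxwellian w := by
    intro v
    simp_rw [add_mul]
    exact (integrable_norm_sub_mul_stdMaxwellian v).add (integrable_norm_add_mul_stdMaxwellian v)
  have h1 : ∀ v : Vel, m ≤ ∫ w : Vel, ‖v - w‖ * stdMaxwellian w := by
    intro v
    have : 2 * m ≤ 2 * ∫ w : Vel, ‖v - w‖ * stdMaxwellian w := by
      rw [hsum, hm, ← integral_const_mul]
      refine integral_mono (hi.const_mul 2) (hint v) fun w => ?_
      have h2 : ‖(v + w) - (v - w)‖ ≤ ‖v + w‖ + ‖v - w‖ := norm_sub_le _ _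
      rw [show (v + w) - (v - w) = (2 : ℝ) • w by module, norm_smul, Real.norm_ofNat] at h2
      have := stdMaxwellian_pos w
      simp only
      nlinarith
    linarith
  have h2 : ∀ v : Vel, ‖v‖ ≤ ∫ w : Vel, ‖v - w‖ * stdMaxwellian w := by
    intro v
    have : 2 * ‖v‖ ≤ 2 * ∫ w : Vel, ‖v - w‖ * stdMaxwellian w := by
      rw [hsum, ← mul_one (2 * ‖v‖), ← integral_stdMaxwellian, ← integral_const_mul]
      refine integral_mono (integrable_stdMaxwellian.const_mul _) (hint v) fun w => ?_
      have h2 : ‖(v + w) + (v - w)‖ ≤ ‖v + w‖ + ‖v - w‖ := norm_add_le _ _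
      rw [show (v + w) + (v - w) = (2 : ℝ) • v by module, norm_smul, Real.norm_ofNat] at h2
      have := stdMaxwellian_pos w
      simp only
      nlinarith
    linarith
  refine ⟨totalCross * (min m 1 / 2), by have := totalCross_pos; positivity, fun v => ?_⟩
  rw [freq_eq, mul_assoc]
  refine mul_le_mul_of_nonneg_left ?_ totalCross_pos.le
  have h3 : min m 1 ≤ m := min_le_left _ _
  have h4 : min m 1 * ‖v‖ ≤ ‖v‖ := mul_le_of_le_one_left (norm_nonneg v) (min_le_right _ _)
  have := h1 v
  have := h2 v
  linarith

theorem freq_pos (v : Vel) : 0 < freq v := by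
  obtain ⟨c, hc, h⟩ := le_freq
  exact lt_of_lt_of_le (by positivity) (h v)

@[fun_prop]
theorem measurable_freq : Measurable freq := by
  have : StronglyMeasurable freq :=
    StronglyMeasurable.integral_prod_right (ν := (volume : Measure Vel))
      (f := fun v w : Vel => totalCross * ‖v - w‖ * stdMaxwellian w)
      (Measurable.stronglyMeasurable (by fun_prop))
  exact this.measurable

/-- The gain kernel conjugated by the square root of the Maxwellian, in a form that is symmetric in
`v` and `w`. -/
theorem sqrt_conj_gainKernel (v w : Vel) :
    sqrtMaxwellian v * gainKernel v w / sqrtMaxwellian w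
      = ‖w - v‖⁻¹ * (√(2 * Real.pi))⁻¹ * Real.exp (-(((inner ℝ v (w - v) / ‖w - v‖) ^ 2
        + (inner ℝ w (w - v) / ‖w - v‖) ^ 2) / 4)) := by
  rcases eq_or_ne (w - v) 0 with h | h
  · simp [gainKernel, h]
  have hp : 0 < ‖w - v‖ := norm_pos_iff.2 h
  have h0 := sqrtMaxwellian_pos 0
  rw [gainKernel, gauss, sqrtMaxwellian_eq v, sqrtMaxwellian_eq w]
  set a := inner ℝ v (w - v) / ‖w - v‖ with ha
  set b := inner ℝ w (w - v) / ‖w - v‖ with hb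
  have e1 : inner ℝ v (w - v) = a * ‖w - v‖ := by rw [ha]; field_simp
  have e2 : inner ℝ w (w - v) = b * ‖w - v‖ := by rw [hb]; field_simp
  have e3 : b - a = ‖w - v‖ := by
    rw [hb, ha, ← sub_div, ← inner_sub_left, real_inner_self_eq_norm_sq]
    field_simp
  have e4 : ‖w‖ ^ 2 - ‖v‖ ^ 2 = b ^ 2 - a ^ 2 := by
    have : ‖w‖ ^ 2 - ‖v‖ ^ 2 = inner ℝ v (w - v) + inner ℝ w (w - v) := by
      rw [inner_sub_right, inner_sub_right, real_inner_self_eq_norm_sq, real_inner_self_eq_norm_sq,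
        real_inner_comm]
      ring
    rw [this, e1, e2, ← e3]
    ring
  have e5 : Real.exp (-(‖v‖ ^ 2 / 4)) * Real.exp (-(b ^ 2 / 2))
      = Real.exp (-((a ^ 2 + b ^ 2) / 4)) * Real.exp (-(‖w‖ ^ 2 / 4)) := by
    rw [← Real.exp_add, ← Real.exp_add]
    congr 1
    linarith
  field_simp
  linear_combination e5

/-- The kernel of `K` (gain minus the loss term that involves `F w`) in `𝓛 (√M F) = √M (K F - ν F)`, where `ν` is the collision frequency. -/
def symKernel (v w : Vel) : ℝ :=
  2 * (sqrtMaxwellian v * gainKernel v w / sqrtMaxwellian w)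
    - totalCross * ‖v - w‖ * sqrtMaxwellian v * sqrtMaxwellian w

@[fun_prop]
theorem measurable_symKernel {α : Type*} [MeasurableSpace α] {f g : α → Vel}
    (hf : Measurable f) (hg : Measurable g) : Measurable fun x => symKernel (f x) (g x) := by
  unfold symKernel; fun_prop

theorem symKernel_comm (v w : Vel) : symKernel v w = symKernel w v := by
  have h : w - v = -(v - w) := by abel
  rw [symKernel, symKernel, sqrt_conj_gainKernel, sqrt_conj_gainKernel, h, norm_neg,
    inner_neg_right, inner_neg_right, neg_div, neg_div, neg_sq, neg_sq,
    add_comm ((inner ℝ v (v - w) / ‖v - w‖) ^ 2)]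
  ring

theorem sqrt_conj_gainKernel_le (v w : Vel) :
    sqrtMaxwellian v * gainKernel v w / sqrtMaxwellian w ≤ decay (v - w) := by
  rw [sqrt_conj_gainKernel, decay, norm_sub_rev w v]
  rcases eq_or_ne (w - v) 0 with h | h
  · have : v - w = 0 := by rw [← neg_sub, h, neg_zero]
    simp [this]
  have hp : 0 < ‖v - w‖ := by rw [norm_sub_rev]; exact norm_pos_iff.2 h
  have h1 : (√(2 * Real.pi))⁻¹ ≤ 1 := by
    refine inv_le_one_of_one_le₀ (Real.one_le_sqrt.2 ?_)
    linarith [Real.pi_gt_three]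
  have e3 : inner ℝ w (w - v) / ‖v - w‖ - inner ℝ v (w - v) / ‖v - w‖ = ‖v - w‖ := by
    rw [← sub_div, ← inner_sub_left, real_inner_self_eq_norm_sq, norm_sub_rev]
    field_simp
  set a := inner ℝ v (w - v) / ‖v - w‖ with ha
  set b := inner ℝ w (w - v) / ‖v - w‖ with hb
  have h2 : Real.exp (-((a ^ 2 + b ^ 2) / 4)) ≤ Real.exp (-(‖v - w‖ ^ 2 / 16)) := by
    refine Real.exp_le_exp.2 ?_
    rw [← e3]
    nlinarith [sq_nonneg (a + b), sq_nonneg (a - b)]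
  calc ‖v - w‖⁻¹ * (√(2 * Real.pi))⁻¹ * Real.exp (-((a ^ 2 + b ^ 2) / 4))
      ≤ ‖v - w‖⁻¹ * 1 * Real.exp (-(‖v - w‖ ^ 2 / 16)) := by gcongr
    _ = _ := by rw [mul_one]

theorem norm_mul_sqrt_le (v w : Vel) :
    ‖v - w‖ * sqrtMaxwellian v * sqrtMaxwellian w ≤ 16 * sqrtMaxwellian 0 ^ 2 * decay (v - w) := by
  rw [sqrtMaxwellian_eq v, sqrtMaxwellian_eq w, decay]
  rcases eq_or_ne (v - w) 0 with h | h
  · simp [h]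
  have hp : 0 < ‖v - w‖ := norm_pos_iff.2 h
  have h0 := sqrtMaxwellian_pos 0
  set s := ‖v - w‖ with hs
  have h1 : s ^ 2 / 8 ≤ ‖v‖ ^ 2 / 4 + ‖w‖ ^ 2 / 4 := by
    have := norm_sub_le v w
    have h2 : s ^ 2 ≤ (‖v‖ + ‖w‖) ^ 2 := by gcongr
    nlinarith [sq_nonneg (‖v‖ - ‖w‖)]
  have h2 : Real.exp (-(‖v‖ ^ 2 / 4)) * Real.exp (-(‖w‖ ^ 2 / 4))
      ≤ Real.exp (-(s ^ 2 / 16)) * Real.exp (-(s ^ 2 / 16)) := by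
    rw [← Real.exp_add, ← Real.exp_add]
    exact Real.exp_le_exp.2 (by linarith)
  have h3 : s ^ 2 * Real.exp (-(s ^ 2 / 16)) ≤ 16 := by
    have := Real.add_one_le_exp (s ^ 2 / 16)
    rw [Real.exp_neg, mul_inv_le_iff₀ (Real.exp_pos _)]
    linarith
  have h4 : s * (Real.exp (-(‖v‖ ^ 2 / 4)) * Real.exp (-(‖w‖ ^ 2 / 4)))
      ≤ 16 * (s⁻¹ * Real.exp (-(s ^ 2 / 16))) := by
    calc s * (Real.exp (-(‖v‖ ^ 2 / 4)) * Real.exp (-(‖w‖ ^ 2 / 4)))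
        ≤ s * (Real.exp (-(s ^ 2 / 16)) * Real.exp (-(s ^ 2 / 16))) := by gcongr
      _ = (s ^ 2 * Real.exp (-(s ^ 2 / 16))) * (s⁻¹ * Real.exp (-(s ^ 2 / 16))) := by
          field_simp
      _ ≤ 16 * (s⁻¹ * Real.exp (-(s ^ 2 / 16))) := by gcongr
  calc _ = sqrtMaxwellian 0 ^ 2 * (s * (Real.exp (-(‖v‖ ^ 2 / 4)) * Real.exp (-(‖w‖ ^ 2 / 4)))) := by
        ring
    _ ≤ sqrtMaxwellian 0 ^ 2 * (16 * (s⁻¹ * Real.exp (-(s ^ 2 / 16)))) := by gcongr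
    _ = _ := by ring

/-- The constant in the bound of the symmetrized kernel by `decay`. -/
def kernelBound : ℝ := 2 + totalCross * (16 * sqrtMaxwellian 0 ^ 2)

theorem kernelBound_pos : 0 < kernelBound := by
  have := totalCross_pos
  unfold kernelBound; positivity

theorem abs_symKernel_le (v w : Vel) : |symKernel v w| ≤ kernelBound * decay (v - w) := by
  have h1 := sqrt_conj_gainKernel_le v w
  have h2 := norm_mul_sqrt_le v w
  have h3 : 0 ≤ sqrtMaxwellian v * gainKernel v w / sqrtMaxwellian w :=
    div_nonneg (mul_nonneg (sqrtMaxwellian_pos v).le (gainKernel_nonneg v w))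
      (sqrtMaxwellian_pos w).le
  have h4 : 0 ≤ ‖v - w‖ * sqrtMaxwellian v * sqrtMaxwellian w :=
    mul_nonneg (mul_nonneg (norm_nonneg _) (sqrtMaxwellian_pos v).le) (sqrtMaxwellian_pos w).le
  have h5 := mul_le_mul_of_nonneg_left h2 totalCross_pos.le
  have h6 := mul_nonneg totalCross_pos.le h4
  have h7 := decay_nonneg (v - w)
  have e : totalCross * ‖v - w‖ * sqrtMaxwellian v * sqrtMaxwellian w
    = totalCross * (‖v - w‖ * sqrtMaxwellian v * sqrtMaxwellian w) := by ring
  rw [symKernel, kernelBound, e, abs_le]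
  constructor <;> nlinarith

/-! ### The linearized operator at unit temperature as `K - ν` -/

/-- If the measure with density `d` on `(w, n)` is mapped by `P` to the measure with density `k`,
then integrals of real functions transform accordingly. -/
theorem integral_of_lintegral_kernel {d : Vel × Sphere → ℝ} {k : Vel → ℝ} {P : Vel × Sphere → Vel}
    (hd : Measurable d) (hd0 : ∀ p, 0 ≤ d p) (hk : Measurable k) (hk0 : ∀ w, 0 ≤ k w)
    (hP : Measurable P)
    (H : ∀ φ : Vel → ℝ≥0∞, Measurable φ →
      ∫⁻ w : Vel, ∫⁻ n : Sphere, ENNReal.ofReal (d (w, n)) * φ (P (w, n)) ∂surf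
        = ∫⁻ w : Vel, ENNReal.ofReal (k w) * φ w)
    {h : Vel → ℝ} (hh : Measurable h) (hi : Integrable fun w => k w * h w) :
    Integrable (fun p => d p * h (P p)) ((volume : Measure Vel).prod surf)
      ∧ ∫ p, d p * h (P p) ∂((volume : Measure Vel).prod surf) = ∫ w, k w * h w := by
  set m := ((volume : Measure Vel).prod surf).withDensity fun p => ENNReal.ofReal (d p) with hm
  have hmap : m.map P = (volume : Measure Vel).withDensity fun w => ENNReal.ofReal (k w) := by
    refine Measure.ext fun s hs => ?_
    have h1 := H (s.indicator 1) (measurable_one.indicator hs)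
    rw [Measure.map_apply hP hs, hm, withDensity_apply _ (hP hs), withDensity_apply _ hs,
      ← lintegral_indicator (hP hs), ← lintegral_indicator hs, lintegral_prod _ (by
        exact (Measurable.indicator (by fun_prop) (hP hs)).aemeasurable)]
    convert h1 using 1
    · refine lintegral_congr fun w => lintegral_congr fun n => ?_
      by_cases hc : P (w, n) ∈ s <;> simp [hc, indicator]
    · refine lintegral_congr fun w => ?_
      by_cases hc : w ∈ s <;> simp [hc, indicator]
  have i1 : Integrable h (m.map P) := by
    rw [hmap, integrable_withDensity_iff_integrable_smul' (by fun_prop)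
      (ae_of_all _ fun _ => ENNReal.ofReal_lt_top)]
    simpa only [ENNReal.toReal_ofReal (hk0 _), smul_eq_mul] using hi
  have i2 : Integrable (fun p => h (P p)) m :=
    (integrable_map_measure hh.aestronglyMeasurable hP.aemeasurable).1 i1
  have e : ∫ w, h w ∂(m.map P) = ∫ p, h (P p) ∂m :=
    integral_map hP.aemeasurable hh.aestronglyMeasurable
  constructor
  · rw [hm, integrable_withDensity_iff_integrable_smul' (by fun_prop)
      (ae_of_all _ fun _ => ENNReal.ofReal_lt_top)] at i2
    simpa only [ENNReal.toReal_ofReal (hd0 _), smul_eq_mul] using i2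
  · rw [hmap, hm, integral_withDensity_eq_integral_toReal_smul (by fun_prop)
      (ae_of_all _ fun _ => ENNReal.ofReal_lt_top),
      integral_withDensity_eq_integral_toReal_smul (by fun_prop)
      (ae_of_all _ fun _ => ENNReal.ofReal_lt_top)] at e
    simpa only [ENNReal.toReal_ofReal (hd0 _), ENNReal.toReal_ofReal (hk0 _), smul_eq_mul]
      using e.symm

theorem norm_sq_postVel (v w : Vel) (n : Sphere) :
    ‖postVel v w n‖ ^ 2 + ‖postVelPartner v w n‖ ^ 2 = ‖v‖ ^ 2 + ‖w‖ ^ 2 := by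
  have hn : inner ℝ (n : Vel) (n : Vel) = 1 := by
    rw [real_inner_self_eq_norm_sq, norm_sphere, one_pow]
  simp only [← real_inner_self_eq_norm_sq, postVel, postVelPartner, inner_sub_left, inner_sub_right,
    inner_add_left, inner_add_right, inner_smul_left, inner_smul_right, hn, conj_trivial,
    real_inner_comm (n : Vel)]
  ring

theorem stdMaxwellian_postVel (v w : Vel) (n : Sphere) :
    stdMaxwellian (postVelPartner v w n) * stdMaxwellian (postVel v w n)
      = stdMaxwellian v * stdMaxwellian w := by
  have h := norm_sq_postVel v w n
  simp only [stdMaxwellian_eq]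
  have e : Real.exp (-(‖postVelPartner v w n‖ ^ 2 / 2)) * Real.exp (-(‖postVel v w n‖ ^ 2 / 2))
      = Real.exp (-(‖v‖ ^ 2 / 2)) * Real.exp (-(‖w‖ ^ 2 / 2)) := by
    rw [← Real.exp_add, ← Real.exp_add]
    congr 1
    linarith
  linear_combination ((√(2 * Real.pi))⁻¹ ^ 3) ^ 2 * e

/-- The defect `h(v') + h(w') - h(v) - h(w)` of a function `h` in a collision. -/
def defect (h : Vel → ℝ) (v w n : Vel) : ℝ :=
  h (postVel v w n) + h (postVelPartner v w n) - h v - h w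

theorem linCollision_one_eq (h : Vel → ℝ) (v : Vel) :
    linCollision 1 (fun v => stdMaxwellian v * h v) v
      = stdMaxwellian v * ∫ w : Vel, ∫ n : Sphere,
          crossSection n (v - w) * stdMaxwellian w * defect h v w n ∂surf := by
  rw [linCollision, collision, ← mul_assoc, mul_one_div_cancel two_ne_zero, one_mul,
    ← integral_const_mul]
  refine integral_congr_ae (ae_of_all _ fun w => ?_)
  simp only
  rw [← integral_const_mul]
  refine integral_congr_ae (ae_of_all _ fun n => ?_)
  have e := stdMaxwellian_postVel v w n
  have e2 : ∀ v, centredMaxwellian 1 v = stdMaxwellian v := fun _ => rfl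
  simp only [defect, e2]
  linear_combination (crossSection n (v - w) * (h (postVel v w n) + h (postVelPartner v w n))) * e

theorem integral_loss {v : Vel} {h : Vel → ℝ} (hh : Measurable h)
    (hi : Integrable fun w => ‖v - w‖ * stdMaxwellian w * h w) :
    Integrable (fun p : Vel × Sphere => crossSection p.2 (v - p.1) * stdMaxwellian p.1 * h p.1)
        ((volume : Measure Vel).prod surf)
      ∧ ∫ p : Vel × Sphere, crossSection p.2 (v - p.1) * stdMaxwellian p.1 * h p.1
          ∂((volume : Measure Vel).prod surf)
        = totalCross * ∫ w, ‖v - w‖ * stdMaxwellian w * h w := by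
  have hI : Integrable (fun p : Vel × Sphere =>
      crossSection p.2 (v - p.1) * stdMaxwellian p.1 * h p.1)
        ((volume : Measure Vel).prod surf) := by
    rw [integrable_prod_iff (Measurable.aestronglyMeasurable (by fun_prop))]
    refine ⟨ae_of_all _ fun w =>
      ((integrable_crossSection (v - w)).mul_const (stdMaxwellian w)).mul_const (h w), ?_⟩
    refine (hi.norm.const_mul totalCross).congr (ae_of_all _ fun w => ?_)
    simp only [norm_mul, Real.norm_of_nonneg (crossSection_nonneg _ _), norm_norm]
    rw [integral_mul_const, integral_mul_const, integral_crossSection]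
    ring
  refine ⟨hI, ?_⟩
  rw [integral_prod _ hI, ← integral_const_mul]
  refine integral_congr_ae (ae_of_all _ fun w => ?_)
  simp only
  rw [integral_mul_const, integral_mul_const, integral_crossSection]
  ring

theorem memLp_decay_sub (v : Vel) : MemLp (fun w => decay (v - w)) 2 := by
  rw [memLp_two_iff_integrable_sq (Measurable.aestronglyMeasurable (by fun_prop))]
  exact integrable_decay_sq.comp_sub_left v

theorem integrable_of_abs_le_decay {v : Vel} {k F : Vel → ℝ} {c : ℝ} (hk : Measurable k)
    (hkd : ∀ w, |k w| ≤ c * decay (v - w)) (hF : MemLp F 2) : Integrable fun w => k w * F w := by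
  have h1 : MemLp k 2 := ((memLp_decay_sub v).const_mul c).mono hk.aestronglyMeasurable
    (ae_of_all _ fun w => by
      rw [Real.norm_eq_abs]
      exact (hkd w).trans (le_abs_self _))
  exact h1.integrable_mul hF

theorem integrable_gain {v : Vel} {h : Vel → ℝ}
    (hF : MemLp (fun w => sqrtMaxwellian w * h w) 2) :
    Integrable fun w => gainKernel v w * h w := by
  have h1 := integrable_of_abs_le_decay (v := v) (c := 1)
    (k := fun w => sqrtMaxwellian v * gainKernel v w / sqrtMaxwellian w) (by fun_prop)
    (fun w => by
      rw [one_mul, abs_of_nonneg (div_nonneg (mul_nonneg (sqrtMaxwellian_pos v).le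
        (gainKernel_nonneg v w)) (sqrtMaxwellian_pos w).le)]
      exact sqrt_conj_gainKernel_le v w) hF
  refine (h1.const_mul (sqrtMaxwellian v)⁻¹).congr (ae_of_all _ fun w => ?_)
  have := (sqrtMaxwellian_pos v).ne'
  have := (sqrtMaxwellian_pos w).ne'
  field_simp

theorem integrable_loss {v : Vel} {h : Vel → ℝ}
    (hF : MemLp (fun w => sqrtMaxwellian w * h w) 2) :
    Integrable fun w => ‖v - w‖ * stdMaxwellian w * h w := by
  have h1 := integrable_of_abs_le_decay (v := v) (c := 16 * sqrtMaxwellian 0 ^ 2)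
    (k := fun w => ‖v - w‖ * sqrtMaxwellian v * sqrtMaxwellian w) (by fun_prop)
    (fun w => by
      rw [abs_of_nonneg (mul_nonneg (mul_nonneg (norm_nonneg _) (sqrtMaxwellian_pos v).le)
        (sqrtMaxwellian_pos w).le)]
      exact norm_mul_sqrt_le v w) hF
  refine (h1.const_mul (sqrtMaxwellian v)⁻¹).congr (ae_of_all _ fun w => ?_)
  have := (sqrtMaxwellian_pos v).ne'
  simp only [← sqrtMaxwellian_sq w]
  field_simp

/-- For every `v` the collision integral converges absolutely. -/
theorem integrable_cross_defect {h : Vel → ℝ} (hh : Measurable h)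
    (hF : MemLp (fun w => sqrtMaxwellian w * h w) 2) (v : Vel) :
    Integrable (fun p : Vel × Sphere => crossSection p.2 (v - p.1) * stdMaxwellian p.1
        * defect h v p.1 p.2) ((volume : Measure Vel).prod surf)
      ∧ ∫ p : Vel × Sphere, crossSection p.2 (v - p.1) * stdMaxwellian p.1
          * defect h v p.1 p.2 ∂((volume : Measure Vel).prod surf)
        = 2 * (∫ w, gainKernel v w * h w)
          - totalCross * (∫ w, ‖v - w‖ * stdMaxwellian w * h w) - freq v * h v := by
  have hd : Measurable fun p : Vel × Sphere => crossSection p.2 (v - p.1) * stdMaxwellian p.1 := by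
    fun_prop
  have hd0 : ∀ p : Vel × Sphere, 0 ≤ crossSection p.2 (v - p.1) * stdMaxwellian p.1 :=
    fun p => mul_nonneg (crossSection_nonneg _ _) (stdMaxwellian_pos _).le
  have g1 := integral_of_lintegral_kernel (P := fun p => postVel v p.1 p.2) hd hd0
    (k := gainKernel v) (by fun_prop) (gainKernel_nonneg v) (by fun_prop)
    (fun φ hφ => lintegral_postVel v hφ) hh (integrable_gain hF)
  have g2 := integral_of_lintegral_kernel (P := fun p => postVelPartner v p.1 p.2) hd hd0
    (k := gainKernel v) (by fun_prop) (gainKernel_nonneg v) (by fun_prop)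
    (fun φ hφ => lintegral_postVelPartner v hφ) hh (integrable_gain hF)
  have g3 := integral_loss (v := v) hh (integrable_loss hF)
  have g4 := integral_loss (v := v) (h := fun _ => h v) measurable_const
    ((integrable_norm_sub_mul_stdMaxwellian v).mul_const _)
  have e : (fun p : Vel × Sphere => crossSection p.2 (v - p.1) * stdMaxwellian p.1
        * defect h v p.1 p.2) = fun p =>
      crossSection p.2 (v - p.1) * stdMaxwellian p.1 * h (postVel v p.1 p.2)
      + crossSection p.2 (v - p.1) * stdMaxwellian p.1 * h (postVelPartner v p.1 p.2)
      - crossSection p.2 (v - p.1) * stdMaxwellian p.1 * h v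
      - crossSection p.2 (v - p.1) * stdMaxwellian p.1 * h p.1 := by
    funext p
    rw [defect]
    ring
  rw [e]
  refine ⟨((g1.1.add g2.1).sub g4.1).sub g3.1, ?_⟩
  have e1 := integral_sub ((g1.1.add g2.1).sub g4.1) g3.1
  have e2 := integral_sub (g1.1.add g2.1) g4.1
  simp only [Pi.add_apply, Pi.sub_apply] at e1 e2
  rw [e1, e2, integral_add g1.1 g2.1, g1.2, g2.2, g3.2, g4.2, integral_mul_const, freq_eq]
  ring

/-- The integral operator `K` with kernel `symKernel`. -/
def gainOp (F : Vel → ℝ) (v : Vel) : ℝ := ∫ w, symKernel v w * F w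

theorem integrable_symKernel {F : Vel → ℝ} (hF : MemLp F 2) (v : Vel) :
    Integrable fun w => symKernel v w * F w :=
  integrable_of_abs_le_decay (by fun_prop) (abs_symKernel_le v) hF

theorem integral_cross_defect {h : Vel → ℝ} (hh : Measurable h)
    (hF : MemLp (fun w => sqrtMaxwellian w * h w) 2) (v : Vel) :
    sqrtMaxwellian v * ∫ p : Vel × Sphere, crossSection p.2 (v - p.1) * stdMaxwellian p.1
          * defect h v p.1 p.2 ∂((volume : Measure Vel).prod surf)
      = gainOp (fun w => sqrtMaxwellian w * h w) v - freq v * (sqrtMaxwellian v * h v) := by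
  rw [(integrable_cross_defect hh hF v).2]
  have h1 : ∀ w, symKernel v w * (sqrtMaxwellian w * h w)
      = sqrtMaxwellian v * 2 * (gainKernel v w * h w)
        - sqrtMaxwellian v * totalCross * (‖v - w‖ * stdMaxwellian w * h w) := by
    intro w
    have := (sqrtMaxwellian_pos w).ne'
    rw [symKernel, ← sqrtMaxwellian_sq w]
    field_simp
  simp only [gainOp, h1]
  rw [integral_sub ((integrable_gain hF).const_mul _) ((integrable_loss hF).const_mul _),
    integral_const_mul, integral_const_mul]
  ring

theorem linCollision_one {F : Vel → ℝ} (hF : Measurable F) (hF2 : MemLp F 2) (v : Vel) :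
    linCollision 1 (fun v => sqrtMaxwellian v * F v) v
      = sqrtMaxwellian v * (gainOp F v - freq v * F v) := by
  set h : Vel → ℝ := fun v => F v / sqrtMaxwellian v with hh
  have hFh : F = fun w => sqrtMaxwellian w * h w := by
    funext w
    have := (sqrtMaxwellian_pos w).ne'
    simp only [hh]
    field_simp
  have hhm : Measurable h := by fun_prop
  have e : (fun v => sqrtMaxwellian v * F v) = fun v => stdMaxwellian v * h v := by
    funext w
    rw [← sqrtMaxwellian_sq, hFh]
    ring
  have hF2' := hF2
  rw [hFh] at hF2'
  have h1 := integral_cross_defect hhm hF2' v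
  rw [← hFh] at h1
  rw [integral_prod _ (integrable_cross_defect hhm hF2' v).1] at h1
  rw [e, linCollision_one_eq, ← sqrtMaxwellian_sq, sq, mul_assoc, h1]
  congr 3
  exact (congrFun hFh v).symm

/-! ### Integral operators on `L²` -/

/-- A Hilbert–Schmidt operator is compact: it is the norm limit of its truncations to finitely many
basis vectors. -/
theorem isCompactOperator_of_summable_norm_sq {E ι : Type*} [NormedAddCommGroup E]
    [InnerProductSpace ℝ E] [CompleteSpace E] (b : HilbertBasis ι ℝ E) (T : E →L[ℝ] E)
    (hT : Summable fun i => ‖T (b i)‖ ^ 2) : IsCompactOperator T := by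
  classical
  set S : Finset ι → E →L[ℝ] E := fun s =>
    ∑ i ∈ s, (ContinuousLinearMap.toSpanSingleton ℝ (T (b i))).comp (innerSL ℝ (b i)) with hS
  have hSx : ∀ s x, S s x = ∑ i ∈ s, inner ℝ (b i) x • T (b i) := by
    intro s x
    simp [hS]
  have hcomp : ∀ s, IsCompactOperator (S s) := by
    intro s
    induction s using Finset.induction_on with
    | empty => simpa [hS] using isCompactOperator_zero
    | insert i s hi ih =>
      have e : S (insert i s) = (ContinuousLinearMap.toSpanSingleton ℝ (T (b i))).comp
          (innerSL ℝ (b i)) + S s := by simp only [hS, Finset.sum_insert hi]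
      rw [e]
      refine IsCompactOperator.add ?_ ih
      exact (isCompactOperator_of_locallyCompactSpace_rng
        (ContinuousLinearMap.toSpanSingleton ℝ (T (b i)))).comp_clm (innerSL ℝ (b i))
  refine isCompactOperator_of_tendsto (l := Filter.atTop) (F := S) (f := T) ?_
    (Filter.Eventually.of_forall hcomp)
  rw [Metric.tendsto_atTop]
  intro ε hε
  obtain ⟨s, hs⟩ := summable_iff_vanishing_norm.1 hT ((ε / 2) ^ 2) (by positivity)
  refine ⟨s, fun u hu => ?_⟩
  rw [dist_eq_norm]
  refine lt_of_le_of_lt (ContinuousLinearMap.opNorm_le_bound _ (by positivity : 0 ≤ ε / 2)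
    fun x => ?_) (half_lt_self hε)
  have hsum : HasSum (fun i => inner ℝ (b i) x • T (b i)) (T x) := by
    have := (b.hasSum_repr x).mapL T
    simpa [b.repr_apply_apply] using this
  have hlim : Filter.Tendsto (fun t => ‖S u x - S t x‖) Filter.atTop (nhds ‖(S u - T) x‖) := by
    have h0 : Filter.Tendsto (fun t => S t x) Filter.atTop (nhds (T x)) := by
      simpa [HasSum, hSx] using hsum
    exact (tendsto_const_nhds.sub h0).norm
  refine le_of_tendsto hlim (Filter.eventually_atTop.2 ⟨u, fun t ht => ?_⟩)
  have e : S t x - S u x = ∑ i ∈ t \ u, inner ℝ (b i) x • T (b i) := by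
    rw [hSx, hSx, ← Finset.sum_sdiff ht, add_sub_cancel_right]
  rw [norm_sub_rev, e]
  calc ‖∑ i ∈ t \ u, inner ℝ (b i) x • T (b i)‖
      ≤ ∑ i ∈ t \ u, ‖(inner ℝ (b i) x : ℝ)‖ * ‖T (b i)‖ := by
        refine (norm_sum_le _ _).trans (Finset.sum_le_sum fun i _ => (norm_smul_le _ _))
    _ ≤ √(∑ i ∈ t \ u, ‖(inner ℝ (b i) x : ℝ)‖ ^ 2) * √(∑ i ∈ t \ u, ‖T (b i)‖ ^ 2) :=
        Real.sum_mul_le_sqrt_mul_sqrt _ _ _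
    _ ≤ √(‖x‖ ^ 2) * √((ε / 2) ^ 2) := by
        gcongr
        · exact b.orthonormal.sum_inner_products_le x
        · have := hs (t \ u) (Finset.disjoint_of_subset_right hu Finset.sdiff_disjoint)
          exact (le_abs_self _).trans this.le
    _ = ε / 2 * ‖x‖ := by
        rw [Real.sqrt_sq (norm_nonneg x), Real.sqrt_sq (by positivity), mul_comm]

/-- Square integrable functions of the velocity. -/
abbrev L2Vel : Type := Lp ℝ 2 (volume : Measure Vel)

theorem L2_norm_sq (F : L2Vel) : ‖F‖ ^ 2 = ∫ v, F v ^ 2 := by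
  rw [← real_inner_self_eq_norm_sq, L2.inner_def]
  refine integral_congr_ae (ae_of_all _ fun v => ?_)
  simp [sq]

theorem L2_inner (F G : L2Vel) : inner ℝ F G = ∫ v, F v * G v := by
  rw [L2.inner_def]
  refine integral_congr_ae (ae_of_all _ fun v => ?_)
  simp [mul_comm]

/-- The integral of `decay`. -/
def decayMass : ℝ := ∫ p, decay p

theorem decayMass_nonneg : 0 ≤ decayMass := integral_nonneg decay_nonneg

theorem lintegral_decay_sub_left (v : Vel) :
    ∫⁻ w, ENNReal.ofReal (decay (v - w)) = ENNReal.ofReal decayMass := by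
  rw [decayMass, ofReal_integral_eq_lintegral_ofReal integrable_decay (ae_of_all _ decay_nonneg)]
  exact lintegral_sub_left_eq_self (fun p => ENNReal.ofReal (decay p)) v

theorem lintegral_decay_sub_right (w : Vel) :
    ∫⁻ v, ENNReal.ofReal (decay (v - w)) = ENNReal.ofReal decayMass := by
  rw [decayMass, ofReal_integral_eq_lintegral_ofReal integrable_decay (ae_of_all _ decay_nonneg)]
  exact lintegral_sub_right_eq_self (fun p => ENNReal.ofReal (decay p)) w

theorem sq_lintegral_mul_le {α : Type*} [MeasurableSpace α] {μ : Measure α} {k f : α → ℝ≥0∞}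
    (hk : AEMeasurable k μ) (hf : AEMeasurable f μ) :
    (∫⁻ x, k x * f x ∂μ) ^ 2 ≤ (∫⁻ x, k x ∂μ) * ∫⁻ x, k x * f x ^ 2 ∂μ := by
  have h := ENNReal.lintegral_mul_le_Lp_mul_Lq μ Real.HolderConjugate.two_two
    (f := fun x => k x ^ (1 / 2 : ℝ)) (g := fun x => k x ^ (1 / 2 : ℝ) * f x)
    (by fun_prop) (by fun_prop)
  have e1 : ∀ x, k x ^ (1 / 2 : ℝ) * k x ^ (1 / 2 : ℝ) = k x := by
    intro x
    rw [← ENNReal.rpow_add_of_nonneg _ _ (by norm_num) (by norm_num)]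
    norm_num
  have e2 : ∀ x, (k x ^ (1 / 2 : ℝ)) ^ (2 : ℝ) = k x := by
    intro x
    rw [← ENNReal.rpow_mul]
    norm_num
  have e3 : ∀ x, (k x ^ (1 / 2 : ℝ) * f x) ^ (2 : ℝ) = k x * f x ^ 2 := by
    intro x
    rw [ENNReal.mul_rpow_of_nonneg _ _ (by norm_num), e2]
    norm_num
  simp only [Pi.mul_apply, ← mul_assoc, e1, e2, e3] at h
  calc (∫⁻ x, k x * f x ∂μ) ^ 2
      ≤ ((∫⁻ x, k x ∂μ) ^ (1 / 2 : ℝ) * (∫⁻ x, k x * f x ^ 2 ∂μ) ^ (1 / 2 : ℝ)) ^ 2 := by gcongr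
    _ = _ := by
      rw [mul_pow, ← ENNReal.rpow_natCast, ← ENNReal.rpow_natCast, ← ENNReal.rpow_mul,
        ← ENNReal.rpow_mul]
      norm_num

/-- The Schur test for kernels dominated by `decay (v - w)`. -/
theorem eLpNorm_kernel_le {a : Vel → Vel → ℝ} {B : ℝ} (hB : 0 ≤ B)
    (hab : ∀ v w, |a v w| ≤ B * decay (v - w)) {F : Vel → ℝ} (hF : AEStronglyMeasurable F volume) :
    eLpNorm (fun v => ∫ w, a v w * F w) 2 volume
      ≤ ENNReal.ofReal (B * decayMass) * eLpNorm F 2 volume := by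
  have hFm : AEMeasurable (fun w => ‖F w‖ₑ) volume := hF.enorm
  have h1 : ∀ v, ‖∫ w, a v w * F w‖ₑ ^ 2 ≤ ENNReal.ofReal B ^ 2 * (ENNReal.ofReal decayMass
      * ∫⁻ w, ENNReal.ofReal (decay (v - w)) * ‖F w‖ₑ ^ 2) := by
    intro v
    have h2 : ‖∫ w, a v w * F w‖ₑ
        ≤ ENNReal.ofReal B * ∫⁻ w, ENNReal.ofReal (decay (v - w)) * ‖F w‖ₑ := by
      refine (enorm_integral_le_lintegral_enorm _).trans ?_
      rw [← lintegral_const_mul' _ _ ENNReal.ofReal_ne_top]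
      refine lintegral_mono fun w => ?_
      rw [enorm_mul, ← mul_assoc, ← ENNReal.ofReal_mul hB]
      gcongr
      rw [Real.enorm_eq_ofReal_abs]
      exact ENNReal.ofReal_le_ofReal (hab v w)
    calc _ ≤ (ENNReal.ofReal B * ∫⁻ w, ENNReal.ofReal (decay (v - w)) * ‖F w‖ₑ) ^ 2 := by gcongr
      _ ≤ _ := by
        rw [mul_pow]
        gcongr
        rw [← lintegral_decay_sub_left v]
        exact sq_lintegral_mul_le (by fun_prop) hFm
  have hN : ∀ G : Vel → ℝ, eLpNorm G 2 volume = (∫⁻ v, ‖G v‖ₑ ^ 2) ^ (1 / 2 : ℝ) := by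
    intro G
    rw [eLpNorm_eq_lintegral_rpow_enorm_toReal (by norm_num) (by norm_num)]
    norm_num
  rw [hN, hN]
  have h3 : ∫⁻ v, ‖∫ w, a v w * F w‖ₑ ^ 2
      ≤ (ENNReal.ofReal (B * decayMass)) ^ 2 * ∫⁻ w, ‖F w‖ₑ ^ 2 := by
    refine (lintegral_mono h1).trans (le_of_eq ?_)
    have hm2 : AEMeasurable (Function.uncurry fun v w : Vel =>
        ENNReal.ofReal (decay (v - w)) * ‖F w‖ₑ ^ 2) (volume.prod volume) := by
      have hm3 : Measurable fun p : Vel × Vel => ENNReal.ofReal (decay (p.1 - p.2)) := by fun_prop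
      exact hm3.aemeasurable.mul (hFm.pow_const 2).comp_snd
    rw [lintegral_const_mul' _ _ (by finiteness), lintegral_const_mul' _ _ ENNReal.ofReal_ne_top,
      lintegral_lintegral_swap hm2]
    have h4 : ∀ w, ∫⁻ v, ENNReal.ofReal (decay (v - w)) * ‖F w‖ₑ ^ 2
        = ENNReal.ofReal decayMass * ‖F w‖ₑ ^ 2 := by
      intro w
      have hm : Measurable fun v => ENNReal.ofReal (decay (v - w)) := by fun_prop
      rw [lintegral_mul_const _ hm, lintegral_decay_sub_right]
    simp_rw [h4]
    rw [lintegral_const_mul' _ _ ENNReal.ofReal_ne_top, ENNReal.ofReal_mul hB]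
    ring
  calc _ ≤ ((ENNReal.ofReal (B * decayMass)) ^ 2 * ∫⁻ w, ‖F w‖ₑ ^ 2) ^ (1 / 2 : ℝ) := by gcongr
    _ = _ := by
      rw [ENNReal.mul_rpow_of_nonneg _ _ (by norm_num), ← ENNReal.rpow_natCast, ← ENNReal.rpow_mul]
      norm_num

theorem memLp_kernel {a : Vel → Vel → ℝ} (ha : Measurable (Function.uncurry a)) {B : ℝ}
    (hB : 0 ≤ B) (hab : ∀ v w, |a v w| ≤ B * decay (v - w)) {F : Vel → ℝ} (hF : MemLp F 2) :
    MemLp (fun v => ∫ w, a v w * F w) 2 := by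
  refine ⟨?_, (eLpNorm_kernel_le hB hab hF.1).trans_lt
    (ENNReal.mul_lt_top ENNReal.ofReal_lt_top hF.2)⟩
  refine AEStronglyMeasurable.integral_prod_right' (f := fun p : Vel × Vel => a p.1 p.2 * F p.2) ?_
  exact ha.aestronglyMeasurable.mul hF.1.comp_snd

theorem exists_kernelOp {a : Vel → Vel → ℝ} (ha : Measurable (Function.uncurry a)) {B : ℝ}
    (hB : 0 ≤ B) (hab : ∀ v w, |a v w| ≤ B * decay (v - w)) :
    ∃ T : L2Vel →L[ℝ] L2Vel, (∀ F : L2Vel, T F =ᵐ[volume] fun v => ∫ w, a v w * F w)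
      ∧ ‖T‖ ≤ B * decayMass := by
  have hm : ∀ F : L2Vel, MemLp (fun v => ∫ w, a v w * F w) 2 := fun F =>
    memLp_kernel ha hB hab (Lp.memLp F)
  have hi : ∀ (F : L2Vel) (v : Vel), Integrable fun w => a v w * F w := fun F v =>
    integrable_of_abs_le_decay (ha.of_uncurry_left) (hab v) (Lp.memLp F)
  let T₀ : L2Vel →ₗ[ℝ] L2Vel :=
    { toFun := fun F => (hm F).toLp
      map_add' := by
        intro F G
        rw [← MemLp.toLp_add, MemLp.toLp_eq_toLp_iff]
        refine ae_of_all _ fun v => ?_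
        simp only [Pi.add_apply]
        rw [← integral_add (hi F v) (hi G v)]
        refine integral_congr_ae ?_
        filter_upwards [Lp.coeFn_add F G] with w hw
        rw [hw, Pi.add_apply, mul_add]
      map_smul' := by
        intro c F
        rw [RingHom.id_apply, ← MemLp.toLp_const_smul, MemLp.toLp_eq_toLp_iff]
        refine ae_of_all _ fun v => ?_
        simp only [Pi.smul_apply, smul_eq_mul]
        rw [← integral_const_mul]
        refine integral_congr_ae ?_
        filter_upwards [Lp.coeFn_smul c F] with w hw
        rw [hw, Pi.smul_apply, smul_eq_mul]
        ring }
  have hbound : ∀ F, ‖T₀ F‖ ≤ B * decayMass * ‖F‖ := by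
    intro F
    rw [Lp.norm_def, Lp.norm_def]
    have h1 := eLpNorm_kernel_le hB hab (Lp.aestronglyMeasurable F)
    have h2 : eLpNorm (T₀ F) 2 volume = eLpNorm (fun v => ∫ w, a v w * F w) 2 volume :=
      eLpNorm_congr_ae (hm F).coeFn_toLp
    rw [h2]
    have h3 := ENNReal.toReal_mono (by
      have := Lp.eLpNorm_ne_top F
      finiteness) h1
    rwa [ENNReal.toReal_mul, ENNReal.toReal_ofReal (mul_nonneg hB decayMass_nonneg)] at h3
  refine ⟨T₀.mkContinuous _ hbound, fun F => (hm F).coeFn_toLp, ?_⟩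
  exact LinearMap.mkContinuous_norm_le _ (mul_nonneg hB decayMass_nonneg) _

/-- A truncated kernel is Hilbert–Schmidt: summing `‖T bᵢ‖²` over an orthonormal basis and using
Bessel's inequality for `a v` at fixed `v` leaves `∫ ‖a v‖² dv` over a ball. -/
theorem isCompactOperator_of_bounded_support {a : Vel → Vel → ℝ}
    (ha : Measurable (Function.uncurry a)) {B R : ℝ}
    (hab : ∀ v w, |a v w| ≤ B * decay (v - w)) (hR : ∀ v, R < ‖v‖ → ∀ w, a v w = 0)
    {T : L2Vel →L[ℝ] L2Vel} (hT : ∀ F : L2Vel, T F =ᵐ[volume] fun v => ∫ w, a v w * F w) :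
    IsCompactOperator T := by
  obtain ⟨ι, b, -⟩ := exists_hilbertBasis ℝ L2Vel
  have hav : ∀ v, MemLp (a v) 2 := fun v =>
    ((memLp_decay_sub v).const_mul B).mono (ha.of_uncurry_left).aestronglyMeasurable
      (ae_of_all _ fun w => by
        rw [Real.norm_eq_abs]
        exact (hab v w).trans (le_abs_self _))
  set D := ∫ p, decay p ^ 2 with hD
  have hnorm : ∀ v, ‖(hav v).toLp‖ ^ 2 ≤ (Metric.closedBall (0 : Vel) R).indicator
      (fun _ => B ^ 2 * D) v := by
    intro v
    rw [L2_norm_sq]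
    have e : ∫ w, (hav v).toLp (a v) w ^ 2 = ∫ w, a v w ^ 2 := by
      refine integral_congr_ae ?_
      filter_upwards [(hav v).coeFn_toLp] with w hw
      rw [hw]
    rw [e]
    by_cases hv : v ∈ Metric.closedBall (0 : Vel) R
    · rw [indicator_of_mem hv, hD, ← integral_sub_left_eq_self (fun p => decay p ^ 2) volume v,
        ← integral_const_mul]
      refine integral_mono_of_nonneg (ae_of_all _ fun w => sq_nonneg _)
        ((integrable_decay_sq.comp_sub_left v).const_mul _) (ae_of_all _ fun w => ?_)
      simp only
      rw [← sq_abs, ← mul_pow]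
      gcongr
      exact hab v w
    · rw [indicator_of_notMem hv]
      have : R < ‖v‖ := by simpa using hv
      simp [hR v this]
  refine isCompactOperator_of_summable_norm_sq b T ?_
  refine summable_of_sum_le (c := ∫ v, (Metric.closedBall (0 : Vel) R).indicator
      (fun _ => B ^ 2 * D) v) (fun i => sq_nonneg _) fun s => ?_
  have hsq : ∀ i, Integrable fun v => T (b i) v ^ 2 := fun i => (Lp.memLp (T (b i))).integrable_sq
  simp_rw [L2_norm_sq]
  rw [← integral_finsetSum _ fun i _ => hsq i]
  refine integral_mono_ae (integrable_finsetSum _ fun i _ => hsq i) ?_ ?_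
  · rw [integrable_indicator_iff measurableSet_closedBall]
    exact integrableOn_const (measure_closedBall_lt_top.ne)
  · have hall : ∀ᵐ v, ∀ i ∈ s, T (b i) v = ∫ w, a v w * b i w := by
      rw [Finset.eventually_all]
      exact fun i _ => hT (b i)
    filter_upwards [hall] with v hv
    refine le_trans (le_of_eq ?_) ((b.orthonormal.sum_inner_products_le (hav v).toLp
      (s := s)).trans (hnorm v))
    refine Finset.sum_congr rfl fun i hi => ?_
    rw [hv i hi, Real.norm_eq_abs, sq_abs, L2_inner]
    congr 1
    refine integral_congr_ae ?_
    filter_upwards [(hav v).coeFn_toLp] with w hw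
    rw [hw, mul_comm]

/-- A kernel that decays relative to `decay (v - w)` as `v → ∞` is the norm limit of its truncations
to bounded `v`. -/
theorem isCompactOperator_kernelOp {a : Vel → Vel → ℝ}
    (ha : Measurable (Function.uncurry a)) {B : ℝ} (hB : 0 ≤ B)
    (hab : ∀ v w, |a v w| ≤ B * decay (v - w))
    (hlim : ∀ ε > 0, ∃ R : ℝ, ∀ v, R < ‖v‖ → ∀ w, |a v w| ≤ ε * decay (v - w))
    {T : L2Vel →L[ℝ] L2Vel} (hT : ∀ F : L2Vel, T F =ᵐ[volume] fun v => ∫ w, a v w * F w) :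
    IsCompactOperator T := by
  set t : ℕ → Vel → Vel → ℝ := fun n v w => (Metric.closedBall (0 : Vel) n).indicator
    (fun v => a v w) v with ht
  have htm : ∀ n, Measurable (Function.uncurry (t n)) := by
    intro n
    have : Function.uncurry (t n) = (Prod.fst ⁻¹' Metric.closedBall (0 : Vel) n).indicator
        (Function.uncurry a) := by
      funext p
      by_cases hp : p.1 ∈ Metric.closedBall (0 : Vel) n <;>
        simp [ht, Function.uncurry, indicator]
    rw [this]
    exact ha.indicator (measurable_fst measurableSet_closedBall)
  have htb : ∀ n v w, |t n v w| ≤ B * decay (v - w) := by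
    intro n v w
    by_cases hv : v ∈ Metric.closedBall (0 : Vel) n
    · simp only [ht, indicator_of_mem hv]; exact hab v w
    · simp only [ht, indicator_of_notMem hv, abs_zero]
      exact mul_nonneg hB (decay_nonneg _)
  choose S hS hSn using fun n => exists_kernelOp (htm n) hB (htb n)
  refine isCompactOperator_of_tendsto (l := Filter.atTop) (F := S) (f := T) ?_
    (Filter.Eventually.of_forall fun n => isCompactOperator_of_bounded_support (htm n) (R := n)
      (htb n) (fun v hv w => indicator_of_notMem (by simpa using hv) _) (hS n))
  rw [Metric.tendsto_atTop]
  intro ε hε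
  have hM := decayMass_nonneg
  set ε' := ε / (2 * (decayMass + 1)) with hε'
  have hε'0 : 0 < ε' := by positivity
  obtain ⟨R, hR⟩ := hlim ε' hε'0
  obtain ⟨N, hN⟩ := exists_nat_ge R
  refine ⟨N, fun n hn => ?_⟩
  have hdb : ∀ v w, |a v w - t n v w| ≤ ε' * decay (v - w) := by
    intro v w
    by_cases hv : v ∈ Metric.closedBall (0 : Vel) n
    · simp only [ht, indicator_of_mem hv, sub_self, abs_zero]
      exact mul_nonneg hε'0.le (decay_nonneg _)
    · simp only [ht, indicator_of_notMem hv, sub_zero]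
      refine hR v (lt_of_le_of_lt (hN.trans (Nat.cast_le.2 hn)) ?_) w
      simpa using hv
  obtain ⟨D, hD, hDn⟩ := exists_kernelOp (a := fun v w => a v w - t n v w) (ha.sub (htm n))
    hε'0.le hdb
  have e : D = T - S n := by
    ext1 F
    refine Lp.ext ?_
    filter_upwards [hD F, hT F, hS n F, Lp.coeFn_sub (T F) (S n F)] with v h1 h2 h3 h4
    rw [_root_.sub_apply, h4, Pi.sub_apply, h1, h2, h3, ← integral_sub
      (integrable_of_abs_le_decay ha.of_uncurry_left (hab v) (Lp.memLp F))
      (integrable_of_abs_le_decay (htm n).of_uncurry_left (htb n v) (Lp.memLp F))]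
    simp only [sub_mul]
  rw [dist_comm, dist_eq_norm, ← e]
  refine lt_of_le_of_lt hDn ?_
  rw [hε', div_mul_eq_mul_div, div_lt_iff₀ (by positivity)]
  nlinarith

/-- The Fredholm alternative for a compact symmetric operator. -/
theorem exists_sub_eq_of_orthogonal {E : Type*} [NormedAddCommGroup E]
    [InnerProductSpace ℝ E] [CompleteSpace E] {A : E →L[ℝ] E} (hA : IsCompactOperator A)
    (hs : ∀ x y, inner ℝ (A x) y = inner ℝ x (A y)) {z : E}
    (hz : ∀ y, A y = y → inner ℝ y z = 0) : ∃ y, y - A y = z := by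
  set N : Submodule ℝ E := LinearMap.ker ((ContinuousLinearMap.id ℝ E - A : E →L[ℝ] E) : E →ₗ[ℝ] E)
    with hN
  have hmem : ∀ y, y ∈ N ↔ A y = y := by
    intro y
    simp [hN, LinearMap.mem_ker, sub_eq_zero, eq_comm (a := y)]
  have hinv : ∀ y ∈ Nᗮ, A y ∈ Nᗮ := by
    intro y hy x hx
    rw [← hs, (hmem x).1 hx]
    exact hy x hx
  have hzN : z ∈ Nᗮ := fun y hy => hz y ((hmem y).1 hy)
  let A' : Nᗮ →L[ℝ] Nᗮ := (A.comp Nᗮ.subtypeL).codRestrict Nᗮ fun y => hinv y y.2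
  have hA' : IsCompactOperator A' :=
    IsCompactOperator.codRestrict (f := A.comp Nᗮ.subtypeL) (hA.comp_clm Nᗮ.subtypeL)
      (fun y => hinv y y.2) (Submodule.isClosed_orthogonal N)
  rcases hA'.hasEigenvalue_or_mem_resolventSet (one_ne_zero : (1 : ℝ) ≠ 0) with h | h
  · -- an eigenvector for the eigenvalue one would lie in `N ∩ Nᗮ`
    exfalso
    obtain ⟨y, hy⟩ := h.exists_hasEigenvector
    have h1 : A' y = y := by simpa using hy.apply_eq_smul
    have h2 : (y : E) ∈ N := (hmem _).2 (congrArg Subtype.val h1)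
    have h3 : inner ℝ (y : E) (y : E) = 0 := y.2 y h2
    exact hy.2 (Subtype.ext (inner_self_eq_zero.1 h3))
  · rw [spectrum.mem_resolventSet_iff, ContinuousLinearMap.isUnit_iff_bijective] at h
    obtain ⟨y, hy⟩ := h.2 ⟨z, hzN⟩
    refine ⟨y, ?_⟩
    have := congrArg Subtype.val hy
    have hA'y : ((A' y : Nᗮ) : E) = A y := rfl
    simpa [hA'y] using this

/-! ### Collisions as measure preserving involutions -/

theorem MeasurePreserving.withDensity_of_invariant {α : Type*} [MeasurableSpace α] {μ : Measure α}
    {f : α → α} (hf : MeasurePreserving f μ μ) {d : α → ℝ≥0∞} (hd : Measurable d)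
    (hdf : ∀ x, d (f x) = d x) :
    MeasurePreserving f (μ.withDensity d) (μ.withDensity d) := by
  refine ⟨hf.measurable, Measure.ext fun s hs => ?_⟩
  rw [Measure.map_apply hf.measurable hs, withDensity_apply _ (hf.measurable hs),
    withDensity_apply _ hs, ← hf.setLIntegral_comp_preimage hs hd]
  simp only [hdf]

theorem MeasurePreserving.integral_comp_of_aesm {α : Type*} [MeasurableSpace α] {μ : Measure α}
    {f : α → α} (hf : MeasurePreserving f μ μ) {g : α → ℝ} (hg : AEStronglyMeasurable g μ) :
    ∫ x, g (f x) ∂μ = ∫ x, g x ∂μ := by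
  have h := integral_map (φ := f) (f := g) hf.measurable.aemeasurable (by rwa [hf.map_eq])
  rw [hf.map_eq] at h
  exact h.symm

theorem inner_sphere_self (n : Sphere) : inner ℝ (n : Vel) (n : Vel) = 1 := by
  rw [real_inner_self_eq_norm_sq, norm_sphere, one_pow]

theorem inner_postVel_sub (v w : Vel) (n : Sphere) :
    inner ℝ (postVel v w n - postVelPartner v w n) (n : Vel) = -inner ℝ (v - w) (n : Vel) := by
  simp only [postVel, postVelPartner, inner_sub_left, inner_add_left, inner_smul_left,
    inner_sphere_self, conj_trivial]
  ring

theorem postVel_postVel (v w : Vel) (n : Sphere) :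
    postVel (postVel v w n) (postVelPartner v w n) n = v := by
  rw [postVel, inner_postVel_sub, postVel]
  module

theorem postVelPartner_postVel (v w : Vel) (n : Sphere) :
    postVelPartner (postVel v w n) (postVelPartner v w n) n = w := by
  rw [postVelPartner, inner_postVel_sub, postVelPartner]
  module

theorem postVel_swap (v w n : Vel) : postVel w v n = postVelPartner v w n := by
  rw [postVel, postVelPartner, ← neg_sub v w, inner_neg_left]
  module

theorem postVelPartner_swap (v w n : Vel) : postVelPartner w v n = postVel v w n := by
  rw [postVel, postVelPartner, ← neg_sub v w, inner_neg_left]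
  module

/-- The pair of outgoing velocities. -/
def collide (n : Sphere) (p : Vel × Vel) : Vel × Vel :=
  (postVel p.1 p.2 n, postVelPartner p.1 p.2 n)

theorem collide_collide (n : Sphere) (p : Vel × Vel) : collide n (collide n p) = p :=
  Prod.ext (postVel_postVel _ _ _) (postVelPartner_postVel _ _ _)

/-- A collision is a linear involution of `ℝ⁶`, so its determinant is `±1`. -/
theorem measurePreserving_collide (n : Sphere) :
    MeasurePreserving (collide n) (volume : Measure (Vel × Vel)) volume := by
  let f : Vel × Vel →ₗ[ℝ] Vel × Vel :=
    { toFun := collide n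
      map_add' := by
        intro p q
        refine Prod.ext ?_ ?_ <;>
        · simp only [collide, postVel, postVelPartner, Prod.fst_add, Prod.snd_add, inner_sub_left,
            inner_add_left]
          module
      map_smul' := by
        intro c p
        refine Prod.ext ?_ ?_ <;>
        · simp only [collide, postVel, postVelPartner, Prod.smul_fst, Prod.smul_snd, inner_sub_left,
            inner_smul_left, RingHom.id_apply, conj_trivial]
          module }
  have hff : f.comp f = LinearMap.id := LinearMap.ext fun p => collide_collide n p
  have hdet : LinearMap.det f * LinearMap.det f = 1 := by
    rw [← LinearMap.det_comp, hff, LinearMap.det_id]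
  have h0 : LinearMap.det f ≠ 0 := left_ne_zero_of_mul_eq_one hdet
  have habs : |(LinearMap.det f)⁻¹| = 1 := by
    rw [abs_inv, inv_eq_one]
    rcases mul_self_eq_one_iff.1 hdet with h | h <;> simp [h]
  have : (volume : Measure (Vel × Vel)).IsAddHaarMeasure :=
    Measure.prod.instIsAddHaarMeasure volume volume
  have h := Measure.map_linearMap_addHaar_eq_smul_addHaar (volume : Measure (Vel × Vel)) h0
  rw [habs, ENNReal.ofReal_one, one_smul] at h
  exact ⟨f.continuous_of_finiteDimensional.measurable, h⟩

/-- The collision space: an impact direction and the two incoming velocities, with the product of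
surface and Lebesgue measures. -/
abbrev collisionMeasure : Measure (Sphere × Vel × Vel) := surf.prod volume

/-- The collision rate in the standard Maxwellian gas. -/
def collisionRate (p : Sphere × Vel × Vel) : ℝ :=
  crossSection p.1 (p.2.1 - p.2.2) * (stdMaxwellian p.2.1 * stdMaxwellian p.2.2)

theorem collisionRate_nonneg (p : Sphere × Vel × Vel) : 0 ≤ collisionRate p :=
  mul_nonneg (crossSection_nonneg _ _)
    (mul_nonneg (stdMaxwellian_pos _).le (stdMaxwellian_pos _).le)

@[fun_prop]
theorem measurable_collisionRate : Measurable collisionRate := by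
  unfold collisionRate; fun_prop

/-- The measure counting collisions in the standard Maxwellian gas. -/
def ratedMeasure : Measure (Sphere × Vel × Vel) :=
  collisionMeasure.withDensity fun p => ENNReal.ofReal (collisionRate p)

theorem measurePreserving_rated_collide :
    MeasurePreserving (fun p : Sphere × Vel × Vel => (p.1, collide p.1 p.2))
      ratedMeasure ratedMeasure := by
  have h : MeasurePreserving (fun p : Sphere × Vel × Vel => (p.1, collide p.1 p.2))
      collisionMeasure collisionMeasure := by
    refine MeasurePreserving.skew_product (MeasurePreserving.id _) (g := collide) ?_
      (ae_of_all _ fun n => (measurePreserving_collide n).map_eq)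
    unfold collide Function.uncurry
    fun_prop
  refine MeasurePreserving.withDensity_of_invariant h (by fun_prop) fun p => ?_
  simp only [collisionRate, collide, crossSection, inner_postVel_sub, abs_neg]
  rw [mul_comm (stdMaxwellian (postVel _ _ _)), stdMaxwellian_postVel]

theorem measurePreserving_rated_swap :
    MeasurePreserving (fun p : Sphere × Vel × Vel => (p.1, p.2.swap))
      ratedMeasure ratedMeasure := by
  have h : MeasurePreserving (fun p : Sphere × Vel × Vel => (p.1, p.2.swap))
      collisionMeasure collisionMeasure :=
    (MeasurePreserving.id surf).prod Measure.measurePreserving_swap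
  refine MeasurePreserving.withDensity_of_invariant h (by fun_prop) fun p => ?_
  simp only [collisionRate, crossSection, Prod.fst_swap, Prod.snd_swap]
  rw [← neg_sub, inner_neg_left, abs_neg, mul_comm (stdMaxwellian p.2.2)]

/-- The collision space with the incoming velocity `v` as the outer variable. -/
theorem measurePreserving_regroup :
    MeasurePreserving (fun p : Sphere × Vel × Vel => (p.2.1, (p.2.2, p.1))) collisionMeasure
      ((volume : Measure Vel).prod ((volume : Measure Vel).prod surf)) :=
  (measurePreserving_prodAssoc _ _ _).comp (Measure.measurePreserving_swap (μ := surf)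
    (ν := (volume : Measure (Vel × Vel))))

theorem measurableEmbedding_regroup :
    MeasurableEmbedding (fun p : Sphere × Vel × Vel => (p.2.1, (p.2.2, p.1))) :=
  (MeasurableEquiv.prodComm.trans MeasurableEquiv.prodAssoc).measurableEmbedding

instance : SFinite ((volume : Measure Vel).prod surf) := by
  have h1 : SFinite (volume : Measure Vel) := inferInstance
  have h2 : SFinite surf := inferInstance
  exact Measure.prod.instSFinite

theorem integrable_rated_iff {g : Sphere × Vel × Vel → ℝ} :
    Integrable g ratedMeasure ↔ Integrable (fun p => collisionRate p * g p) collisionMeasure := by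
  rw [ratedMeasure, integrable_withDensity_iff_integrable_smul' (by fun_prop)
      (ae_of_all _ fun _ => ENNReal.ofReal_lt_top)]
  simp only [ENNReal.toReal_ofReal (collisionRate_nonneg _), smul_eq_mul]

theorem integral_rated (g : Sphere × Vel × Vel → ℝ) :
    ∫ p, g p ∂ratedMeasure = ∫ p, collisionRate p * g p ∂collisionMeasure := by
  rw [ratedMeasure, integral_withDensity_eq_integral_toReal_smul (by fun_prop)
      (ae_of_all _ fun _ => ENNReal.ofReal_lt_top)]
  simp only [ENNReal.toReal_ofReal (collisionRate_nonneg _), smul_eq_mul]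

theorem memLp_rated_fst {h : Vel → ℝ} (hh : Measurable h)
    (hν : Integrable fun v => freq v * (stdMaxwellian v * h v ^ 2)) :
    MemLp (fun p : Sphere × Vel × Vel => h p.2.1) 2 ratedMeasure := by
  rw [memLp_two_iff_integrable_sq (Measurable.aestronglyMeasurable (by fun_prop)),
    integrable_rated_iff]
  have h1 : Integrable (fun q : Vel × Vel × Sphere =>
      crossSection q.2.2 (q.1 - q.2.1) * stdMaxwellian q.2.1 * (stdMaxwellian q.1 * h q.1 ^ 2))
      ((volume : Measure Vel).prod ((volume : Measure Vel).prod surf)) := by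
    rw [integrable_prod_iff (Measurable.aestronglyMeasurable (by fun_prop))]
    have hl : ∀ v, _ := fun v => integral_loss (v := v)
      (h := fun _ => stdMaxwellian v * h v ^ 2) measurable_const
      ((integrable_norm_sub_mul_stdMaxwellian v).mul_const _)
    refine ⟨ae_of_all _ fun v => (hl v).1, ?_⟩
    refine hν.congr (ae_of_all _ fun v => ?_)
    have h2 : ∀ q : Vel × Sphere, ‖crossSection q.2 (v - q.1) * stdMaxwellian q.1
        * (stdMaxwellian v * h v ^ 2)‖ = crossSection q.2 (v - q.1) * stdMaxwellian q.1
        * (stdMaxwellian v * h v ^ 2) := fun q => Real.norm_of_nonneg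
      (mul_nonneg (mul_nonneg (crossSection_nonneg _ _) (stdMaxwellian_pos _).le)
        (mul_nonneg (stdMaxwellian_pos _).le (sq_nonneg _)))
    simp only [h2]
    rw [(hl v).2, integral_mul_const, freq_eq]
    ring
  have h3 := (measurePreserving_regroup.integrable_comp h1.aestronglyMeasurable).2 h1
  refine h3.congr (ae_of_all _ fun p => ?_)
  simp only [Function.comp, collisionRate]
  ring

/-- The dissipation identity for the linearized collision operator: by the symmetries of the collision
measure, each of the four terms of the defect contributes the same amount. -/
theorem dissipation {h : Vel → ℝ} (hh : Measurable h)
    (hF : MemLp (fun w => sqrtMaxwellian w * h w) 2)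
    (hν : Integrable fun v => freq v * (stdMaxwellian v * h v ^ 2)) :
    Integrable (fun p : Sphere × Vel × Vel => defect h p.2.1 p.2.2 p.1 ^ 2) ratedMeasure ∧
    ∫ p : Sphere × Vel × Vel, defect h p.2.1 p.2.2 p.1 ^ 2 ∂ratedMeasure
      = -(4 * ∫ v, (sqrtMaxwellian v * h v) * (gainOp (fun w => sqrtMaxwellian w * h w) v
          - freq v * (sqrtMaxwellian v * h v))) := by
  set A₁ : Sphere × Vel × Vel → ℝ := fun p => h p.2.1 with hA₁
  set A₂ : Sphere × Vel × Vel → ℝ := fun p => h p.2.2 with hA₂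
  set A₃ : Sphere × Vel × Vel → ℝ := fun p => h (postVel p.2.1 p.2.2 p.1) with hA₃
  set A₄ : Sphere × Vel × Vel → ℝ := fun p => h (postVelPartner p.2.1 p.2.2 p.1) with hA₄
  set D : Sphere × Vel × Vel → ℝ := fun p => defect h p.2.1 p.2.2 p.1 with hD
  have m₁ : MemLp A₁ 2 ratedMeasure := memLp_rated_fst hh hν
  have m₂ : MemLp A₂ 2 ratedMeasure := m₁.comp_measurePreserving measurePreserving_rated_swap
  have m₃ : MemLp A₃ 2 ratedMeasure := m₁.comp_measurePreserving measurePreserving_rated_collide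
  have m₄ : MemLp A₄ 2 ratedMeasure := m₂.comp_measurePreserving measurePreserving_rated_collide
  have mD : MemLp D 2 ratedMeasure := ((m₃.add m₄).sub m₁).sub m₂
  have i₁ : Integrable (fun p => A₁ p * D p) ratedMeasure := m₁.integrable_mul mD
  have i₂ : Integrable (fun p => A₂ p * D p) ratedMeasure := m₂.integrable_mul mD
  have i₃ : Integrable (fun p => A₃ p * D p) ratedMeasure := m₃.integrable_mul mD
  have i₄ : Integrable (fun p => A₄ p * D p) ratedMeasure := m₄.integrable_mul mD
  have e₂ : ∫ p, A₂ p * D p ∂ratedMeasure = ∫ p, A₁ p * D p ∂ratedMeasure := by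
    rw [← MeasurePreserving.integral_comp_of_aesm measurePreserving_rated_swap
      i₁.aestronglyMeasurable]
    refine integral_congr_ae (ae_of_all _ fun p => ?_)
    simp only [hA₁, hA₂, hD, defect, Prod.fst_swap, Prod.snd_swap,
      postVel_swap p.2.1 p.2.2, postVelPartner_swap p.2.1 p.2.2]
    ring
  have e₃ : ∫ p, A₃ p * D p ∂ratedMeasure = -∫ p, A₁ p * D p ∂ratedMeasure := by
    rw [← MeasurePreserving.integral_comp_of_aesm measurePreserving_rated_collide
      i₁.aestronglyMeasurable, ← integral_neg]
    refine integral_congr_ae (ae_of_all _ fun p => ?_)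
    simp only [hA₁, hA₃, hD, defect, collide, postVel_postVel, postVelPartner_postVel]
    ring
  have e₄ : ∫ p, A₄ p * D p ∂ratedMeasure = -∫ p, A₂ p * D p ∂ratedMeasure := by
    rw [← MeasurePreserving.integral_comp_of_aesm measurePreserving_rated_collide
      i₂.aestronglyMeasurable, ← integral_neg]
    refine integral_congr_ae (ae_of_all _ fun p => ?_)
    simp only [hA₂, hA₄, hD, defect, collide, postVel_postVel, postVelPartner_postVel]
    ring
  refine ⟨mD.integrable_sq, ?_⟩
  have e : ∀ p, D p ^ 2 = A₃ p * D p + A₄ p * D p - A₁ p * D p - A₂ p * D p := by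
    intro p
    have : D p = A₃ p + A₄ p - A₁ p - A₂ p := rfl
    rw [sq]
    nth_rewrite 1 [this]
    ring
  have s1 := integral_sub ((i₃.add i₄).sub i₁) i₂
  have s2 := integral_sub (i₃.add i₄) i₁
  simp only [Pi.add_apply, Pi.sub_apply] at s1 s2
  refine (integral_congr_ae (ae_of_all _ e)).trans ?_
  rw [s1, s2, integral_add i₃ i₄, e₄, e₃, e₂]
  have key : ∫ p, A₁ p * D p ∂ratedMeasure
      = ∫ v, (sqrtMaxwellian v * h v) * (gainOp (fun w => sqrtMaxwellian w * h w) v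
          - freq v * (sqrtMaxwellian v * h v)) := by
    rw [integrable_rated_iff] at i₁
    rw [integral_rated]
    set g : Vel × Vel × Sphere → ℝ := fun q => stdMaxwellian q.1 * h q.1
      * (crossSection q.2.2 (q.1 - q.2.1) * stdMaxwellian q.2.1 * defect h q.1 q.2.1 q.2.2) with hg
    have hgr : ∀ p : Sphere × Vel × Vel, collisionRate p * (A₁ p * D p) = g (p.2.1, (p.2.2, p.1)) := by
      intro p
      simp only [collisionRate, hA₁, hD, hg]
      ring
    simp_rw [hgr] at i₁ ⊢
    rw [measurePreserving_regroup.integral_comp measurableEmbedding_regroup]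
    have ig : Integrable g ((volume : Measure Vel).prod ((volume : Measure Vel).prod surf)) :=
      (measurePreserving_regroup.integrable_comp_emb (g := g) measurableEmbedding_regroup).1 i₁
    rw [integral_prod _ ig]
    refine integral_congr_ae (ae_of_all _ fun v => ?_)
    simp only [hg]
    rw [integral_const_mul, ← integral_cross_defect hh hF v, ← sqrtMaxwellian_sq]
    ring
  rw [key]
  ring

theorem defect_eq_zero_of_inner_eq_zero (h : Vel → ℝ) {v w n : Vel}
    (h0 : inner ℝ (v - w) n = 0) : defect h v w n = 0 := by
  simp [defect, postVel, postVelPartner, h0]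

theorem ae_defect_eq_zero {h : Vel → ℝ} (hh : Measurable h)
    (hF : MemLp (fun w => sqrtMaxwellian w * h w) 2)
    (hν : Integrable fun v => freq v * (stdMaxwellian v * h v ^ 2))
    (h0 : ∫ v, (sqrtMaxwellian v * h v) * (gainOp (fun w => sqrtMaxwellian w * h w) v
          - freq v * (sqrtMaxwellian v * h v)) = 0) :
    ∀ᵐ p ∂collisionMeasure, defect h p.2.1 p.2.2 p.1 = 0 := by
  obtain ⟨hi, he⟩ := dissipation hh hF hν
  rw [h0, mul_zero, neg_zero, integral_eq_zero_iff_of_nonneg (fun p => sq_nonneg _) hi,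
    Filter.EventuallyEq, ratedMeasure, ae_withDensity_iff (by fun_prop)] at he
  filter_upwards [he] with p hp
  by_cases hc : collisionRate p = 0
  · -- the rate vanishes only in grazing collisions, which do not change the velocities
    refine defect_eq_zero_of_inner_eq_zero h ?_
    have h1 := (stdMaxwellian_pos p.2.1).ne'
    have h2 := (stdMaxwellian_pos p.2.2).ne'
    simpa [collisionRate, crossSection, h1, h2] using hc
  · have h1 : ENNReal.ofReal (collisionRate p) ≠ 0 := by
      simpa using lt_of_le_of_ne (collisionRate_nonneg p) (Ne.symm hc)
    simpa using hp h1

/-! ### Summational invariants under the Gaussian measure -/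

/-- The velocity distribution of the standard Maxwellian gas. -/
def gas : Measure Vel := volume.withDensity fun v => ENNReal.ofReal (stdMaxwellian v)

instance : IsProbabilityMeasure gas where
  measure_univ := by
    rw [gas, withDensity_apply _ MeasurableSet.univ, setLIntegral_univ, lintegral_stdMaxwellian]

theorem integrable_gas_iff {g : Vel → ℝ} :
    Integrable g gas ↔ Integrable (fun v => stdMaxwellian v * g v) := by
  rw [gas, integrable_withDensity_iff_integrable_smul' (by fun_prop)
      (ae_of_all _ fun _ => ENNReal.ofReal_lt_top)]
  simp only [ENNReal.toReal_ofReal (stdMaxwellian_pos _).le, smul_eq_mul]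

theorem integral_gas (g : Vel → ℝ) : ∫ v, g v ∂gas = ∫ v, stdMaxwellian v * g v := by
  rw [gas, integral_withDensity_eq_integral_toReal_smul (by fun_prop)
      (ae_of_all _ fun _ => ENNReal.ofReal_lt_top)]
  simp only [ENNReal.toReal_ofReal (stdMaxwellian_pos _).le, smul_eq_mul]

theorem memLp_gas_iff {h : Vel → ℝ} (hh : Measurable h) :
    MemLp h 2 gas ↔ MemLp (fun v => sqrtMaxwellian v * h v) 2 := by
  rw [memLp_two_iff_integrable_sq hh.aestronglyMeasurable, integrable_gas_iff,
    memLp_two_iff_integrable_sq (Measurable.aestronglyMeasurable (by fun_prop))]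
  simp only [mul_pow, sqrtMaxwellian_sq]

theorem gas_prod_gas : gas.prod gas = (volume : Measure (Vel × Vel)).withDensity fun p =>
    ENNReal.ofReal (stdMaxwellian p.1) * ENNReal.ofReal (stdMaxwellian p.2) :=
  prod_withDensity (by fun_prop) (by fun_prop)

theorem measurePreserving_gas_collide (n : Sphere) :
    MeasurePreserving (collide n) (gas.prod gas) (gas.prod gas) := by
  rw [gas_prod_gas]
  refine MeasurePreserving.withDensity_of_invariant (measurePreserving_collide n) (by fun_prop)
    fun p => ?_
  rw [← ENNReal.ofReal_mul (stdMaxwellian_pos _).le, ← ENNReal.ofReal_mul (stdMaxwellian_pos _).le,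
    collide, mul_comm, stdMaxwellian_postVel]

theorem measurePreserving_gas_isometry (R : Vel ≃ₗᵢ[ℝ] Vel) : MeasurePreserving R gas gas :=
  MeasurePreserving.withDensity_of_invariant R.measurePreserving (by fun_prop) fun v => by
    rw [stdMaxwellian_eq, stdMaxwellian_eq, R.norm_map]

theorem map_gas_inner (n : Sphere) :
    gas.map (fun v => inner ℝ (n : Vel) v) = ProbabilityTheory.gaussianReal 0 1 := by
  refine Measure.ext fun s hs => ?_
  rw [Measure.map_apply (by fun_prop) hs, ProbabilityTheory.gaussianReal_of_var_ne_zero _ one_ne_zero,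
    gas, withDensity_apply _ hs, withDensity_apply _ (by measurability),
    ← lintegral_indicator (by measurability), ← lintegral_indicator hs]
  have h := lintegral_marginal (norm_sphere n) (Ψ := s.indicator 1) (measurable_one.indicator hs)
  refine Eq.trans (lintegral_congr fun v => ?_) (h.trans (lintegral_congr fun t => ?_))
  · by_cases hv : inner ℝ (n : Vel) v ∈ s <;> simp [indicator, hv]
  · by_cases hv : t ∈ s <;>
      simp [indicator, hv, ProbabilityTheory.gaussianPDF, ProbabilityTheory.gaussianPDFReal, gauss,
        neg_div]

theorem integral_gas_inner (n : Sphere) : ∫ v, inner ℝ (n : Vel) v ∂gas = 0 := by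
  have h := integral_map (μ := gas) (φ := fun v => inner ℝ (n : Vel) v) (f := fun t => t)
    (by fun_prop) (by fun_prop)
  rw [map_gas_inner, ProbabilityTheory.integral_id_gaussianReal] at h
  exact h.symm

theorem integral_gas_inner_sq (n : Sphere) : ∫ v, inner ℝ (n : Vel) v ^ 2 ∂gas = 1 := by
  have h := integral_map (μ := gas) (φ := fun v => inner ℝ (n : Vel) v) (f := fun t => t ^ 2)
    (by fun_prop) (by fun_prop)
  rw [map_gas_inner] at h
  rw [← h]
  have h2 := ProbabilityTheory.variance_id_gaussianReal (μ := 0) (v := 1)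
  rw [ProbabilityTheory.variance_of_integral_eq_zero (by fun_prop)
    (by simp)] at h2
  simpa using h2

theorem memLp_gas_of_abs_le {g : Vel → ℝ} (hg : Measurable g) {c : ℝ} {k : ℕ}
    (h : ∀ v, |g v| ≤ c * (1 + ‖v‖ ^ k)) : MemLp g 2 gas := by
  rw [memLp_two_iff_integrable_sq hg.aestronglyMeasurable, integrable_gas_iff]
  refine (((integrable_stdMaxwellian_mul_pow 0).add
    (integrable_stdMaxwellian_mul_pow (2 * k))).const_mul (2 * c ^ 2)).mono'
    (Measurable.aestronglyMeasurable (by fun_prop)) (ae_of_all _ fun v => ?_)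
  have h1 : g v ^ 2 ≤ (c * (1 + ‖v‖ ^ k)) ^ 2 := sq_le_sq' (neg_le_of_abs_le (h v)) (le_of_abs_le (h v))
  have h2 : (1 + ‖v‖ ^ k) ^ 2 ≤ 2 * (1 + ‖v‖ ^ (2 * k)) := by
    rw [mul_comm 2 k, pow_mul]; nlinarith [sq_nonneg (1 - ‖v‖ ^ k)]
  have h3 : g v ^ 2 ≤ 2 * c ^ 2 * (1 + ‖v‖ ^ (2 * k)) := by
    rw [mul_pow] at h1; nlinarith [sq_nonneg c]
  rw [Real.norm_of_nonneg (mul_nonneg (stdMaxwellian_pos v).le (sq_nonneg _))]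
  simp only [Pi.add_apply, pow_zero, mul_one]
  nlinarith [mul_le_mul_of_nonneg_left h3 (stdMaxwellian_pos v).le]

/-- A function odd in the direction `u ⟂ n` averages to zero, by reflection in the line of `n`. -/
theorem integral_gas_mul_inner (n : Sphere) {u : Vel} (hu : inner ℝ u (n : Vel) = 0) {q : ℝ → ℝ}
    (hq : Measurable q) : ∫ v, inner ℝ u v * q (inner ℝ (n : Vel) v) ∂gas = 0 := by
  set R : Vel ≃ₗᵢ[ℝ] Vel := (Submodule.span ℝ {(n : Vel)}).reflection with hR
  have h1 : ∀ v, inner ℝ (n : Vel) (R v) = inner ℝ (n : Vel) v := fun v => by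
    have : R n = n := Submodule.reflection_mem_subspace_eq_self (Submodule.mem_span_singleton_self _)
    conv_lhs => rw [← this]
    exact R.inner_map_map _ _
  have h2 : ∀ v, inner ℝ u (R v) = -inner ℝ u v := fun v => by
    have : R u = -u := Submodule.reflection_mem_subspace_orthogonalComplement_eq_neg
      ((Submodule.mem_orthogonal_singleton_iff_inner_left).2 hu)
    rw [← R.inner_map_map u v, this, inner_neg_left, neg_neg]
  have h := MeasurePreserving.integral_comp_of_aesm (measurePreserving_gas_isometry R)
    (g := fun v => inner ℝ u v * q (inner ℝ (n : Vel) v))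
    (Measurable.aestronglyMeasurable (by fun_prop))
  simp only [h1, h2, neg_mul] at h
  rw [integral_neg] at h
  linarith

theorem inner_postVel_of_orthogonal (n : Sphere) {u : Vel} (hu : inner ℝ u (n : Vel) = 0)
    (v w : Vel) : inner ℝ u (postVel v w n) = inner ℝ u v := by
  rw [postVel, inner_sub_right, inner_smul_right, hu, mul_zero, sub_zero]

theorem inner_postVel_self (n : Sphere) (v w : Vel) :
    inner ℝ (n : Vel) (postVel v w n) = inner ℝ (n : Vel) w := by
  rw [postVel, inner_sub_right, inner_smul_right, inner_sphere_self, inner_sub_left,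
    real_inner_comm, real_inner_comm (n : Vel) w]
  ring

/-- If `h(v') + h(w') = h(v) + h(w)` for collisions in the direction `n`, then `h` is orthogonal to
`⟪u, v⟫ p(⟪n, v⟫)` whenever `u ⟂ n` and `p` has Gaussian mean zero: a collision exchanges the
components along `n` and leaves those along `u` alone. -/
theorem integral_invariant_mul {h : Vel → ℝ} (hh : MemLp h 2 gas) (n : Sphere)
    (hd : ∀ᵐ p ∂gas.prod gas, defect h p.1 p.2 n = 0) {u : Vel} (hu : inner ℝ u (n : Vel) = 0)
    {p : ℝ → ℝ} (hp : Measurable p) (hp1 : ∀ t, |p t| ≤ 1 + t ^ 2)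
    (hp0 : ∫ v, p (inner ℝ (n : Vel) v) ∂gas = 0) :
    ∫ v, h v * (inner ℝ u v * p (inner ℝ (n : Vel) v)) ∂gas = 0 := by
  have hn : ∀ v, |inner ℝ (n : Vel) v| ≤ ‖v‖ := fun v => by
    simpa [norm_sphere] using abs_real_inner_le_norm (n : Vel) v
  have hnp : ∀ v, |p (inner ℝ (n : Vel) v)| ≤ 1 + ‖v‖ ^ 2 := fun v =>
    (hp1 _).trans (by gcongr 1 + ?_; exact sq_le_sq.2 (by simpa using hn v))
  have mα : MemLp (fun v => inner ℝ u v) 2 gas := by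
    refine memLp_gas_of_abs_le (by fun_prop) (c := ‖u‖) (k := 1) fun v => ?_
    have := abs_real_inner_le_norm u v
    nlinarith [norm_nonneg u]
  have mp : MemLp (fun v => p (inner ℝ (n : Vel) v)) 2 gas :=
    memLp_gas_of_abs_le (by fun_prop) (c := 1) (k := 2) fun v => by simpa using hnp v
  have mψ : MemLp (fun v => inner ℝ u v * p (inner ℝ (n : Vel) v)) 2 gas := by
    refine memLp_gas_of_abs_le (by fun_prop) (c := 2 * ‖u‖) (k := 3) fun v => ?_
    rw [abs_mul]
    have h1 := mul_le_mul (abs_real_inner_le_norm u v) (hnp v) (abs_nonneg _) (by positivity)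
    refine h1.trans ?_
    have h2 : ‖v‖ ≤ 1 + ‖v‖ ^ 3 := by
      rcases le_total ‖v‖ 1 with h | h
      · nlinarith [pow_nonneg (norm_nonneg v) 3]
      · nlinarith [le_self_pow₀ h (n := 3) (by norm_num)]
    nlinarith [mul_le_mul_of_nonneg_left h2 (norm_nonneg u), norm_nonneg u,
      mul_nonneg (norm_nonneg u) (pow_nonneg (norm_nonneg v) 3)]
  have i1 : Integrable (fun _ : Vel => (1 : ℝ)) gas := integrable_const _
  have ih := hh.integrable one_le_two
  have iα := mα.integrable one_le_two
  have ip := mp.integrable one_le_two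
  have iψ := mψ.integrable one_le_two
  have ihψ : Integrable (fun v => h v * (inner ℝ u v * p (inner ℝ (n : Vel) v))) gas :=
    hh.integrable_mul mψ
  have ihα : Integrable (fun v => h v * inner ℝ u v) gas := hh.integrable_mul mα
  have ihp : Integrable (fun v => h v * p (inner ℝ (n : Vel) v)) gas := hh.integrable_mul mp
  -- both sides of the detailed balance, as sums of products
  have k1 : ∫ x : Vel × Vel, (h x.1 * (inner ℝ u x.1 * p (inner ℝ (n : Vel) x.1)) * 1
      + (inner ℝ u x.1 * p (inner ℝ (n : Vel) x.1)) * h x.2) ∂gas.prod gas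
      = ∫ v, h v * (inner ℝ u v * p (inner ℝ (n : Vel) v)) ∂gas := by
    rw [integral_add (ihψ.mul_prod i1) (iψ.mul_prod ih),
      integral_prod_mul (fun v => h v * (inner ℝ u v * p (inner ℝ (n : Vel) v))) (fun _ => (1 : ℝ)),
      integral_prod_mul (fun v => inner ℝ u v * p (inner ℝ (n : Vel) v)) h,
      integral_gas_mul_inner n hu hp]
    simp
  have i2 := (ihα.mul_prod ip).add (iα.mul_prod ihp)
  have k2 : ∫ x : Vel × Vel, (h x.1 * inner ℝ u x.1 * p (inner ℝ (n : Vel) x.2)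
      + inner ℝ u x.1 * (h x.2 * p (inner ℝ (n : Vel) x.2))) ∂gas.prod gas = 0 := by
    rw [integral_add (ihα.mul_prod ip) (iα.mul_prod ihp),
      integral_prod_mul (fun v => h v * inner ℝ u v) (fun v => p (inner ℝ (n : Vel) v)),
      integral_prod_mul (fun v => inner ℝ u v) (fun v => h v * p (inner ℝ (n : Vel) v)), hp0]
    have := integral_gas_mul_inner n hu (q := fun _ => 1) measurable_const
    simp only [mul_one] at this
    rw [this]
    simp
  have k3 := MeasurePreserving.integral_comp_of_aesm (measurePreserving_gas_collide n)
    i2.aestronglyMeasurable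
  simp only [Pi.add_apply] at k3
  rw [k2] at k3
  rw [← k1, ← k3]
  refine integral_congr_ae ?_
  filter_upwards [hd] with x hx
  rw [defect] at hx
  have e1 : inner ℝ (n : Vel) (postVelPartner x.1 x.2 n) = inner ℝ (n : Vel) x.1 := by
    rw [← postVel_swap, inner_postVel_self]
  simp only [collide, inner_postVel_of_orthogonal n hu, e1]
  linear_combination (-(inner ℝ u x.1 * p (inner ℝ (n : Vel) x.1))) * hx

theorem abs_test_le (n : Sphere) (c v : Vel) {p : ℝ → ℝ} (hp1 : ∀ t, |p t| ≤ 1 + t ^ 2) :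
    |(inner ℝ c v - inner ℝ c (n : Vel) * inner ℝ (n : Vel) v) * p (inner ℝ (n : Vel) v)|
      ≤ 2 * ‖c‖ * (‖v‖ * (1 + ‖v‖ ^ 2)) := by
  have hn : |inner ℝ (n : Vel) v| ≤ ‖v‖ := by
    simpa [norm_sphere] using abs_real_inner_le_norm (n : Vel) v
  have hc : |inner ℝ c (n : Vel)| ≤ ‖c‖ := by
    simpa [norm_sphere] using abs_real_inner_le_norm c (n : Vel)
  have hnp : |p (inner ℝ (n : Vel) v)| ≤ 1 + ‖v‖ ^ 2 :=
    (hp1 _).trans (by gcongr 1 + ?_; exact sq_le_sq.2 (by simpa using hn))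
  rw [abs_mul, ← mul_assoc]
  refine mul_le_mul ?_ hnp (abs_nonneg _) (by positivity)
  refine (abs_sub _ _).trans ?_
  rw [abs_mul]
  have := mul_le_mul hc hn (abs_nonneg _) (norm_nonneg c)
  linarith [abs_real_inner_le_norm c v]

theorem memLp_testBound (c : Vel) :
    MemLp (fun v : Vel => 2 * ‖c‖ * (‖v‖ * (1 + ‖v‖ ^ 2))) 2 gas := by
  refine memLp_gas_of_abs_le (by fun_prop) (c := 4 * ‖c‖) (k := 3) fun v => ?_
  rw [abs_of_nonneg (by positivity)]
  have h2 : ‖v‖ ≤ 1 + ‖v‖ ^ 3 := by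
    rcases le_total ‖v‖ 1 with h | h
    · nlinarith [pow_nonneg (norm_nonneg v) 3]
    · nlinarith [le_self_pow₀ h (n := 3) (by norm_num)]
  nlinarith [mul_le_mul_of_nonneg_left h2 (norm_nonneg c), norm_nonneg c,
    mul_nonneg (norm_nonneg c) (pow_nonneg (norm_nonneg v) 3)]

theorem memLp_test (n : Sphere) (c : Vel) {p : ℝ → ℝ} (hp : Measurable p)
    (hp1 : ∀ t, |p t| ≤ 1 + t ^ 2) :
    MemLp (fun v => (inner ℝ c v - inner ℝ c (n : Vel) * inner ℝ (n : Vel) v)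
      * p (inner ℝ (n : Vel) v)) 2 gas :=
  (memLp_testBound c).mono' (Measurable.aestronglyMeasurable (by fun_prop))
    (ae_of_all _ fun v => abs_test_le n c v hp1)

/-- The orthogonality relations hold for every direction `n`, as they hold for almost every `n` and
both sides are continuous in `n`. -/
theorem integral_invariant_mul_of_ae {h : Vel → ℝ} (hm : Measurable h) (hh : MemLp h 2 gas)
    (hd : ∀ᵐ p ∂collisionMeasure, defect h p.2.1 p.2.2 p.1 = 0) (n : Sphere) (c : Vel)
    {p : ℝ → ℝ} (hp : Continuous p) (hp1 : ∀ t, |p t| ≤ 1 + t ^ 2)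
    (hp0 : ∀ n : Sphere, ∫ v, p (inner ℝ (n : Vel) v) ∂gas = 0) :
    ∫ v, h v * ((inner ℝ c v - inner ℝ c (n : Vel) * inner ℝ (n : Vel) v)
      * p (inner ℝ (n : Vel) v)) ∂gas = 0 := by
  set J : Sphere → ℝ := fun n => ∫ v, h v * ((inner ℝ c v - inner ℝ c (n : Vel)
    * inner ℝ (n : Vel) v) * p (inner ℝ (n : Vel) v)) ∂gas with hJ
  have hae : J =ᵐ[surf] fun _ => 0 := by
    filter_upwards [Measure.ae_ae_of_ae_prod hd] with n hn
    have hd' : ∀ᵐ x ∂gas.prod gas, defect h x.1 x.2 n = 0 := by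
      rw [gas_prod_gas]
      exact (withDensity_absolutelyContinuous _ _).ae_le hn
    have hu : inner ℝ (c - inner ℝ c (n : Vel) • (n : Vel)) (n : Vel) = 0 := by
      rw [inner_sub_left, inner_smul_left, inner_sphere_self]; simp
    have := integral_invariant_mul hh n hd' hu hp.measurable hp1 (hp0 n)
    simpa only [inner_sub_left, inner_smul_left, conj_trivial] using this
  have hcont : Continuous J := by
    have mh : MemLp (fun v => |h v|) 2 gas := hh.norm
    have ib : Integrable (fun v => |h v| * (2 * ‖c‖ * (‖v‖ * (1 + ‖v‖ ^ 2)))) gas :=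
      mh.integrable_mul (memLp_testBound c)
    refine continuous_of_dominated (bound := fun v => |h v| * (2 * ‖c‖ * (‖v‖ * (1 + ‖v‖ ^ 2))))
      (fun n => Measurable.aestronglyMeasurable (by have := hp.measurable; fun_prop))
      (fun n => ae_of_all _ fun v => ?_)
      ib (ae_of_all _ fun v => ?_)
    rotate_left
    · have h1 : Continuous fun n : Sphere => inner ℝ (n : Vel) v := by fun_prop
      have h2 : Continuous fun n : Sphere => inner ℝ c (n : Vel) := by fun_prop
      exact continuous_const.mul ((continuous_const.sub (h2.mul h1)).mul (hp.comp h1))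
    rw [Real.norm_eq_abs, abs_mul]
    exact mul_le_mul_of_nonneg_left (abs_test_le n c v hp1) (abs_nonneg _)
  exact congrFun ((hcont.ae_eq_iff_eq surf continuous_const).1 hae) n

/-! ### Collision invariants are orthogonal to the transport sources -/

/-- The unit vector with coordinates `a, b, c`. -/
def unitVec (a b c : ℝ) (h : a ^ 2 + b ^ 2 + c ^ 2 = 1) : Sphere :=
  ⟨!₂[a, b, c], by
    rw [mem_sphere_zero_iff_norm, EuclideanSpace.norm_eq, Fin.sum_univ_three]
    simp [h]⟩

theorem inner_unitVec {a b c : ℝ} (h : a ^ 2 + b ^ 2 + c ^ 2 = 1) (v : Vel) :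
    inner ℝ (unitVec a b c h : Vel) v = a * v 0 + b * v 1 + c * v 2 := by
  simp [unitVec, PiLp.inner_apply, Fin.sum_univ_three, mul_comm]

theorem inner_single_one (v : Vel) : inner ℝ (EuclideanSpace.single 1 1 : Vel) v = v 1 := by
  simp [EuclideanSpace.inner_single_left]

theorem unitVec_one {a b c : ℝ} (h : a ^ 2 + b ^ 2 + c ^ 2 = 1) : (unitVec a b c h : Vel) 1 = b :=
  rfl

theorem norm_sq_eq_coords (v : Vel) : ‖v‖ ^ 2 = v 0 ^ 2 + v 1 ^ 2 + v 2 ^ 2 := by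
  rw [EuclideanSpace.norm_sq_eq, Fin.sum_univ_three]; simp

theorem abs_coord_le (v : Vel) (i : Fin 3) : |v i| ≤ ‖v‖ := PiLp.norm_apply_le v i

/-- A square integrable function `h` that is summationally invariant in almost every collision. -/
structure IsAEInvariant (h : Vel → ℝ) : Prop where
  measurable : Measurable h
  memLp : MemLp h 2 gas
  defect_eq_zero : ∀ᵐ p ∂collisionMeasure, defect h p.2.1 p.2.2 p.1 = 0

/-- The case `p(t) = t`, in coordinates, with test direction the `y` axis and `n = (a, b, c)`. -/
theorem IsAEInvariant.integral_mul_test_one {h : Vel → ℝ} (hh : IsAEInvariant h)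
    {a b c : ℝ} (hn : a ^ 2 + b ^ 2 + c ^ 2 = 1) :
    ∫ v, h v * ((v 1 - b * (a * v 0 + b * v 1 + c * v 2)) * (a * v 0 + b * v 1 + c * v 2)) ∂gas
      = 0 := by
  have := integral_invariant_mul_of_ae hh.measurable hh.memLp hh.defect_eq_zero (unitVec a b c hn)
    (EuclideanSpace.single 1 1) (p := fun t => t) continuous_id
    (fun t => by nlinarith [sq_nonneg (|t| - 1), sq_abs t]) integral_gas_inner
  simpa only [inner_single_one, inner_unitVec, unitVec_one] using this

/-- The case `p(t) = t² - 1`, in coordinates, with test direction the `y` axis and `n = (a, b, c)`. -/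
theorem IsAEInvariant.integral_mul_test_two {h : Vel → ℝ} (hh : IsAEInvariant h)
    {a b c : ℝ} (hn : a ^ 2 + b ^ 2 + c ^ 2 = 1) :
    Integrable (fun v => h v * ((v 1 - b * (a * v 0 + b * v 1 + c * v 2))
      * ((a * v 0 + b * v 1 + c * v 2) ^ 2 - 1))) gas ∧
    ∫ v, h v * ((v 1 - b * (a * v 0 + b * v 1 + c * v 2))
      * ((a * v 0 + b * v 1 + c * v 2) ^ 2 - 1)) ∂gas = 0 := by
  have hp1 : ∀ t : ℝ, |t ^ 2 - 1| ≤ 1 + t ^ 2 := fun t =>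
    abs_le.2 ⟨by nlinarith [sq_nonneg t], by linarith⟩
  have hp : Continuous fun t : ℝ => t ^ 2 - 1 := by fun_prop
  have h1 := integral_invariant_mul_of_ae hh.measurable hh.memLp hh.defect_eq_zero
    (unitVec a b c hn) (EuclideanSpace.single 1 1) hp hp1 fun n => by
      have i : MemLp (fun v => inner ℝ (n : Vel) v) 2 gas := by
        refine memLp_gas_of_abs_le (by fun_prop) (c := 1) (k := 1) fun v => ?_
        have := abs_real_inner_le_norm (n : Vel) v
        rw [norm_sphere] at this
        linarith
      rw [integral_sub i.integrable_sq (integrable_const _), integral_gas_inner_sq]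
      simp
  have h2 := hh.memLp.integrable_mul (memLp_test (unitVec a b c hn) (EuclideanSpace.single 1 1)
    hp.measurable hp1)
  have h3 : Integrable (fun v => h v * ((inner ℝ (EuclideanSpace.single 1 1 : Vel) v
      - inner ℝ (EuclideanSpace.single 1 1 : Vel) (unitVec a b c hn : Vel)
      * inner ℝ (unitVec a b c hn : Vel) v) * (inner ℝ (unitVec a b c hn : Vel) v ^ 2 - 1))) gas := h2
  constructor
  · simpa only [inner_single_one, inner_unitVec, unitVec_one] using h3
  · simpa only [inner_single_one, inner_unitVec, unitVec_one] using h1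

theorem IsAEInvariant.integral_mul_shear {h : Vel → ℝ} (hh : IsAEInvariant h) :
    ∫ v, h v * (v 0 * v 1) ∂gas = 0 := by
  have := hh.integral_mul_test_one (a := 1) (b := 0) (c := 0) (by norm_num)
  rw [← this]
  congr 1 with v
  ring

theorem IsAEInvariant.integral_mul_heat {h : Vel → ℝ} (hh : IsAEInvariant h) :
    ∫ v, h v * ((‖v‖ ^ 2 - 5) / 2 * v 1) ∂gas = 0 := by
  have hs : (√2)⁻¹ ^ 2 = (1 / 2 : ℝ) := by rw [inv_pow, Real.sq_sqrt zero_le_two]; norm_num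
  set s : ℝ := (√2)⁻¹
  obtain ⟨i1, e1⟩ := hh.integral_mul_test_two (a := s) (b := s) (c := 0) (by linarith)
  obtain ⟨i2, e2⟩ := hh.integral_mul_test_two (a := s) (b := -s) (c := 0) (by nlinarith)
  obtain ⟨i3, e3⟩ := hh.integral_mul_test_two (a := 1) (b := 0) (c := 0) (by norm_num)
  obtain ⟨i4, e4⟩ := hh.integral_mul_test_two (a := 0) (b := 0) (c := 1) (by norm_num)
  -- the two diagonal directions produce `v_y³`, the others restore the isotropic combination
  have key : ∀ v : Vel, h v * ((‖v‖ ^ 2 - 5) / 2 * v 1)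
      = h v * ((v 1 - s * (s * v 0 + s * v 1 + 0 * v 2)) * ((s * v 0 + s * v 1 + 0 * v 2) ^ 2 - 1))
      + h v * ((v 1 - -s * (s * v 0 + -s * v 1 + 0 * v 2))
        * ((s * v 0 + -s * v 1 + 0 * v 2) ^ 2 - 1))
      + h v * ((v 1 - 0 * (1 * v 0 + 0 * v 1 + 0 * v 2)) * ((1 * v 0 + 0 * v 1 + 0 * v 2) ^ 2 - 1))
      + 1 / 2 * (h v * ((v 1 - 0 * (0 * v 0 + 0 * v 1 + 1 * v 2))
        * ((0 * v 0 + 0 * v 1 + 1 * v 2) ^ 2 - 1))) := by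
    intro v
    have t1 : s * (s * v 0 + s * v 1 + 0 * v 2) = (v 0 + v 1) / 2 := by linear_combination (v 0 + v 1) * hs
    have t2 : (s * v 0 + s * v 1 + 0 * v 2) ^ 2 = (v 0 + v 1) ^ 2 / 2 := by
      linear_combination (v 0 + v 1) ^ 2 * hs
    have t3 : -s * (s * v 0 + -s * v 1 + 0 * v 2) = (v 1 - v 0) / 2 := by
      linear_combination (v 1 - v 0) * hs
    have t4 : (s * v 0 + -s * v 1 + 0 * v 2) ^ 2 = (v 0 - v 1) ^ 2 / 2 := by
      linear_combination (v 0 - v 1) ^ 2 * hs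
    rw [t1, t2, t3, t4, norm_sq_eq_coords]
    ring
  simp_rw [key]
  have j12 := i1.add i2
  have j123 := j12.add i3
  have a3 := integral_add j123 (i4.const_mul (1 / 2))
  have a2 := integral_add j12 i3
  simp only [Pi.add_apply] at a3 a2
  rw [a3, a2, integral_add i1 i2, integral_const_mul, e1, e2, e3, e4]
  norm_num

/-! ### Solving the linearized Boltzmann equation -/

theorem integrable_kernel_mul_mul {a : Vel → Vel → ℝ} (ha : Measurable (Function.uncurry a))
    {B : ℝ} (hB : 0 ≤ B) (hab : ∀ v w, |a v w| ≤ B * decay (v - w)) {F G : Vel → ℝ}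
    (hFm : Measurable F) (hGm : Measurable G) (hF : MemLp F 2) (hG : MemLp G 2) :
    Integrable (fun p : Vel × Vel => a p.1 p.2 * F p.2 * G p.1)
      ((volume : Measure Vel).prod volume) := by
  have ha' : Measurable fun p : Vel × Vel => a p.1 p.2 := ha
  rw [integrable_prod_iff (Measurable.aestronglyMeasurable (by fun_prop))]
  refine ⟨ae_of_all _ fun v => (integrable_of_abs_le_decay (k := fun w => a v w) (v := v)
    (ha.comp measurable_prodMk_left) (hab v) hF).mul_const (G v), ?_⟩
  have h := memLp_kernel (a := fun v w => |a v w|) (Measurable.abs ha) hB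
    (fun v w => by rw [abs_abs]; exact hab v w) (F := fun w => |F w|) hF.norm
  have hG' : MemLp (fun v => |G v|) 2 := hG.norm
  have h2 : Integrable (fun v => (∫ w, |a v w| * |F w|) * |G v|) := h.integrable_mul hG'
  refine h2.congr (ae_of_all _ fun v => ?_)
  simp only [Real.norm_eq_abs, abs_mul]
  rw [integral_mul_const]

theorem integral_kernel_comm {a : Vel → Vel → ℝ} (ha : Measurable (Function.uncurry a))
    {B : ℝ} (hB : 0 ≤ B) (hab : ∀ v w, |a v w| ≤ B * decay (v - w)) (hs : ∀ v w, a v w = a w v)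
    {F G : Vel → ℝ} (hFm : Measurable F) (hGm : Measurable G) (hF : MemLp F 2) (hG : MemLp G 2) :
    ∫ v, (∫ w, a v w * F w) * G v = ∫ v, F v * ∫ w, a v w * G w := by
  have h := integral_integral_swap (f := fun v w => a v w * F w * G v)
    (integrable_kernel_mul_mul ha hB hab hFm hGm hF hG)
  simp only [integral_mul_const] at h
  rw [h]
  refine integral_congr_ae (ae_of_all _ fun w => ?_)
  simp only
  rw [← integral_const_mul]
  refine integral_congr_ae (ae_of_all _ fun v => ?_)
  simp only
  rw [hs v w]
  ring

theorem integrable_mul_of_memLp {F G : Vel → ℝ} (hF : MemLp F 2) (hG : MemLp G 2) :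
    Integrable fun v => F v * G v := hF.integrable_mul hG

theorem memLp_gainOp {F : Vel → ℝ} (hF : MemLp F 2) : MemLp (gainOp F) 2 :=
  memLp_kernel (a := symKernel) (by unfold Function.uncurry; fun_prop) kernelBound_pos.le
    abs_symKernel_le hF

theorem integral_gainOp_comm {F G : Vel → ℝ} (hFm : Measurable F) (hGm : Measurable G)
    (hF : MemLp F 2) (hG : MemLp G 2) :
    ∫ v, gainOp F v * G v = ∫ v, F v * gainOp G v :=
  integral_kernel_comm (a := symKernel) (by unfold Function.uncurry; fun_prop) kernelBound_pos.le
    abs_symKernel_le symKernel_comm hFm hGm hF hG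

/-- `F` solves the linearized Boltzmann equation with source `P`: in terms of `h`, where
`F = √M h`, this is `𝓛 (M h) = M P`. -/
structure Solves (P F : Vel → ℝ) : Prop where
  measurable : Measurable F
  memLp : MemLp F 2
  eq : ∀ᵐ v, gainOp F v - freq v * F v = sqrtMaxwellian v * P v

/-- Right-hand sides `P` (relative to the Maxwellian) for which the linearized Boltzmann equation
is solvable. -/
structure IsSource (P : Vel → ℝ) : Prop where
  continuous : Continuous P
  memLp : MemLp P 2 gas
  orth : ∀ h, IsAEInvariant h → ∫ v, h v * P v ∂gas = 0

theorem IsSource.measurable {P : Vel → ℝ} (hP : IsSource P) : Measurable P :=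
  hP.continuous.measurable

theorem IsSource.memLp_sqrt {P : Vel → ℝ} (hP : IsSource P) :
    MemLp (fun v => sqrtMaxwellian v * P v) 2 := (memLp_gas_iff hP.measurable).1 hP.memLp

theorem isSource_zero : IsSource 0 where
  continuous := continuous_const
  memLp := MemLp.zero
  orth h _ := by simp

theorem isSource_shear : IsSource fun v => v 0 * v 1 where
  continuous := by fun_prop
  memLp := by
    refine memLp_gas_of_abs_le (by fun_prop) (c := 1) (k := 2) fun v => ?_
    rw [abs_mul]
    nlinarith [abs_coord_le v 0, abs_coord_le v 1, abs_nonneg (v 0), abs_nonneg (v 1)]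
  orth _ hh := hh.integral_mul_shear

theorem isSource_heat : IsSource fun v => (‖v‖ ^ 2 - 5) / 2 * v 1 where
  continuous := by fun_prop
  memLp := by
    refine memLp_gas_of_abs_le (by fun_prop) (c := 6) (k := 3) fun v => ?_
    have h0 := norm_nonneg v
    have h1 : |(‖v‖ ^ 2 - 5) / 2| ≤ (‖v‖ ^ 2 + 5) / 2 := abs_le.2 ⟨by nlinarith, by linarith⟩
    have h2 : ‖v‖ ≤ 1 + ‖v‖ ^ 3 := by
      rcases le_total ‖v‖ 1 with h | h
      · nlinarith [pow_nonneg h0 3]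
      · nlinarith [le_self_pow₀ h (n := 3) (by norm_num)]
    rw [abs_mul]
    have := mul_le_mul h1 (abs_coord_le v 1) (abs_nonneg _) (by positivity)
    nlinarith
  orth _ hh := hh.integral_mul_heat

theorem Solves.memLp_freq_mul {P F : Vel → ℝ} (h : Solves P F) (hP : IsSource P) :
    MemLp (fun v => freq v * F v) 2 := by
  refine ((memLp_gainOp h.memLp).sub hP.memLp_sqrt).ae_eq ?_
  filter_upwards [h.eq] with v hv
  simp only [Pi.sub_apply]
  linarith

/-- The pairing of a solution with the source does not depend on the choice of the solution, as the
linearized operator is symmetric. -/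
theorem Solves.integral_eq {P F G : Vel → ℝ} (hP : IsSource P) (hF : Solves P F)
    (hG : Solves P G) :
    ∫ v, F v * (sqrtMaxwellian v * P v) = ∫ v, G v * (sqrtMaxwellian v * P v) := by
  have e : ∀ {F G : Vel → ℝ}, Solves P F → Solves P G →
      ∫ v, F v * (sqrtMaxwellian v * P v)
        = (∫ v, F v * gainOp G v) - ∫ v, F v * (freq v * G v) := by
    intro F G hF hG
    rw [← integral_sub (integrable_mul_of_memLp hF.memLp (memLp_gainOp hG.memLp))
      (integrable_mul_of_memLp hF.memLp (hG.memLp_freq_mul hP))]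
    refine integral_congr_ae ?_
    filter_upwards [hG.eq] with v hv
    rw [← hv]
    ring
  rw [e hF hG, e hG hF, ← integral_gainOp_comm hF.measurable hG.measurable hF.memLp hG.memLp]
  congr 1
  · exact integral_congr_ae (ae_of_all _ fun v => mul_comm _ _)
  · exact integral_congr_ae (ae_of_all _ fun v => by ring)

/-- The pairing of a solution with its source is nonpositive, and it vanishes only for summational
invariants. -/
theorem Solves.dissipation {P F : Vel → ℝ} (h : Solves P F) (hP : IsSource P) :
    ∫ v, F v * (sqrtMaxwellian v * P v) ≤ 0 ∧
      (∫ v, F v * (sqrtMaxwellian v * P v) = 0 → IsAEInvariant fun v => F v / sqrtMaxwellian v) := by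
  have hF := h.measurable
  have e : ∀ v, sqrtMaxwellian v * (F v / sqrtMaxwellian v) = F v := fun v =>
    mul_div_cancel₀ _ (sqrtMaxwellian_pos v).ne'
  have hm : Measurable fun v => F v / sqrtMaxwellian v := by fun_prop
  have hL : MemLp (fun v => sqrtMaxwellian v * (F v / sqrtMaxwellian v)) 2 := by
    simp only [e]; exact h.memLp
  have hν : Integrable fun v => freq v * (stdMaxwellian v * (F v / sqrtMaxwellian v) ^ 2) := by
    refine (integrable_mul_of_memLp h.memLp (h.memLp_freq_mul hP)).congr (ae_of_all _ fun v => ?_)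
    simp only
    rw [← sqrtMaxwellian_sq, ← mul_pow, e]
    ring
  have key : ∫ v, F v * (sqrtMaxwellian v * P v) = ∫ v, (sqrtMaxwellian v * (F v / sqrtMaxwellian v))
      * (gainOp (fun w => sqrtMaxwellian w * (F w / sqrtMaxwellian w)) v
          - freq v * (sqrtMaxwellian v * (F v / sqrtMaxwellian v))) := by
    simp only [e]
    refine integral_congr_ae ?_
    filter_upwards [h.eq] with v hv
    rw [← hv]
  constructor
  · have h1 := (GhostCouette.dissipation hm hL hν).2
    rw [← key] at h1
    have h2 : 0 ≤ ∫ p : Sphere × Vel × Vel,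
        defect (fun v => F v / sqrtMaxwellian v) p.2.1 p.2.2 p.1 ^ 2 ∂ratedMeasure :=
      integral_nonneg fun p => sq_nonneg _
    linarith
  · intro h0
    exact ⟨hm, (memLp_gas_iff hm).2 hL, ae_defect_eq_zero hm hL hν (by rw [← key, h0])⟩

theorem IsAEInvariant.gainOp_eq {h : Vel → ℝ} (hh : IsAEInvariant h) :
    ∀ᵐ v, gainOp (fun w => sqrtMaxwellian w * h w) v - freq v * (sqrtMaxwellian v * h v) = 0 := by
  have hF := (memLp_gas_iff hh.measurable).1 hh.memLp
  have h1 : ∀ᵐ q ∂((volume : Measure Vel).prod ((volume : Measure Vel).prod surf)),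
      defect h q.1 q.2.1 q.2.2 = 0 := by
    rw [← measurePreserving_regroup.map_eq, measurableEmbedding_regroup.ae_map_iff]
    exact hh.defect_eq_zero
  filter_upwards [Measure.ae_ae_of_ae_prod h1] with v hv
  rw [← integral_cross_defect hh.measurable hF v]
  have : (fun p : Vel × Sphere => crossSection p.2 (v - p.1) * stdMaxwellian p.1
      * defect h v p.1 p.2) =ᵐ[(volume : Measure Vel).prod surf] fun _ => 0 := by
    filter_upwards [hv] with p hp
    rw [hp, mul_zero]
  rw [integral_congr_ae this, integral_zero, mul_zero]

theorem Solves.integral_neg {P F : Vel → ℝ} (h : Solves P F) (hP : IsSource P) {v₀ : Vel}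
    (h0 : P v₀ ≠ 0) : ∫ v, F v * (sqrtMaxwellian v * P v) < 0 := by
  obtain ⟨h1, h2⟩ := h.dissipation hP
  refine lt_of_le_of_ne h1 fun h3 => h0 ?_
  have h4 := (h2 h3).gainOp_eq
  have e : ∀ v, sqrtMaxwellian v * (F v / sqrtMaxwellian v) = F v := fun v =>
    mul_div_cancel₀ _ (sqrtMaxwellian_pos v).ne'
  simp only [e] at h4
  have h5 : P =ᵐ[volume] fun _ => 0 := by
    filter_upwards [h4, h.eq] with v hv hv'
    rw [hv] at hv'
    simpa [(sqrtMaxwellian_pos v).ne'] using hv'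
  exact congrFun ((hP.continuous.ae_eq_iff_eq volume continuous_const).1 h5) v₀

/-! ### The Fredholm alternative -/

/-- The weight `ν^(-1/2)` that symmetrizes the linearized equation. -/
def freqWeight (v : Vel) : ℝ := (√(freq v))⁻¹

theorem freqWeight_pos (v : Vel) : 0 < freqWeight v := inv_pos.2 (Real.sqrt_pos.2 (freq_pos v))

@[fun_prop]
theorem measurable_freqWeight : Measurable freqWeight := by unfold freqWeight; fun_prop

theorem freq_mul_freqWeight (v : Vel) : freq v * freqWeight v = (freqWeight v)⁻¹ := by
  rw [freqWeight, inv_inv, ← div_eq_mul_inv, Real.div_sqrt]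

theorem freqWeight_le {c : ℝ} (hc : 0 < c) {v : Vel} (h : c ≤ freq v) : freqWeight v ≤ (√c)⁻¹ :=
  inv_anti₀ (Real.sqrt_pos.2 hc) (Real.sqrt_le_sqrt h)

theorem exists_freqWeight_le : ∃ d : ℝ, 0 < d ∧ ∀ v, freqWeight v ≤ d := by
  obtain ⟨c, hc, h⟩ := le_freq
  refine ⟨(√c)⁻¹, by positivity, fun v => freqWeight_le hc ?_⟩
  nlinarith [h v, norm_nonneg v, mul_nonneg hc.le (norm_nonneg v)]

/-- `ν^(-1/2) K ν^(-1/2)`. -/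
def relKernel (v w : Vel) : ℝ := freqWeight v * symKernel v w * freqWeight w

theorem measurable_relKernel : Measurable (Function.uncurry relKernel) := by
  unfold Function.uncurry relKernel; fun_prop

theorem relKernel_comm (v w : Vel) : relKernel v w = relKernel w v := by
  rw [relKernel, relKernel, symKernel_comm]; ring

theorem abs_relKernel_le {d : ℝ} (hd : ∀ v, freqWeight v ≤ d) (v w : Vel) :
    |relKernel v w| ≤ freqWeight v * kernelBound * d * decay (v - w) := by
  have h1 := freqWeight_pos v
  have h2 := freqWeight_pos w
  rw [relKernel, abs_mul, abs_mul, abs_of_pos h1, abs_of_pos h2]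
  have h3 := mul_le_mul (abs_symKernel_le v w) (hd w) h2.le
    (mul_nonneg kernelBound_pos.le (decay_nonneg _))
  nlinarith [mul_le_mul_of_nonneg_left h3 h1.le]

theorem gainOp_freqWeight_mul (X : Vel → ℝ) (v : Vel) :
    gainOp (fun w => freqWeight w * X w) v - freq v * (freqWeight v * X v)
      = (freqWeight v)⁻¹ * ((∫ w, relKernel v w * X w) - X v) := by
  have h : ∫ w, relKernel v w * X w = freqWeight v * gainOp (fun w => freqWeight w * X w) v := by
    rw [gainOp, ← integral_const_mul]
    refine integral_congr_ae (ae_of_all _ fun w => ?_)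
    simp only [relKernel]
    ring
  rw [h, mul_sub, inv_mul_cancel_left₀ (freqWeight_pos v).ne', ← freq_mul_freqWeight]
  ring

theorem inner_toLp {F G : Vel → ℝ} (hF : MemLp F 2) (hG : MemLp G 2) :
    inner ℝ (hF.toLp F) (hG.toLp G) = ∫ v, F v * G v := by
  rw [L2_inner]
  refine integral_congr_ae ?_
  filter_upwards [hF.coeFn_toLp, hG.coeFn_toLp] with v h1 h2
  rw [h1, h2]

/-- With `Y = ν^(1/2) F` the equation becomes `Y - A Y = z`, where `A` has the kernel `relKernel`. Its
null space consists of summational invariants, by the dissipation identity, so `z` is orthogonal to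
it. -/
theorem exists_solves {P : Vel → ℝ} (hP : IsSource P) : ∃ F, Solves P F := by
  obtain ⟨d, hd0, hd⟩ := exists_freqWeight_le
  have hB : 0 ≤ d * kernelBound * d := by have := kernelBound_pos; positivity
  have hab : ∀ v w, |relKernel v w| ≤ d * kernelBound * d * decay (v - w) := fun v w =>
    (abs_relKernel_le hd v w).trans (by
      have := kernelBound_pos
      have := decay_nonneg (v - w)
      have := hd v
      gcongr)
  obtain ⟨A, hA, -⟩ := exists_kernelOp measurable_relKernel hB hab
  have hlim : ∀ ε > 0, ∃ R : ℝ, ∀ v, R < ‖v‖ → ∀ w, |relKernel v w| ≤ ε * decay (v - w) := by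
    intro ε hε
    obtain ⟨c, hc, h⟩ := le_freq
    have hk := kernelBound_pos
    refine ⟨(kernelBound * d / ε) ^ 2 / c, fun v hv w => ?_⟩
    refine (abs_relKernel_le hd v w).trans ?_
    refine mul_le_mul_of_nonneg_right ?_ (decay_nonneg _)
    rw [div_lt_iff₀ hc] at hv
    have h1 : freqWeight v ≤ (√((kernelBound * d / ε) ^ 2))⁻¹ :=
      freqWeight_le (by positivity) (by nlinarith [h v])
    rw [Real.sqrt_sq (by positivity), inv_div] at h1
    calc freqWeight v * kernelBound * d ≤ ε / (kernelBound * d) * kernelBound * d := by gcongr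
      _ = ε := by field_simp
  have hcpt := isCompactOperator_kernelOp measurable_relKernel hB hab hlim hA
  have hmeas : ∀ x : L2Vel, Measurable x := fun x => (Lp.stronglyMeasurable x).measurable
  have hsymm : ∀ x y, inner ℝ (A x) y = inner ℝ x (A y) := by
    intro x y
    rw [L2_inner, L2_inner]
    have h1 : ∫ v, A x v * y v = ∫ v, (∫ w, relKernel v w * x w) * y v := by
      refine integral_congr_ae ?_
      filter_upwards [hA x] with v hv
      rw [hv]
    have h2 : ∫ v, x v * A y v = ∫ v, x v * ∫ w, relKernel v w * y w := by
      refine integral_congr_ae ?_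
      filter_upwards [hA y] with v hv
      rw [hv]
    rw [h1, h2]
    exact integral_kernel_comm measurable_relKernel hB hab relKernel_comm (hmeas x) (hmeas y)
      (Lp.memLp x) (Lp.memLp y)
  have hwF : ∀ {X : Vel → ℝ}, Measurable X → MemLp X 2 → MemLp (fun v => freqWeight v * X v) 2 := by
    intro X hX hX2
    refine (hX2.const_mul d).mono (Measurable.aestronglyMeasurable (by fun_prop))
      (ae_of_all _ fun v => ?_)
    rw [norm_mul, norm_mul, Real.norm_of_nonneg (freqWeight_pos v).le, Real.norm_of_nonneg hd0.le]
    exact mul_le_mul_of_nonneg_right (hd v) (norm_nonneg _)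
  have hPm := hP.measurable
  have hz : MemLp (fun v => -(freqWeight v * (sqrtMaxwellian v * P v))) 2 :=
    (hwF (by fun_prop) hP.memLp_sqrt).neg
  obtain ⟨y, hy⟩ := exists_sub_eq_of_orthogonal hcpt hsymm (z := hz.toLp _) fun x hx => by
    have hs : Solves 0 fun v => freqWeight v * x v := by
      refine ⟨by have := hmeas x; fun_prop, hwF (hmeas x) (Lp.memLp x), ?_⟩
      have h1 := hA x
      rw [hx] at h1
      filter_upwards [h1] with v hv
      rw [gainOp_freqWeight_mul, ← hv]
      simp
    have hi := (hs.dissipation isSource_zero).2 (by simp)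
    have h0 := hP.orth _ hi
    rw [integral_gas] at h0
    rw [L2_inner]
    have : ∫ v, x v * hz.toLp _ v = -∫ v, stdMaxwellian v
        * (freqWeight v * x v / sqrtMaxwellian v * P v) := by
      rw [← integral_neg]
      refine integral_congr_ae ?_
      filter_upwards [hz.coeFn_toLp] with v hv
      rw [hv, ← sqrtMaxwellian_sq]
      have := (sqrtMaxwellian_pos v).ne'
      field_simp
    rw [this, h0, neg_zero]
  refine ⟨fun v => freqWeight v * y v, by have := hmeas y; fun_prop, hwF (hmeas y) (Lp.memLp y), ?_⟩
  have h1 : (fun v => y v - A y v) =ᵐ[volume] hz.toLp _ := by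
    rw [← hy]
    exact (Lp.coeFn_sub y (A y)).symm
  filter_upwards [h1, hA y, hz.coeFn_toLp] with v h1 h2 h3
  rw [gainOp_freqWeight_mul, ← h2, ← neg_sub, h1, h3, neg_neg,
    inv_mul_cancel_left₀ (freqWeight_pos v).ne']

/-! ### The transport coefficients at temperature one -/

@[fun_prop]
theorem measurable_collInvariant (β : Fin 5) : Measurable (collInvariant β) := by
  fin_cases β
  · exact measurable_const
  · exact (by fun_prop : Measurable fun v : Vel => v 0)
  · exact (by fun_prop : Measurable fun v : Vel => v 1)
  · exact (by fun_prop : Measurable fun v : Vel => v 2)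
  · exact (by fun_prop : Measurable fun v : Vel => ‖v‖ ^ 2 / 2)

theorem memLp_collInvariant (β : Fin 5) : MemLp (collInvariant β) 2 gas := by
  refine memLp_gas_of_abs_le (by fun_prop) (c := 1) (k := 2) fun v => ?_
  have h : ∀ i, |v i| ≤ 1 * (1 + ‖v‖ ^ 2) := fun i => by
    nlinarith [abs_coord_le v i, sq_nonneg (‖v‖ - 1)]
  fin_cases β
  · simp [collInvariant]
  · exact h 0
  · exact h 1
  · exact h 2
  · have h1 : |‖v‖ ^ 2 / 2| ≤ 1 * (1 + ‖v‖ ^ 2) := by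
      rw [abs_of_nonneg (by positivity)]
      nlinarith [sq_nonneg ‖v‖]
    exact h1

theorem defect_collInvariant (β : Fin 5) (v w : Vel) (n : Sphere) :
    defect (collInvariant β) v w n = 0 := by
  have h : ∀ i, postVel v w n i + postVelPartner v w n i - v i - w i = 0 := fun i => by
    simp [postVel, postVelPartner]
  have h2 := norm_sq_postVel v w n
  fin_cases β
  · simp [collInvariant, defect]
  · exact h 0
  · exact h 1
  · exact h 2
  · simp [collInvariant, defect]
    linarith

theorem isAEInvariant_collInvariant (β : Fin 5) : IsAEInvariant (collInvariant β) :=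
  ⟨measurable_collInvariant β, memLp_collInvariant β, ae_of_all _ fun _ =>
    defect_collInvariant _ _ _ _⟩

/-- The image in `L²(dv)` of a collision invariant. -/
def nullVec (β : Fin 5) (v : Vel) : ℝ := sqrtMaxwellian v * collInvariant β v

@[fun_prop]
theorem measurable_nullVec (β : Fin 5) : Measurable (nullVec β) := by unfold nullVec; fun_prop

theorem memLp_nullVec (β : Fin 5) : MemLp (nullVec β) 2 :=
  (memLp_gas_iff (measurable_collInvariant β)).1 (memLp_collInvariant β)

/-- Coefficients of the projection of `F` onto the span of the collision invariants. -/
theorem exists_coeff_orthogonal {F : Vel → ℝ} (hF : MemLp F 2) :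
    ∃ c : Fin 5 → ℝ, ∀ β, ∫ v, nullVec β v * (F v - ∑ γ, c γ * nullVec γ v) = 0 := by
  set x : Fin 5 → L2Vel := fun β => (memLp_nullVec β).toLp _ with hx
  set K : Submodule ℝ L2Vel := Submodule.span ℝ (Set.range x) with hK
  have hfin : FiniteDimensional ℝ K := FiniteDimensional.span_of_finite ℝ (Set.finite_range x)
  obtain ⟨c, hc⟩ := (Submodule.mem_span_range_iff_exists_fun ℝ).1
    (K.starProjection_apply_mem (hF.toLp F))
  refine ⟨c, fun β => ?_⟩
  have h1 : inner ℝ (x β) (hF.toLp F - K.starProjection (hF.toLp F)) = 0 :=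
    Submodule.inner_right_of_mem_orthogonal (K := K) (Submodule.subset_span (Set.mem_range_self β))
      (Submodule.sub_starProjection_mem_orthogonal _)
  rw [inner_sub_right, ← hc, inner_sum, inner_toLp] at h1
  simp only [inner_smul_right, hx, inner_toLp] at h1
  rw [← h1]
  have i : ∀ γ, Integrable fun v => c γ * (nullVec β v * nullVec γ v) := fun γ =>
    (integrable_mul_of_memLp (memLp_nullVec β) (memLp_nullVec γ)).const_mul _
  simp_rw [← integral_const_mul]
  rw [← integral_finsetSum _ fun γ _ => i γ,
    ← integral_sub (integrable_mul_of_memLp (memLp_nullVec β) hF)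
      (integrable_finsetSum _ fun γ _ => i γ)]
  refine integral_congr_ae (ae_of_all _ fun v => ?_)
  simp only [mul_sub, Finset.mul_sum]
  congr 1
  exact Finset.sum_congr rfl fun γ _ => by ring

theorem centredMaxwellian_one : centredMaxwellian 1 = stdMaxwellian := rfl

theorem Solves.isInverseImage {P F : Vel → ℝ} (h : Solves P F)
    (ho : ∀ β, ∫ v, nullVec β v * F v = 0) :
    IsInverseImage 1 (fun v => stdMaxwellian v * P v) fun v => sqrtMaxwellian v * F v := by
  have hm := h.measurable
  refine ⟨⟨by fun_prop, ?_⟩, fun β => ?_, ?_⟩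
  · refine h.memLp.integrable_sq.congr (ae_of_all _ fun v => ?_)
    simp only [centredMaxwellian_one]
    rw [mul_pow, sqrtMaxwellian_sq, inv_mul_cancel_left₀ (stdMaxwellian_pos v).ne']
  · rw [hInner, ← ho β]
    refine integral_congr_ae (ae_of_all _ fun v => ?_)
    simp only [centredMaxwellian_one, nullVec]
    have := (stdMaxwellian_pos v).ne'
    field_simp
  · filter_upwards [h.eq] with v hv
    rw [linCollision_one hm h.memLp, hv, ← sqrtMaxwellian_sq]
    ring

theorem exists_isInverseImage {P : Vel → ℝ} (hP : IsSource P) :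
    ∃ f, IsInverseImage 1 (fun v => stdMaxwellian v * P v) f := by
  obtain ⟨F, hF⟩ := exists_solves hP
  obtain ⟨c, hc⟩ := exists_coeff_orthogonal hF.memLp
  have hm := hF.measurable
  have hsum : MemLp (fun v => ∑ γ, c γ * nullVec γ v) 2 :=
    memLp_finsetSum _ fun γ _ => (memLp_nullVec γ).const_mul (c γ)
  refine ⟨_, Solves.isInverseImage (F := fun v => F v - ∑ γ, c γ * nullVec γ v)
    ⟨by fun_prop, hF.memLp.sub hsum, ?_⟩ hc⟩
  have h0 : ∀ᵐ v, ∀ γ, gainOp (nullVec γ) v - freq v * nullVec γ v = 0 :=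
    ae_all_iff.2 fun γ => (isAEInvariant_collInvariant γ).gainOp_eq
  filter_upwards [hF.eq, h0] with v h1 h2
  have i : ∀ γ, Integrable fun w => c γ * (symKernel v w * nullVec γ w) := fun γ =>
    (integrable_symKernel (memLp_nullVec γ) v).const_mul _
  have e : gainOp (fun w => F w - ∑ γ, c γ * nullVec γ w) v
      = gainOp F v - ∑ γ, c γ * gainOp (nullVec γ) v := by
    simp only [gainOp]
    simp_rw [← integral_const_mul]
    rw [← integral_finsetSum _ fun γ _ => i γ,
      ← integral_sub (integrable_symKernel hF.memLp v) (integrable_finsetSum _ fun γ _ => i γ)]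
    refine integral_congr_ae (ae_of_all _ fun w => ?_)
    simp only [mul_sub, Finset.mul_sum]
    congr 1
    exact Finset.sum_congr rfl fun γ _ => by ring
  have e2 : ∀ γ, gainOp (nullVec γ) v = freq v * nullVec γ v := fun γ => sub_eq_zero.1 (h2 γ)
  rw [e, ← h1]
  simp only [e2, mul_sub, Finset.mul_sum]
  have : ∑ γ, c γ * (freq v * nullVec γ v) = ∑ γ, freq v * (c γ * nullVec γ v) :=
    Finset.sum_congr rfl fun γ _ => by ring
  rw [this]
  ring

theorem IsInverseImage.solves {P f : Vel → ℝ}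
    (h : IsInverseImage 1 (fun v => stdMaxwellian v * P v) f) :
    Solves P fun v => f v / sqrtMaxwellian v := by
  obtain ⟨⟨hm, hi⟩, -, he⟩ := h
  have hm' : Measurable fun v => f v / sqrtMaxwellian v := by fun_prop
  have hL : MemLp (fun v => f v / sqrtMaxwellian v) 2 := by
    rw [memLp_two_iff_integrable_sq hm'.aestronglyMeasurable]
    refine hi.congr (ae_of_all _ fun v => ?_)
    simp only [centredMaxwellian_one]
    rw [div_pow, sqrtMaxwellian_sq, div_eq_inv_mul]
  refine ⟨hm', hL, ?_⟩
  filter_upwards [he] with v hv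
  have e : (fun v => sqrtMaxwellian v * (f v / sqrtMaxwellian v)) = f :=
    funext fun v => mul_div_cancel₀ _ (sqrtMaxwellian_pos v).ne'
  have h1 := linCollision_one hm' hL v
  rw [e, hv, ← sqrtMaxwellian_sq, sq, mul_assoc] at h1
  exact (mul_left_cancel₀ (sqrtMaxwellian_pos v).ne' h1).symm

theorem hInner_source (P f : Vel → ℝ) : hInner 1 f (fun v => stdMaxwellian v * P v)
    = ∫ v, f v / sqrtMaxwellian v * (sqrtMaxwellian v * P v) := by
  rw [hInner]
  refine integral_congr_ae (ae_of_all _ fun v => ?_)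
  simp only [centredMaxwellian_one]
  have h1 := (stdMaxwellian_pos v).ne'
  have h2 := (sqrtMaxwellian_pos v).ne'
  field_simp

theorem hInner_unique {P f g : Vel → ℝ} (hP : IsSource P)
    (hf : IsInverseImage 1 (fun v => stdMaxwellian v * P v) f)
    (hg : IsInverseImage 1 (fun v => stdMaxwellian v * P v) g) :
    hInner 1 f (fun v => stdMaxwellian v * P v) = hInner 1 g (fun v => stdMaxwellian v * P v) := by
  rw [hInner_source, hInner_source]
  exact hf.solves.integral_eq hP hg.solves

theorem invLinCollision_spec {T : ℝ} {g : Vel → ℝ} (h : ∃ f, IsInverseImage T g f) :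
    IsInverseImage T g (invLinCollision T g) := by
  rw [invLinCollision, dif_pos h]
  exact h.choose_spec

/-- Strict negativity of `(𝓛⁻¹ g, g)` for a nonzero source `g`. -/
theorem hInner_invLinCollision_neg {P : Vel → ℝ} (hP : IsSource P) {v₀ : Vel} (h0 : P v₀ ≠ 0) :
    hInner 1 (invLinCollision 1 fun v => stdMaxwellian v * P v) (fun v => stdMaxwellian v * P v)
      < 0 := by
  rw [hInner_source]
  exact (invLinCollision_spec (exists_isInverseImage hP)).solves.integral_neg hP h0

theorem viscSource_one : viscSource 1 = fun v => stdMaxwellian v * (v 0 * v 1) := by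
  funext v
  rw [viscSource, centredMaxwellian_one, div_one, mul_comm]

theorem heatSource_one : heatSource 1 = fun v => stdMaxwellian v * ((‖v‖ ^ 2 - 5) / 2 * v 1) := by
  funext v
  rw [heatSource, centredMaxwellian_one]
  ring

theorem viscosity_one_pos : 0 < viscosity 1 := by
  have := hInner_invLinCollision_neg isSource_shear (v₀ := !₂[1, 1, 0]) (by simp)
  rw [viscosity, viscSource_one]
  linarith

theorem conductivity_one_pos : 0 < conductivity 1 := by
  have := hInner_invLinCollision_neg isSource_heat (v₀ := !₂[0, 1, 0]) (by
    rw [norm_sq_eq_coords]; norm_num [Matrix.cons_val_two])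
  rw [conductivity, heatSource_one]
  linarith

/-! ### Dependence of the transport coefficients on the temperature -/

theorem centredMaxwellian_scale {l T : ℝ} (hl : 0 < l) (hT : 0 < T) (v : Vel) :
    centredMaxwellian (l ^ 2 * T) v = (l ^ 3)⁻¹ * centredMaxwellian T (l⁻¹ • v) := by
  have h1 : (2 * Real.pi * (l ^ 2 * T)) ^ (3 / 2 : ℝ)
      = l ^ 3 * (2 * Real.pi * T) ^ (3 / 2 : ℝ) := by
    have : 2 * Real.pi * (l ^ 2 * T) = l ^ 2 * (2 * Real.pi * T) := by ring
    rw [this, Real.mul_rpow (by positivity) (by positivity), ← Real.rpow_natCast l 2,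
      ← Real.rpow_mul hl.le, ← Real.rpow_natCast l 3]
    norm_num
  have h2 : ‖l⁻¹ • v‖ ^ 2 / (2 * T) = ‖v‖ ^ 2 / (2 * (l ^ 2 * T)) := by
    rw [norm_smul, Real.norm_of_nonneg (inv_pos.2 hl).le]
    field_simp
  rw [centredMaxwellian, centredMaxwellian, maxwellian, maxwellian, sub_zero, sub_zero, h1, h2]
  have := (Real.rpow_pos_of_pos (show 0 < 2 * Real.pi * T by positivity) (3 / 2)).ne'
  field_simp

theorem integral_comp_inv_smul {l : ℝ} (hl : 0 < l) (g : Vel → ℝ) :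
    ∫ v : Vel, g (l⁻¹ • v) = l ^ 3 * ∫ v, g v := by
  rw [Measure.integral_comp_inv_smul_of_nonneg _ _ hl.le]
  simp

theorem hInner_scale {l T : ℝ} (hl : 0 < l) (hT : 0 < T) (f g : Vel → ℝ) :
    hInner (l ^ 2 * T) (fun v => f (l⁻¹ • v)) (fun v => g (l⁻¹ • v)) = l ^ 6 * hInner T f g := by
  rw [hInner, hInner]
  have : ∀ v : Vel, (centredMaxwellian (l ^ 2 * T) v)⁻¹ * (f (l⁻¹ • v) * g (l⁻¹ • v))
      = l ^ 3 * ((centredMaxwellian T (l⁻¹ • v))⁻¹ * (f (l⁻¹ • v) * g (l⁻¹ • v))) := fun v => by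
    rw [centredMaxwellian_scale hl hT, mul_inv, inv_inv, mul_assoc]
  simp_rw [this]
  rw [integral_const_mul,
    integral_comp_inv_smul hl fun v => (centredMaxwellian T v)⁻¹ * (f v * g v)]
  ring

theorem smul_postVel (a : ℝ) (v w n : Vel) : a • postVel v w n = postVel (a • v) (a • w) n := by
  rw [postVel, postVel, ← smul_sub, inner_smul_left, smul_sub, smul_smul]; simp

theorem smul_postVelPartner (a : ℝ) (v w n : Vel) :
    a • postVelPartner v w n = postVelPartner (a • v) (a • w) n := by
  rw [postVelPartner, postVelPartner, ← smul_sub, inner_smul_left, smul_add, smul_smul]; simp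

theorem crossSection_smul {a : ℝ} (ha : 0 < a) (n V : Vel) :
    crossSection n (a • V) = a * crossSection n V := by
  rw [crossSection, crossSection, inner_smul_left, abs_mul]
  simp [abs_of_pos ha, mul_div_assoc]

/-- For hard spheres the collision operator scales with one power of the velocity. -/
theorem linCollision_scale {l T : ℝ} (hl : 0 < l) (hT : 0 < T) (f : Vel → ℝ) (v : Vel) :
    linCollision (l ^ 2 * T) (fun v => f (l⁻¹ • v)) v = l * linCollision T f (l⁻¹ • v) := by
  set M := centredMaxwellian T with hM
  set Φ : Vel → ℝ := fun w => ∫ n : Sphere, crossSection n (l⁻¹ • v - w) *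
      (M (postVelPartner (l⁻¹ • v) w n) * f (postVel (l⁻¹ • v) w n)
        + M (postVel (l⁻¹ • v) w n) * f (postVelPartner (l⁻¹ • v) w n)
        - M w * f (l⁻¹ • v) - f w * M (l⁻¹ • v)) ∂((volume : Measure Vel).toSphere) with hΦ
  have h : ∀ w : Vel, ∫ n : Sphere, crossSection n (v - w) *
      (centredMaxwellian (l ^ 2 * T) (postVelPartner v w n) * f (l⁻¹ • postVel v w n)
        + centredMaxwellian (l ^ 2 * T) (postVel v w n) * f (l⁻¹ • postVelPartner v w n)
        - centredMaxwellian (l ^ 2 * T) w * f (l⁻¹ • v)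
        - f (l⁻¹ • w) * centredMaxwellian (l ^ 2 * T) v) ∂((volume : Measure Vel).toSphere)
      = (l ^ 2)⁻¹ * Φ (l⁻¹ • w) := by
    intro w
    rw [hΦ]
    simp only
    rw [← integral_const_mul]
    refine integral_congr_ae (ae_of_all _ fun n => ?_)
    simp only [centredMaxwellian_scale hl hT, smul_postVel, smul_postVelPartner, ← smul_sub,
      crossSection_smul (inv_pos.2 hl), ← hM]
    field_simp
  have h2 : linCollision T f (l⁻¹ • v) = 2 * (1 / 2 * ∫ w, Φ w) := rfl
  rw [linCollision, collision, h2]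
  simp_rw [h]
  rw [integral_const_mul, integral_comp_inv_smul hl Φ]
  field_simp

theorem quasiMeasurePreserving_inv_smul {l : ℝ} (hl : 0 < l) :
    Measure.QuasiMeasurePreserving (fun v : Vel => l⁻¹ • v) volume volume :=
  ⟨by fun_prop, by
    rw [Measure.map_addHaar_smul _ (inv_pos.2 hl).ne']
    exact Measure.smul_absolutelyContinuous⟩

theorem IsInverseImage.const_mul {T : ℝ} {g f : Vel → ℝ} (h : IsInverseImage T g f) (c : ℝ) :
    IsInverseImage T (fun v => c * g v) fun v => c * f v := by
  refine ⟨⟨by have := h.mem.1; fun_prop, ?_⟩, fun β => ?_, ?_⟩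
  · refine (h.mem.2.const_mul (c ^ 2)).congr (ae_of_all _ fun v => ?_)
    simp only
    ring
  · have : ∀ v, (centredMaxwellian T v)⁻¹ * (collInvariant β v * centredMaxwellian T v * (c * f v))
        = c * ((centredMaxwellian T v)⁻¹ * (collInvariant β v * centredMaxwellian T v * f v)) :=
      fun v => by ring
    rw [hInner]
    simp_rw [this]
    rw [integral_const_mul, ← hInner, h.orth β, mul_zero]
  · filter_upwards [h.eq] with v hv
    have e : ∀ A B a b d e f m x : ℝ, x * (A * (c * a) + B * (c * b) - d * (c * e) - c * f * m)
        = c * (x * (A * a + B * b - d * e - f * m)) := by intros; ring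
    rw [← hv, linCollision, linCollision, collision, collision]
    simp_rw [e, integral_const_mul]
    ring

theorem collInvariant_smul (l : ℝ) (β : Fin 5) (v : Vel) :
    collInvariant β (l • v) = l ^ (![0, 1, 1, 1, 2] β : ℕ) * collInvariant β v := by
  fin_cases β <;> simp [collInvariant, norm_smul]
  rw [mul_pow, sq_abs]; ring

theorem IsInverseImage.scale {l T : ℝ} (hl : 0 < l) (hT : 0 < T) {g f : Vel → ℝ}
    (h : IsInverseImage T g f) :
    IsInverseImage (l ^ 2 * T) (fun v => l * g (l⁻¹ • v)) fun v => f (l⁻¹ • v) := by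
  have hm := h.mem.1
  refine ⟨⟨by fun_prop, ?_⟩, fun β => ?_, ?_⟩
  · have := (h.mem.2.comp_smul (inv_pos.2 hl).ne').const_mul (l ^ 3)
    refine this.congr (ae_of_all _ fun v => ?_)
    simp only [centredMaxwellian_scale hl hT, mul_inv, inv_inv]
    ring
  · set k : ℕ := ![0, 1, 1, 1, 2] β
    have e : ∀ v, collInvariant β v * centredMaxwellian (l ^ 2 * T) v
        = (l ^ 3)⁻¹ * l ^ k * (collInvariant β (l⁻¹ • v) * centredMaxwellian T (l⁻¹ • v)) := by
      intro v
      rw [collInvariant_smul, centredMaxwellian_scale hl hT]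
      have : l ^ k * l⁻¹ ^ k = 1 := by rw [← mul_pow, mul_inv_cancel₀ hl.ne', one_pow]
      linear_combination (-((l ^ 3)⁻¹ * collInvariant β v * centredMaxwellian T (l⁻¹ • v))) * this
    have h2 := hInner_scale hl hT (fun v => (l ^ 3)⁻¹ * l ^ k * (collInvariant β v * centredMaxwellian T v)) f
    simp_rw [e]
    rw [h2, hInner]
    have h3 : ∀ v, (centredMaxwellian T v)⁻¹ *
        ((l ^ 3)⁻¹ * l ^ k * (collInvariant β v * centredMaxwellian T v) * f v) = (l ^ 3)⁻¹ * l ^ k *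
        ((centredMaxwellian T v)⁻¹ * (collInvariant β v * centredMaxwellian T v * f v)) :=
      fun v => by ring
    simp_rw [h3]
    rw [integral_const_mul, ← hInner, h.orth β, mul_zero, mul_zero]
  · filter_upwards [(quasiMeasurePreserving_inv_smul hl).ae h.eq] with v hv
    rw [linCollision_scale hl hT, hv]

/-- The pairing of a source with its inverse image at temperature `l²`, by rescaling velocities. -/
theorem hInner_invLinCollision_scale {P : Vel → ℝ} (hP : IsSource P) {l c : ℝ} (hl : 0 < l)
    (hc : c ≠ 0) {g : Vel → ℝ}
    (hg : ∀ v, g v = c * (l * (stdMaxwellian (l⁻¹ • v) * P (l⁻¹ • v)))) :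
    hInner (l ^ 2) (invLinCollision (l ^ 2) g) g
      = c ^ 2 * l ^ 7 * hInner 1 (invLinCollision 1 fun v => stdMaxwellian v * P v)
          (fun v => stdMaxwellian v * P v) := by
  have h1 := invLinCollision_spec (exists_isInverseImage hP)
  have h2 : ∃ f, IsInverseImage (l ^ 2) g f := by
    have := (h1.scale hl one_pos).const_mul c
    rw [mul_one, ← funext hg] at this
    exact ⟨_, this⟩
  set f := invLinCollision (l ^ 2) g with hf
  have h3 : IsInverseImage (l ^ 2) g f := invLinCollision_spec h2
  have h4 := (h3.scale (inv_pos.2 hl) (by positivity)).const_mul c⁻¹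
  have e1 : l⁻¹ ^ 2 * l ^ 2 = 1 := by rw [← mul_pow, inv_mul_cancel₀ hl.ne', one_pow]
  have e2 : (fun v => c⁻¹ * (l⁻¹ * g (l⁻¹⁻¹ • v))) = fun v => stdMaxwellian v * P v := by
    funext v
    rw [hg, inv_inv, inv_smul_smul₀ hl.ne']
    field_simp
  rw [e1, e2] at h4
  rw [hInner_unique hP h1 h4]
  have h5 := hInner_scale hl one_pos (fun v => c⁻¹ * f (l⁻¹⁻¹ • v)) fun v => stdMaxwellian v * P v
  have e3 : ∀ v : Vel, l⁻¹⁻¹ • l⁻¹ • v = v := fun v => by rw [inv_inv, smul_inv_smul₀ hl.ne']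
  simp only [e3] at h5
  have h6 : hInner (l ^ 2) f g = c ^ 2 * l * hInner (l ^ 2 * 1) (fun v => c⁻¹ * f v)
      (fun v => stdMaxwellian (l⁻¹ • v) * P (l⁻¹ • v)) := by
    rw [hInner, hInner, ← integral_const_mul]
    refine integral_congr_ae (ae_of_all _ fun v => ?_)
    simp only
    rw [hg, mul_one]
    field_simp
  rw [h6, h5]
  ring

theorem viscosity_eq {T : ℝ} (hT : 0 < T) : viscosity T = √T * viscosity 1 := by
  have hl := Real.sqrt_pos.2 hT
  have hT2 : √T ^ 2 = T := Real.sq_sqrt hT.le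
  have h := hInner_invLinCollision_scale isSource_shear hl (c := (√T ^ 4)⁻¹) (by positivity)
    (g := viscSource T) fun v => by
      have hM := centredMaxwellian_scale hl one_pos v
      rw [mul_one, hT2, centredMaxwellian_one] at hM
      rw [viscSource, hM]
      simp only [PiLp.smul_apply, smul_eq_mul]
      nth_rewrite 1 [← hT2]
      field_simp
  rw [hT2] at h
  rw [viscosity, viscosity, h, viscSource_one]
  nth_rewrite 1 [← hT2]
  field_simp

theorem conductivity_eq {T : ℝ} (hT : 0 < T) : conductivity T = √T * conductivity 1 := by
  have hl := Real.sqrt_pos.2 hT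
  have hT2 : √T ^ 2 = T := Real.sq_sqrt hT.le
  have h := hInner_invLinCollision_scale isSource_heat hl (c := (√T ^ 5)⁻¹) (by positivity)
    (g := heatSource T) fun v => by
      have hM := centredMaxwellian_scale hl one_pos v
      rw [mul_one, hT2, centredMaxwellian_one] at hM
      rw [heatSource, hM]
      simp only [PiLp.smul_apply, smul_eq_mul, norm_smul, Real.norm_of_nonneg (inv_pos.2 hl).le]
      generalize √T = l at hT2 hl ⊢
      subst hT2
      field_simp
  rw [hT2] at h
  rw [conductivity, conductivity, h, heatSource_one]
  nth_rewrite 1 [← hT2]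
  field_simp

/-! ### The velocity profile -/

/-- The velocity equation `q(U) U' = const` on `(-π, π)` with its boundary values. -/
structure IsProfile (q : ℝ → ℝ) (Um Up : ℝ) (U : ℝ → ℝ) : Prop where
  cont : ContinuousOn U (Icc (-Real.pi) Real.pi)
  left : U (-Real.pi) = Um
  right : U Real.pi = Up
  slope : ∃ a, ∀ y ∈ Ioo (-Real.pi) Real.pi, HasDerivAt U (a / q (U y)) y

theorem neg_pi_lt_pi : -Real.pi < Real.pi := by linarith [Real.pi_pos]

theorem eq_left_of_hasDerivAt_zero {f : ℝ → ℝ} (hf : ContinuousOn f (Icc (-Real.pi) Real.pi))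
    (h : ∀ y ∈ Ioo (-Real.pi) Real.pi, HasDerivAt f 0 y) {y : ℝ}
    (hy : y ∈ Icc (-Real.pi) Real.pi) : f y = f (-Real.pi) := by
  have hle := neg_pi_lt_pi.le
  have hd : ∀ x ∈ interior (Icc (-Real.pi) Real.pi), deriv f x = 0 := fun x hx =>
    (h x (by rwa [interior_Icc] at hx)).deriv
  have hdiff : DifferentiableOn ℝ f (interior (Icc (-Real.pi) Real.pi)) := fun x hx =>
    (h x (by rwa [interior_Icc] at hx)).differentiableAt.differentiableWithinAt
  refine le_antisymm ?_ ?_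
  · exact antitoneOn_of_deriv_nonpos (convex_Icc _ _) hf hdiff (fun x hx => (hd x hx).le)
      (left_mem_Icc.2 hle) hy hy.1
  · exact monotoneOn_of_deriv_nonneg (convex_Icc _ _) hf hdiff (fun x hx => (hd x hx).ge)
      (left_mem_Icc.2 hle) hy hy.1

theorem mem_uIcc_of_hasDerivAt {U g : ℝ → ℝ} {a : ℝ}
    (hU : ContinuousOn U (Icc (-Real.pi) Real.pi)) (hg : ∀ y ∈ Ioo (-Real.pi) Real.pi, 0 ≤ g y)
    (h : ∀ y ∈ Ioo (-Real.pi) Real.pi, HasDerivAt U (a / g y) y) {y : ℝ}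
    (hy : y ∈ Icc (-Real.pi) Real.pi) : U y ∈ uIcc (U (-Real.pi)) (U Real.pi) := by
  have hle := neg_pi_lt_pi.le
  have hdiff : DifferentiableOn ℝ U (interior (Icc (-Real.pi) Real.pi)) := fun x hx =>
    (h x (by rwa [interior_Icc] at hx)).differentiableAt.differentiableWithinAt
  rcases le_total 0 a with ha | ha
  · have hm : MonotoneOn U (Icc (-Real.pi) Real.pi) :=
      monotoneOn_of_deriv_nonneg (convex_Icc _ _) hU hdiff fun x hx => by
        rw [interior_Icc] at hx
        rw [(h x hx).deriv]
        exact div_nonneg ha (hg x hx)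
    exact Icc_subset_uIcc ⟨hm (left_mem_Icc.2 hle) hy hy.1, hm hy (right_mem_Icc.2 hle) hy.2⟩
  · have hm : AntitoneOn U (Icc (-Real.pi) Real.pi) :=
      antitoneOn_of_deriv_nonpos (convex_Icc _ _) hU hdiff fun x hx => by
        rw [interior_Icc] at hx
        rw [(h x hx).deriv]
        exact div_nonpos_of_nonpos_of_nonneg ha (hg x hx)
    exact Icc_subset_uIcc' ⟨hm hy (right_mem_Icc.2 hle) hy.2, hm (left_mem_Icc.2 hle) hy hy.1⟩

/-- A primitive of `q`; it linearizes the velocity equation. -/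
def profilePrimitive (q : ℝ → ℝ) (s : ℝ) : ℝ := ∫ t in (0 : ℝ)..s, q t

section

variable {q : ℝ → ℝ} {Um Up : ℝ} {U V : ℝ → ℝ}

theorem hasDerivAt_profilePrimitive (hq : Continuous q) (s : ℝ) : HasDerivAt (profilePrimitive q) (q s) s :=
  (hq.integral_hasStrictDerivAt 0 s).hasDerivAt

theorem strictMono_profilePrimitive (hq : Continuous q) (hq1 : ∀ s, 1 ≤ q s) : StrictMono (profilePrimitive q) :=
  strictMono_of_deriv_pos fun s => by
    rw [(hasDerivAt_profilePrimitive hq s).deriv]; linarith [hq1 s]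

theorem continuous_profilePrimitive (hq : Continuous q) : Continuous (profilePrimitive q) :=
  continuous_iff_continuousAt.2 fun s => (hasDerivAt_profilePrimitive hq s).continuousAt

theorem surjective_profilePrimitive (hq : Continuous q) (hq1 : ∀ s, 1 ≤ q s) : Function.Surjective (profilePrimitive q) := by
  have hm : Monotone fun s => profilePrimitive q s - s := by
    refine monotone_of_deriv_nonneg (fun s => ?_) fun s => ?_
    · exact ((hasDerivAt_profilePrimitive hq s).sub (hasDerivAt_id s)).differentiableAt
    · have h : HasDerivAt (fun s => profilePrimitive q s - s) (q s - 1) s :=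
        (hasDerivAt_profilePrimitive hq s).sub (hasDerivAt_id s)
      rw [h.deriv]
      linarith [hq1 s]
  have h0 : profilePrimitive q 0 = 0 := by simp [profilePrimitive]
  refine (continuous_profilePrimitive hq).surjective ?_ ?_
  · refine Filter.tendsto_atTop_mono' _ ?_ Filter.tendsto_id
    filter_upwards [Filter.eventually_ge_atTop 0] with s hs
    have := hm hs
    simp only [h0] at this
    simp only [id]; linarith
  · refine Filter.tendsto_atBot_mono' _ ?_ Filter.tendsto_id
    filter_upwards [Filter.eventually_le_atBot 0] with s hs
    have := hm hs
    simp only [h0] at this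
    simp only [id]; linarith

theorem IsProfile.primitive_eq (hq : Continuous q) (hq1 : ∀ s, 1 ≤ q s) (hU : IsProfile q Um Up U) :
    ∃ a, ∀ y ∈ Icc (-Real.pi) Real.pi,
      profilePrimitive q (U y) = profilePrimitive q Um + a * (y + Real.pi) := by
  obtain ⟨hc, hl, hr, a, ha⟩ := hU
  refine ⟨a, fun y hy => ?_⟩
  have hcont : ContinuousOn (fun y => profilePrimitive q (U y) - a * (y + Real.pi))
      (Icc (-Real.pi) Real.pi) :=
    ((continuous_profilePrimitive hq).comp_continuousOn hc).sub (by fun_prop)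
  have h := eq_left_of_hasDerivAt_zero hcont (fun y hy => by
    have h1 := (hasDerivAt_profilePrimitive hq (U y)).comp y (ha y hy)
    have h2 := h1.sub (((hasDerivAt_id y).add_const Real.pi).const_mul a)
    have h3 : q (U y) * (a / q (U y)) - a * 1 = 0 := by
      rw [mul_div_cancel₀ _ (by linarith [hq1 (U y)] : q (U y) ≠ 0)]; ring
    rw [h3] at h2
    exact h2) hy
  simp only [hl] at h
  linarith

theorem IsProfile.unique (hq : Continuous q) (hq1 : ∀ s, 1 ≤ q s) (hU : IsProfile q Um Up U) (hV : IsProfile q Um Up V) {y : ℝ}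
    (hy : y ∈ Icc (-Real.pi) Real.pi) : U y = V y := by
  obtain ⟨a, ha⟩ := hU.primitive_eq hq hq1
  obtain ⟨b, hb⟩ := hV.primitive_eq hq hq1
  have hp : Real.pi ∈ Icc (-Real.pi) Real.pi := right_mem_Icc.2 neg_pi_lt_pi.le
  have h1 := ha _ hp
  have h2 := hb _ hp
  rw [hU.right] at h1
  rw [hV.right] at h2
  have h3 : a = b := by
    have : a * (Real.pi + Real.pi) = b * (Real.pi + Real.pi) := by linarith
    exact mul_right_cancel₀ (by linarith [Real.pi_pos] : Real.pi + Real.pi ≠ 0) this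
  refine (strictMono_profilePrimitive hq hq1).injective ?_
  rw [ha y hy, hb y hy, h3]

theorem exists_profile (hq : Continuous q) (hq1 : ∀ s, 1 ≤ q s) (Um Up : ℝ) : ∃ U, Continuous U ∧ IsProfile q Um Up U := by
  set e := (strictMono_profilePrimitive hq hq1).orderIsoOfSurjective _
    (surjective_profilePrimitive hq hq1) with he
  have hes : ∀ x, profilePrimitive q (e.symm x) = x := fun x => e.apply_symm_apply x
  have hse : ∀ x, e.symm (profilePrimitive q x) = x := fun x => e.symm_apply_apply x
  set a := (profilePrimitive q Up - profilePrimitive q Um) / (2 * Real.pi) with ha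
  have hc : Continuous fun y => e.symm (profilePrimitive q Um + a * (y + Real.pi)) :=
    e.symm.continuous.comp (by fun_prop)
  refine ⟨fun y => e.symm (profilePrimitive q Um + a * (y + Real.pi)), hc, hc.continuousOn, ?_, ?_,
    a, fun y _ => ?_⟩
  · simp only [neg_add_cancel, mul_zero, add_zero, hse]
  · have : profilePrimitive q Um + a * (Real.pi + Real.pi) = profilePrimitive q Up := by
      rw [ha]; field_simp [Real.pi_ne_zero]; ring
    simp only [this, hse]
  · have h1 : HasDerivAt e.symm (q (e.symm (profilePrimitive q Um + a * (y + Real.pi))))⁻¹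
        (profilePrimitive q Um + a * (y + Real.pi)) :=
      HasDerivAt.of_local_left_inverse e.symm.continuous.continuousAt
        (hasDerivAt_profilePrimitive hq _) (by linarith [hq1 (e.symm
          (profilePrimitive q Um + a * (y + Real.pi)))]) (Filter.Eventually.of_forall hes)
    have h2 : HasDerivAt (fun y => profilePrimitive q Um + a * (y + Real.pi)) (a * 1) y :=
      (((hasDerivAt_id y).add_const Real.pi).const_mul a).const_add _
    have h3 := h1.comp y h2
    rw [mul_one, inv_mul_eq_div] at h3
    exact h3

theorem IsProfile.mem_uIcc (hq1 : ∀ s, 1 ≤ q s) (hU : IsProfile q Um Up U) {y : ℝ}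
    (hy : y ∈ Icc (-Real.pi) Real.pi) : U y ∈ uIcc Um Up := by
  obtain ⟨hc, hl, hr, a, ha⟩ := hU
  have := mem_uIcc_of_hasDerivAt hc (fun y _ => zero_le_one.trans (hq1 (U y))) ha hy
  rwa [hl, hr] at this

/-- By the mean value theorem `U'` takes the laminar value somewhere, and `q(U) U'` is constant. -/
theorem IsProfile.abs_sub_laminar_le (hq1 : ∀ s, 1 ≤ q s) (hU : IsProfile q Um Up U) {ε : ℝ}
    (hε : ∀ s ∈ uIcc Um Up, q s ≤ 1 + ε) {y : ℝ} (hy : y ∈ Icc (-Real.pi) Real.pi) :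
    |U y - laminarVelocity Um Up y| ≤ |Up - Um| * ε := by
  have hmem := fun {y} => hU.mem_uIcc hq1 (y := y)
  obtain ⟨hc, hl, hr, a, ha⟩ := hU
  set m := (Up - Um) / (2 * Real.pi) with hm
  obtain ⟨ξ, hξ, hξ'⟩ := exists_hasDerivAt_eq_slope U _ neg_pi_lt_pi hc ha
  have hm' : (U Real.pi - U (-Real.pi)) / (Real.pi - -Real.pi) = m := by
    rw [hl, hr, hm]; ring
  rw [hm'] at hξ'
  have hq0 : ∀ s, 0 < q s := fun s => by linarith [hq1 s]
  have ha' : a = m * q (U ξ) := by rw [← hξ', div_mul_cancel₀ _ (hq0 _).ne']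
  have hder : ∀ x ∈ Ioo (-Real.pi) Real.pi,
      HasDerivAt (fun y => U y - laminarVelocity Um Up y) (a / q (U x) - m) x := fun x hx => by
    have h2 : HasDerivAt (laminarVelocity Um Up) (m * 1) x :=
      (((hasDerivAt_id x).add_const Real.pi).const_mul m).const_add Um
    rw [mul_one] at h2
    exact (ha x hx).sub h2
  have hbound : ∀ x ∈ Ioo (-Real.pi) Real.pi, |a / q (U x) - m| ≤ |m| * ε := by
    intro x hx
    have e : a / q (U x) - m = m * ((q (U ξ) - q (U x)) / q (U x)) := by
      rw [ha']; field_simp [(hq0 (U x)).ne']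
    rw [e, abs_mul m, abs_div _ (q (U x)), abs_of_pos (hq0 (U x))]
    refine mul_le_mul_of_nonneg_left ?_ (abs_nonneg _)
    have h1 : |q (U ξ) - q (U x)| ≤ ε := by
      have h3 := hε _ (hmem (Ioo_subset_Icc_self hξ))
      have h4 := hε _ (hmem (Ioo_subset_Icc_self hx))
      have h5 := hq1 (U ξ)
      have h6 := hq1 (U x)
      exact abs_le.2 ⟨by linarith, by linarith⟩
    rw [div_le_iff₀ (hq0 _)]
    nlinarith [hq1 (U x), (abs_nonneg _).trans h1]
  have hcont : ContinuousOn (fun y => U y - laminarVelocity Um Up y) (Icc (-Real.pi) Real.pi) :=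
    hc.sub (by unfold laminarVelocity; fun_prop)
  have hzero : U (-Real.pi) - laminarVelocity Um Up (-Real.pi) = 0 := by
    rw [hl, laminarVelocity]; ring
  have hm2 : |Up - Um| = |m| * (2 * Real.pi) := by
    rw [hm, abs_div, abs_of_pos (by positivity : 0 < 2 * Real.pi),
      div_mul_cancel₀ _ (by positivity)]
  rcases eq_or_lt_of_le hy.1 with h | h
  · rw [← h, hzero, abs_zero]
    have h0 : 0 ≤ ε := by linarith [hε Um left_mem_uIcc, hq1 Um]
    positivity
  · obtain ⟨ζ, hζ, hζ'⟩ := exists_hasDerivAt_eq_slope _ _ h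
      (hcont.mono (Icc_subset_Icc_right hy.2)) fun x hx => hder x ⟨hx.1, hx.2.trans_le hy.2⟩
    have h1 := hbound ζ ⟨hζ.1, hζ.2.trans_le hy.2⟩
    rw [hζ', hzero, sub_zero, abs_div, abs_of_pos (by linarith : 0 < y - -Real.pi),
      div_le_iff₀ (by linarith)] at h1
    refine h1.trans ?_
    rw [hm2]
    have h0 : 0 ≤ ε := by linarith [hε Um left_mem_uIcc, hq1 Um]
    have : 0 ≤ |m| * ε := by positivity
    nlinarith [hy.2]

end

/-! ### Solutions of the hydrodynamic system -/

/-- The temperature as a function of the velocity (the Crocco relation). -/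
def couetteTemp (Um Up δ s : ℝ) : ℝ :=
  1 + δ ^ 2 * (viscosity 1 / (2 * conductivity 1)) * ((Up - s) * (s - Um))

/-- The factor `√T` of the viscosity as a function of the velocity. The truncation is inactive for
velocities between `Um` and `Up`. -/
def couetteRate (Um Up δ s : ℝ) : ℝ := √(max 1 (couetteTemp Um Up δ s))

theorem continuous_couetteRate (Um Up δ : ℝ) : Continuous (couetteRate Um Up δ) := by
  unfold couetteRate couetteTemp; fun_prop

theorem one_le_couetteRate (Um Up δ s : ℝ) : 1 ≤ couetteRate Um Up δ s :=
  Real.one_le_sqrt.2 (le_max_left _ _)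

theorem couetteCoeff_pos : 0 < viscosity 1 / (2 * conductivity 1) := by
  have := viscosity_one_pos
  have := conductivity_one_pos
  positivity

theorem mul_sub_nonneg_of_mem_uIcc {Um Up s : ℝ} (hs : s ∈ uIcc Um Up) :
    0 ≤ (Up - s) * (s - Um) := by
  rcases mem_uIcc.1 hs with h | h <;> nlinarith

theorem one_le_couetteTemp {Um Up δ s : ℝ} (hs : s ∈ uIcc Um Up) : 1 ≤ couetteTemp Um Up δ s := by
  have := mul_sub_nonneg_of_mem_uIcc hs
  have := couetteCoeff_pos
  unfold couetteTemp
  have : 0 ≤ δ ^ 2 * (viscosity 1 / (2 * conductivity 1)) * ((Up - s) * (s - Um)) := by positivity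
  linarith

theorem couetteRate_eq {Um Up δ s : ℝ} (hs : s ∈ uIcc Um Up) :
    couetteRate Um Up δ s = √(couetteTemp Um Up δ s) := by
  rw [couetteRate, max_eq_right (one_le_couetteTemp hs)]

theorem couetteTemp_le {Um Up δ s : ℝ} : couetteTemp Um Up δ s
    ≤ 1 + δ ^ 2 * (viscosity 1 / (2 * conductivity 1)) * (Up - Um) ^ 2 := by
  have := couetteCoeff_pos
  have h : (Up - s) * (s - Um) ≤ (Up - Um) ^ 2 := by
    nlinarith [sq_nonneg (Up - s - (s - Um)), sq_nonneg (Up - Um)]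
  unfold couetteTemp
  gcongr

/-- The open flow domain. -/
abbrev channel : Set ℝ := Ioo (-Real.pi) Real.pi

theorem ContDiffOn.differentiableAt_channel {f : ℝ → ℝ} (hf : ContDiffOn ℝ ∞ f channel) {y : ℝ}
    (hy : y ∈ channel) : DifferentiableAt ℝ f y :=
  (hf.differentiableOn (by simp)).differentiableAt (isOpen_Ioo.mem_nhds hy)

theorem ContDiffOn.deriv_channel {f : ℝ → ℝ} (hf : ContDiffOn ℝ ∞ f channel) :
    ContDiffOn ℝ ∞ (deriv f) channel := hf.deriv_of_isOpen isOpen_Ioo (by simp)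

theorem exists_const_of_deriv_eq_zero {f : ℝ → ℝ} (hf : ∀ y ∈ channel, HasDerivAt f 0 y) :
    ∃ a, ∀ y ∈ channel, f y = a :=
  isOpen_Ioo.exists_is_const_of_deriv_eq_zero isPreconnected_Ioo
    (fun y hy => (hf y hy).differentiableAt.differentiableWithinAt) fun y hy => (hf y hy).deriv

/-- Integrals of the system: no radial flow, `ρ T = 1`, the Crocco relation between temperature and
velocity, and the resulting velocity equation. -/
theorem HydroFields.IsSolution.fields {W : HydroFields} {σ₁ σ₂ : ℝ → ℝ} {C Um Up δ : ℝ}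
    (h : W.IsSolution σ₁ σ₂ C Um Up δ) :
    IsProfile (couetteRate Um Up δ) Um Up W.U ∧
      ∀ y ∈ Icc (-Real.pi) Real.pi, W.u y = 0 ∧ W.density δ y * W.temperature δ y = 1 ∧
        conductivity 1 * W.τ y = δ * viscosity 1 / 2 * ((Up - W.U y) * (W.U y - Um)) ∧
        W.temperature δ y = couetteTemp Um Up δ (W.U y) := by
  have hη := viscosity_one_pos
  have hκ := conductivity_one_pos
  have dr := fun y (hy : y ∈ channel) => ContDiffOn.differentiableAt_channel h.smooth_r hy
  have dτ := fun y (hy : y ∈ channel) => ContDiffOn.differentiableAt_channel h.smooth_τ hy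
  have du := fun y (hy : y ∈ channel) => ContDiffOn.differentiableAt_channel h.smooth_u hy
  have dU := fun y (hy : y ∈ channel) => ContDiffOn.differentiableAt_channel h.smooth_U hy
  have ddτ := fun y (hy : y ∈ channel) =>
    ContDiffOn.differentiableAt_channel (ContDiffOn.deriv_channel h.smooth_τ) hy
  have ddU := fun y (hy : y ∈ channel) =>
    ContDiffOn.differentiableAt_channel (ContDiffOn.deriv_channel h.smooth_U) hy
  have dρ : ∀ y ∈ channel, DifferentiableAt ℝ (W.density δ) y := fun y hy =>
    ((dr y hy).const_mul δ).const_add 1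
  have dT : ∀ y ∈ channel, DifferentiableAt ℝ (W.temperature δ) y := fun y hy =>
    ((dτ y hy).const_mul δ).const_add 1
  have cρ : ContinuousOn (W.density δ) (Icc (-Real.pi) Real.pi) :=
    continuousOn_const.add (continuousOn_const.mul h.cont_r)
  have cT : ContinuousOn (W.temperature δ) (Icc (-Real.pi) Real.pi) :=
    continuousOn_const.add (continuousOn_const.mul h.cont_τ)
  have Tpos : ∀ y ∈ channel, 0 < W.temperature δ y := fun y hy =>
    h.temperature_pos y (Ioo_subset_Icc_self hy)
  have dS : ∀ y ∈ channel, DifferentiableAt ℝ (fun s => √(W.temperature δ s)) y := fun y hy =>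
    (dT y hy).sqrt (Tpos y hy).ne'
  have hflux : ∀ y ∈ Icc (-Real.pi) Real.pi, W.density δ y * W.u y = 0 := fun y hy => by
    have := eq_left_of_hasDerivAt_zero (f := fun s => W.density δ s * W.u s) (cρ.mul h.cont_u)
      (fun y hy => by
        rw [← h.mass y hy]
        exact ((dρ y hy).mul (du y hy)).hasDerivAt) hy
    rw [this, h.u_left, mul_zero]
  have hpress : ∀ y ∈ Icc (-Real.pi) Real.pi, W.density δ y * W.temperature δ y = 1 := fun y hy => by
    have := eq_left_of_hasDerivAt_zero (f := fun s => W.density δ s * W.temperature δ s) (cρ.mul cT)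
      (fun y hy => by
        rw [← h.const_pressure y hy]
        exact ((dρ y hy).mul (dT y hy)).hasDerivAt) hy
    rw [this, HydroFields.density, HydroFields.temperature, h.r_left, h.τ_left]
    ring
  -- the shear stress is constant
  obtain ⟨a, ha⟩ := exists_const_of_deriv_eq_zero
    (f := fun s => √(W.temperature δ s) * deriv W.U s) fun y hy => by
      have h1 : HasDerivAt (fun s => √(W.temperature δ s) * deriv W.U s)
          (deriv (fun s => √(W.temperature δ s) * deriv W.U s) y) y :=
        ((dS y hy).mul (ddU y hy)).hasDerivAt
      have h2 : (fun s => viscosity (W.temperature δ s) * deriv W.U s)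
          =ᶠ[nhds y] fun s => viscosity 1 * (√(W.temperature δ s) * deriv W.U s) := by
        filter_upwards [isOpen_Ioo.mem_nhds hy] with s hs
        rw [viscosity_eq (Tpos s hs)]
        ring
      have h3 := h.tangential y hy
      rw [hflux y (Ioo_subset_Icc_self hy), zero_mul, h2.deriv_eq,
        (h1.const_mul (viscosity 1)).deriv] at h3
      rw [(mul_eq_zero.1 h3.symm).resolve_left hη.ne'] at h1
      exact h1
  have Spos : ∀ y ∈ channel, 0 < √(W.temperature δ y) := fun y hy => Real.sqrt_pos.2 (Tpos y hy)
  have hU' : ∀ y ∈ channel, HasDerivAt W.U (a / √(W.temperature δ y)) y := fun y hy => by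
    rw [← ha y hy, mul_div_cancel_left₀ _ (Spos y hy).ne']
    exact (dU y hy).hasDerivAt
  -- the heat flux balances the viscous heating
  obtain ⟨b, hb⟩ := exists_const_of_deriv_eq_zero
    (f := fun s => conductivity 1 * (√(W.temperature δ s) * deriv W.τ s)
      - δ * viscosity 1 / 2 * (Up + Um - 2 * W.U s) * a) fun y hy => by
      have h1 : HasDerivAt (fun s => √(W.temperature δ s) * deriv W.τ s)
          (deriv (fun s => √(W.temperature δ s) * deriv W.τ s) y) y :=
        ((dS y hy).mul (ddτ y hy)).hasDerivAt
      have h2 : (fun s => conductivity (W.temperature δ s) * deriv W.τ s)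
          =ᶠ[nhds y] fun s => conductivity 1 * (√(W.temperature δ s) * deriv W.τ s) := by
        filter_upwards [isOpen_Ioo.mem_nhds hy] with s hs
        rw [conductivity_eq (Tpos s hs)]
        ring
      have h3 := h.energy y hy
      rw [hflux y (Ioo_subset_Icc_self hy), zero_mul, mul_zero, h2.deriv_eq,
        (h1.const_mul (conductivity 1)).deriv, viscosity_eq (Tpos y hy)] at h3
      have h4 := ((((dU y hy).hasDerivAt.const_mul 2).const_sub (Up + Um)).const_mul
        (δ * viscosity 1 / 2)).mul_const a
      have h5 := (h1.const_mul (conductivity 1)).sub h4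
      refine h5.congr_deriv ?_
      have h6 := ha y hy
      linear_combination -h3 - δ * viscosity 1 * deriv W.U y * h6
  -- `ψ` is monotone, as `√T ψ'` is constant, and vanishes at both walls
  have hψ : ∀ y ∈ Icc (-Real.pi) Real.pi,
      conductivity 1 * W.τ y - δ * viscosity 1 / 2 * ((Up - W.U y) * (W.U y - Um)) = 0 := by
    intro y hy
    have h1 := mem_uIcc_of_hasDerivAt (a := b) (g := fun s => √(W.temperature δ s))
      (U := fun s => conductivity 1 * W.τ s - δ * viscosity 1 / 2 * ((Up - W.U s) * (W.U s - Um)))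
      ((continuousOn_const.mul h.cont_τ).sub (continuousOn_const.mul
        ((continuousOn_const.sub h.cont_U).mul (h.cont_U.sub continuousOn_const))))
      (fun _ _ => Real.sqrt_nonneg _) (fun y hy => by
        have h1 := (dU y hy).hasDerivAt
        have h2 := ((dτ y hy).hasDerivAt.const_mul (conductivity 1)).sub
          (((h1.const_sub Up).mul (h1.sub_const Um)).const_mul (δ * viscosity 1 / 2))
        refine h2.congr_deriv ?_
        have h3 := (Spos y hy).ne'
        rw [← hb y hy, ← ha y hy]
        field_simp
        ring) hy
    simpa [h.τ_left, h.τ_right, h.U_left, h.U_right] using h1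
  have hT : ∀ y ∈ Icc (-Real.pi) Real.pi, W.temperature δ y = couetteTemp Um Up δ (W.U y) := by
    intro y hy
    have h1 := hψ y hy
    rw [HydroFields.temperature, couetteTemp]
    field_simp
    linear_combination 2 * δ * h1
  have hmem : ∀ y ∈ Icc (-Real.pi) Real.pi, W.U y ∈ uIcc Um Up := fun y hy => by
    have := mem_uIcc_of_hasDerivAt h.cont_U (fun _ _ => Real.sqrt_nonneg _) hU' hy
    rwa [h.U_left, h.U_right] at this
  refine ⟨⟨h.cont_U, h.U_left, h.U_right, a, fun y hy => ?_⟩, fun y hy => ⟨?_, hpress y hy, ?_, hT y hy⟩⟩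
  · have hy' := Ioo_subset_Icc_self hy
    rw [couetteRate_eq (hmem y hy'), ← hT y hy']
    exact hU' y hy
  · exact (mul_eq_zero.1 (hflux y hy)).resolve_left (h.density_pos y hy).ne'
  · linarith [hψ y hy]

theorem HydroFields.IsSolution.unique {W W' : HydroFields} {σ₁ σ₂ : ℝ → ℝ} {C Um Up δ : ℝ}
    (hδ : 0 < δ) (h : W.IsSolution σ₁ σ₂ C Um Up δ) (h' : W'.IsSolution σ₁ σ₂ C Um Up δ) {y : ℝ}
    (hy : y ∈ Icc (-Real.pi) Real.pi) :
    W.U y = W'.U y ∧ W.u y = W'.u y ∧ W.r y = W'.r y ∧ W.τ y = W'.τ y := by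
  obtain ⟨hU, hf⟩ := h.fields
  obtain ⟨hU', hf'⟩ := h'.fields
  obtain ⟨h1, h2, h3, -⟩ := hf y hy
  obtain ⟨h1', h2', h3', -⟩ := hf' y hy
  have eU := hU.unique (continuous_couetteRate _ _ _) (one_le_couetteRate _ _ _) hU' hy
  have eτ : W.τ y = W'.τ y := mul_left_cancel₀ conductivity_one_pos.ne' (by rw [h3, h3', eU])
  refine ⟨eU, by rw [h1, h1'], ?_, eτ⟩
  have eT : W.temperature δ y = W'.temperature δ y := by
    rw [HydroFields.temperature, HydroFields.temperature, eτ]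
  have eρ : W.density δ y = W'.density δ y :=
    mul_right_cancel₀ (h'.temperature_pos y hy).ne' (by rw [← eT, h2, eT, h2'])
  rw [HydroFields.density, HydroFields.density] at eρ
  exact mul_left_cancel₀ hδ.ne' (by linarith)

/-- Bootstrapping in the velocity equation. -/
theorem IsProfile.contDiffOn {Um Up δ : ℝ} {U : ℝ → ℝ} (h : IsProfile (couetteRate Um Up δ) Um Up U) :
    ContDiffOn ℝ ∞ U channel := by
  have hmem := fun {y} => h.mem_uIcc (one_le_couetteRate _ _ _) (y := y)
  obtain ⟨hc, -, -, a, ha⟩ := h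
  rw [contDiffOn_infty]
  intro n
  induction n with
  | zero => exact contDiffOn_zero.2 (hc.mono Ioo_subset_Icc_self)
  | succ n ih =>
    have h1 : ContDiffOn ℝ n (fun y => a / √(couetteTemp Um Up δ (U y))) channel := by
      refine contDiffOn_const.div (ContDiffOn.sqrt ?_ fun y hy => ?_) fun y hy => ?_
      · unfold couetteTemp
        exact contDiffOn_const.add (contDiffOn_const.mul
          ((contDiffOn_const.sub ih).mul (ih.sub contDiffOn_const)))
      · linarith [one_le_couetteTemp (δ := δ) (hmem (Ioo_subset_Icc_self hy))]
      · exact (Real.sqrt_pos.2 (by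
          linarith [one_le_couetteTemp (δ := δ) (hmem (Ioo_subset_Icc_self hy))])).ne'
    have h2 : ContDiffOn ℝ n (deriv U) channel := h1.congr fun y hy => by
      rw [(ha y hy).deriv, couetteRate_eq (hmem (Ioo_subset_Icc_self hy))]
    rw [Nat.cast_add, Nat.cast_one, contDiffOn_succ_iff_deriv_of_isOpen isOpen_Ioo]
    exact ⟨fun y hy => (ha y hy).differentiableAt.differentiableWithinAt, by simp, h2⟩

/-- The fields determined by a velocity profile `U`. In the quadrature for `𝓟₂` the temperature is
truncated below by `1`, which has no effect on `[-π, π]` but makes the integrand continuous on `ℝ`. -/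
def couetteFields (σ₁ σ₂ : ℝ → ℝ) (C Um Up δ : ℝ) (U : ℝ → ℝ) : HydroFields where
  U := U
  u := fun _ => 0
  r := fun y => ((couetteTemp Um Up δ (U y))⁻¹ - 1) / δ
  τ := fun y => δ * (viscosity 1 / (2 * conductivity 1)) * ((Up - U y) * (U y - Um))
  P₂ := fun y => δ ^ 2 * (σ₁ (couetteTemp Um Up δ (U y))
        * deriv (fun y => δ * (viscosity 1 / (2 * conductivity 1)) * ((Up - U y) * (U y - Um))) y ^ 2
      + σ₂ (couetteTemp Um Up δ (U y)) * deriv U y ^ 2)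
    + ∫ s in (0 : ℝ)..y, 1 / C ^ 2 * (U s ^ 2 / max 1 (couetteTemp Um Up δ (U s)))

theorem couetteFields_isSolution {σ₁ σ₂ : ℝ → ℝ} {C Um Up δ : ℝ} {U : ℝ → ℝ} (hδ : 0 < δ)
    (hσ₁ : ContDiffOn ℝ ∞ σ₁ (Ioi 0)) (hσ₂ : ContDiffOn ℝ ∞ σ₂ (Ioi 0)) (hc : Continuous U)
    (hU : IsProfile (couetteRate Um Up δ) Um Up U) :
    (couetteFields σ₁ σ₂ C Um Up δ U).IsSolution σ₁ σ₂ C Um Up δ := by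
  have hη := viscosity_one_pos
  have hκ := conductivity_one_pos
  have sU : ContDiffOn ℝ ∞ U channel := hU.contDiffOn
  have hmem := fun {y} => hU.mem_uIcc (one_le_couetteRate _ _ _) (y := y)
  obtain ⟨-, hl, hr, a, ha⟩ := hU
  set β := viscosity 1 / (2 * conductivity 1) with hβ
  set T : ℝ → ℝ := fun y => couetteTemp Um Up δ (U y) with hT
  set τ : ℝ → ℝ := fun y => δ * β * ((Up - U y) * (U y - Um)) with hτ
  set W := couetteFields σ₁ σ₂ C Um Up δ U with hW
  have WT : ∀ y, W.temperature δ y = T y := fun y => by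
    simp only [hW, HydroFields.temperature, couetteFields, hT, couetteTemp]
    ring
  have Wρ : ∀ y, W.density δ y = (T y)⁻¹ := fun y => by
    simp only [hW, HydroFields.density, couetteFields]
    field_simp
    ring
  have T1 : ∀ y ∈ Icc (-Real.pi) Real.pi, 1 ≤ T y := fun y hy => one_le_couetteTemp (hmem hy)
  have T0 : ∀ y ∈ Icc (-Real.pi) Real.pi, 0 < T y := fun y hy => by linarith [T1 y hy]
  have T0' : ∀ y ∈ channel, 0 < T y := fun y hy => T0 y (Ioo_subset_Icc_self hy)
  have sτ : ContDiffOn ℝ ∞ τ channel :=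
    contDiffOn_const.mul ((contDiffOn_const.sub sU).mul (sU.sub contDiffOn_const))
  have sT : ContDiffOn ℝ ∞ T channel :=
    contDiffOn_const.add (contDiffOn_const.mul
      ((contDiffOn_const.sub sU).mul (sU.sub contDiffOn_const)))
  have cT : Continuous T := by simp only [hT]; unfold couetteTemp; fun_prop
  have dU : ∀ y ∈ channel, HasDerivAt U (a / √(T y)) y := fun y hy => by
    have := ha y hy
    rwa [couetteRate_eq (hmem (Ioo_subset_Icc_self hy))] at this
  have dτ : ∀ y ∈ channel, HasDerivAt τ (δ * β * ((Up + Um - 2 * U y) * (a / √(T y)))) y := by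
    intro y hy
    have h1 := dU y hy
    refine (((h1.const_sub Up).mul (h1.sub_const Um)).const_mul (δ * β)).congr_deriv ?_
    ring
  set F : ℝ → ℝ := fun y => δ ^ 2 * (σ₁ (T y) * deriv τ y ^ 2 + σ₂ (T y) * deriv U y ^ 2) with hF
  have sF : ContDiffOn ℝ ∞ F channel :=
    contDiffOn_const.mul (((hσ₁.comp sT T0').mul ((ContDiffOn.deriv_channel sτ).pow 2)).add
      ((hσ₂.comp sT T0').mul ((ContDiffOn.deriv_channel sU).pow 2)))
  set g : ℝ → ℝ := fun s => 1 / C ^ 2 * (U s ^ 2 / max 1 (T s)) with hg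
  have cg : Continuous g := by
    refine continuous_const.mul ((hc.pow 2).div (continuous_const.max cT) fun s => ?_)
    exact (lt_of_lt_of_le one_pos (le_max_left _ _)).ne'
  have dG : ∀ y, HasDerivAt (fun y => ∫ s in (0 : ℝ)..y, g s) (g y) y := fun y =>
    (cg.integral_hasStrictDerivAt 0 y).hasDerivAt
  have eg : ∀ y ∈ channel, g y = 1 / C ^ 2 * ((T y)⁻¹ * U y ^ 2) := fun y hy => by
    simp only [hg]
    rw [max_eq_right (T1 y (Ioo_subset_Icc_self hy))]
    ring
  have sG : ContDiffOn ℝ ∞ (fun y => ∫ s in (0 : ℝ)..y, g s) channel := by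
    rw [contDiffOn_infty_iff_deriv_of_isOpen isOpen_Ioo]
    refine ⟨fun y _ => (dG y).differentiableAt.differentiableWithinAt, ?_⟩
    refine ContDiffOn.congr (f := fun y => 1 / C ^ 2 * ((T y)⁻¹ * U y ^ 2)) ?_ fun y hy => by
      rw [(dG y).deriv, eg y hy]
    exact contDiffOn_const.mul ((sT.inv fun y hy => (T0' y hy).ne').mul (sU.pow 2))
  have eP : W.P₂ = fun y => F y + ∫ s in (0 : ℝ)..y, g s := rfl
  have eτ : W.τ = τ := rfl
  have eU : W.U = U := rfl
  have nhds_channel : ∀ y ∈ channel, ∀ᶠ s in nhds y, s ∈ channel := fun y hy =>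
    isOpen_Ioo.mem_nhds hy
  have S0 : ∀ y ∈ channel, √(T y) ≠ 0 := fun y hy => (Real.sqrt_pos.2 (T0' y hy)).ne'
  have Wp : ∀ y ∈ channel, W.pressure δ y = 1 := fun y hy => by
    rw [HydroFields.pressure, WT, Wρ, inv_mul_cancel₀ (T0' y hy).ne']
  refine
    { smooth_U := sU
      smooth_u := contDiffOn_const
      smooth_r := ((sT.inv fun y hy => (T0' y hy).ne').sub contDiffOn_const).div_const δ
      smooth_τ := sτ
      smooth_P₂ := sF.add sG
      cont_U := hc.continuousOn
      cont_u := continuousOn_const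
      cont_r := ((cT.continuousOn.inv₀ fun y hy => (T0 y hy).ne').sub continuousOn_const).div_const δ
      cont_τ := (by fun_prop : Continuous τ).continuousOn
      density_pos := fun y hy => by rw [Wρ]; exact inv_pos.2 (T0 y hy)
      temperature_pos := fun y hy => by rw [WT]; exact T0 y hy
      mass := fun y _ => by simp [hW, couetteFields]
      const_pressure := fun y hy => ?_
      tangential := fun y hy => ?_
      energy := fun y hy => ?_
      radial := fun y hy => ?_
      u_left := rfl
      u_right := rfl
      U_left := hl
      U_right := hr
      τ_left := by simp [hW, couetteFields, hl]
      τ_right := by simp [hW, couetteFields, hr]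
      r_left := by simp [hW, couetteFields, hl, couetteTemp]
      r_right := by simp [hW, couetteFields, hr, couetteTemp] }
  · have h : (fun s => W.pressure δ s) =ᶠ[nhds y] fun _ => 1 := (nhds_channel y hy).mono Wp
    rw [h.deriv_eq, deriv_const]
  · have h : (fun s => viscosity (W.temperature δ s) * deriv W.U s)
        =ᶠ[nhds y] fun _ => viscosity 1 * a := by
      filter_upwards [nhds_channel y hy] with s hs
      rw [WT, viscosity_eq (T0' s hs), eU, (dU s hs).deriv]
      field_simp [S0 s hs]
    rw [h.deriv_eq, deriv_const]
    simp [hW, couetteFields]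
  · have h : (fun s => conductivity (W.temperature δ s) * deriv W.τ s)
        =ᶠ[nhds y] fun s => conductivity 1 * (δ * β * (Up + Um - 2 * U s) * a) := by
      filter_upwards [nhds_channel y hy] with s hs
      rw [WT, conductivity_eq (T0' s hs), eτ, (dτ s hs).deriv]
      field_simp [S0 s hs]
    have h2 : HasDerivAt (fun s => conductivity 1 * (δ * β * (Up + Um - 2 * U s) * a))
        (conductivity 1 * (δ * β * (-(2 * (a / √(T y)))) * a)) y :=
      (((((dU y hy).const_mul 2).const_sub (Up + Um)).const_mul (δ * β)).mul_const a).const_mul _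
    rw [h.deriv_eq, h2.deriv, WT, viscosity_eq (T0' y hy), eU, (dU y hy).deriv]
    have h3 := S0 y hy
    have h4 : W.u y = 0 := rfl
    rw [h4, hβ]
    field_simp
    ring
  · have h : (fun s => (viscosity (W.temperature δ s) - viscosity 1) * deriv W.u s
            + δ ^ 2 / W.pressure δ s
              * (σ₁ (W.temperature δ s) * deriv W.τ s ^ 2
                + σ₂ (W.temperature δ s) * deriv W.U s ^ 2)) =ᶠ[nhds y] F := by
      filter_upwards [nhds_channel y hy] with s hs
      have : deriv W.u s = 0 := deriv_const s (0 : ℝ)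
      rw [Wp s hs, this, WT, eτ, eU]
      simp [hF]
    have h1 : HasDerivAt W.P₂ (deriv F y + g y) y :=
      (ContDiffOn.differentiableAt_channel sF hy).hasDerivAt.add (dG y)
    have h2 : deriv W.u = fun _ => 0 := funext fun s => deriv_const s (0 : ℝ)
    rw [h.deriv_eq, h1.deriv, eg y hy, Wρ, h2, deriv_const, eU]
    ring

theorem exists_isSolution {σ₁ σ₂ : ℝ → ℝ} (C Um Up : ℝ) {δ : ℝ} (hδ : 0 < δ)
    (hσ₁ : ContDiffOn ℝ ∞ σ₁ (Ioi 0)) (hσ₂ : ContDiffOn ℝ ∞ σ₂ (Ioi 0)) :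
    ∃ W : HydroFields, W.IsSolution σ₁ σ₂ C Um Up δ := by
  obtain ⟨U, hc, hU⟩ := exists_profile (continuous_couetteRate Um Up δ)
    (one_le_couetteRate Um Up δ) Um Up
  exact ⟨_, couetteFields_isSolution hδ hσ₁ hσ₂ hc hU⟩

/-! ### Comparison of the Maxwellians -/

/-- The logarithm of `M(1/T, T, (s, 0, 0); v) / M(v)`. -/
def logRatio (T s : ℝ) (v : Vel) : ℝ :=
  -(5 / 2 * Real.log T) - (‖v‖ ^ 2 - 2 * s * v 0 + s ^ 2) / (2 * T) + ‖v‖ ^ 2 / 2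

theorem inv_stdMaxwellian_mul {T : ℝ} (hT : 0 < T) (s : ℝ) (v : Vel) :
    (stdMaxwellian v)⁻¹ * maxwellian T⁻¹ T !₂[s, 0, 0] v = Real.exp (logRatio T s v) := by
  have hn : ‖v - !₂[s, 0, 0]‖ ^ 2 = ‖v‖ ^ 2 - 2 * s * v 0 + s ^ 2 := by
    rw [norm_sq_eq_coords, norm_sq_eq_coords]
    simp
    ring
  have hp : (0 : ℝ) < (2 * Real.pi) ^ (3 / 2 : ℝ) := by positivity
  have h1 : (2 * Real.pi * T) ^ (3 / 2 : ℝ)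
      = (2 * Real.pi) ^ (3 / 2 : ℝ) * Real.exp (3 / 2 * Real.log T) := by
    rw [Real.mul_rpow (by positivity) hT.le, Real.rpow_def_of_pos hT, mul_comm (Real.log T)]
  have h2 : T⁻¹ = Real.exp (-Real.log T) := by rw [Real.exp_neg, Real.exp_log hT]
  have h3 : logRatio T s v = -Real.log T - 3 / 2 * Real.log T
      + -((‖v‖ ^ 2 - 2 * s * v 0 + s ^ 2) / (2 * T)) - -(‖v‖ ^ 2 / 2) := by
    rw [logRatio]; ring
  rw [h3, Real.exp_sub, Real.exp_add, Real.exp_sub, ← h2, stdMaxwellian, maxwellian, maxwellian, hn,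
    h1, sub_zero, mul_one, mul_one]
  field_simp

theorem abs_exp_sub_exp_le (a b : ℝ) :
    |Real.exp a - Real.exp b| ≤ |a - b| * (Real.exp a + Real.exp b) := by
  have key : ∀ a b : ℝ, b ≤ a → |Real.exp a - Real.exp b| ≤ |a - b| * (Real.exp a + Real.exp b) := by
    intro a b h
    rw [abs_of_nonneg (sub_nonneg.2 (Real.exp_le_exp.2 h)), abs_of_nonneg (sub_nonneg.2 h)]
    have h1 := Real.add_one_le_exp (b - a)
    have h2 : Real.exp b = Real.exp a * Real.exp (b - a) := by rw [← Real.exp_add]; ring_nf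
    have h3 := Real.exp_pos a
    have h4 : 0 ≤ (a - b) * Real.exp b := mul_nonneg (sub_nonneg.2 h) (Real.exp_pos b).le
    nlinarith
  rcases le_total b a with h | h
  · exact key a b h
  · rw [abs_sub_comm, abs_sub_comm a, add_comm]
    exact key b a h

/-- A majorant of the Maxwellian ratios, square integrable against the standard Maxwellian. -/
def majorant (R : ℝ) (v : Vel) : ℝ := (1 + ‖v‖ ^ 2) * Real.exp (‖v‖ ^ 2 / 8 + R * ‖v‖)

theorem integrable_majorant (R : ℝ) : Integrable fun v => stdMaxwellian v * majorant R v ^ 2 := by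
  have h := ((integrable_norm_pow_mul_exp 0 (a := 1 / 8) (by norm_num)).add
    (integrable_norm_pow_mul_exp 4 (a := 1 / 8) (by norm_num))).const_mul
      ((√(2 * Real.pi))⁻¹ ^ 3 * (2 * Real.exp (8 * R ^ 2)))
  refine h.mono' (Measurable.aestronglyMeasurable (by unfold majorant; fun_prop))
    (ae_of_all _ fun v => ?_)
  rw [Real.norm_of_nonneg (mul_nonneg (stdMaxwellian_pos v).le (sq_nonneg _)), stdMaxwellian_eq,
    majorant, mul_pow, ← Real.exp_nat_mul]
  simp only [Pi.add_apply, pow_zero, one_mul]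
  have h1 : (1 + ‖v‖ ^ 2) ^ 2 ≤ 2 * (1 + ‖v‖ ^ 4) := by nlinarith [sq_nonneg (1 - ‖v‖ ^ 2)]
  have h2 : Real.exp (-(‖v‖ ^ 2 / 2)) * Real.exp (((2 : ℕ) : ℝ) * (‖v‖ ^ 2 / 8 + R * ‖v‖))
      ≤ Real.exp (8 * R ^ 2) * Real.exp (-(1 / 8 * ‖v‖ ^ 2)) := by
    rw [← Real.exp_add, ← Real.exp_add]
    refine Real.exp_le_exp.2 ?_
    push_cast
    nlinarith [sq_nonneg (‖v‖ - 8 * R)]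
  have h3 := mul_le_mul h1 h2 (by positivity) (by positivity)
  have h4 : 0 ≤ (√(2 * Real.pi))⁻¹ ^ 3 := by positivity
  have h5 := mul_le_mul_of_nonneg_left h3 h4
  refine le_trans (le_of_eq ?_) (h5.trans (le_of_eq ?_))
  · ring
  · ring_nf

/-- The mixed norms with `q = 2` and `q = ∞` are controlled by a majorant uniform in `y`. -/
theorem mixedNorm_le {R A : ℝ} (hA : 0 ≤ A) {q : ℝ≥0∞} (hq : q = 2 ∨ q = ⊤) {f : ℝ → Vel → ℝ}
    (hf : ∀ y ∈ Icc (-Real.pi) Real.pi, ∀ v, |f y v| ≤ A * majorant R v) :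
    mixedNorm q f
      ≤ ENNReal.ofReal (A * (2 * Real.pi * √(∫ v, stdMaxwellian v * majorant R v ^ 2))) := by
  have hpi : 1 ≤ 2 * Real.pi := by linarith [Real.pi_gt_three]
  have hm0 : ∀ v, 0 ≤ majorant R v := fun v => by unfold majorant; positivity
  have h1 : ∀ v, eLpNorm (fun y => f y v) q (volume.restrict (Icc (-Real.pi) Real.pi))
      ≤ ENNReal.ofReal (2 * Real.pi * A * majorant R v) := by
    intro v
    have h := eLpNorm_le_of_ae_bound (p := q) (f := fun y => f y v) (C := A * majorant R v)
      (μ := volume.restrict (Icc (-Real.pi) Real.pi))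
      ((ae_restrict_iff' measurableSet_Icc).2 (ae_of_all _ fun y hy => hf y hy v))
    refine h.trans ?_
    have e : Real.pi - -Real.pi = 2 * Real.pi := by ring
    rw [Measure.restrict_apply_univ, Real.volume_Icc, e, mul_assoc,
      ENNReal.ofReal_mul (p := 2 * Real.pi) (by positivity)]
    refine mul_le_mul_left ?_ _
    have h1 : (1 : ℝ≥0∞) ≤ ENNReal.ofReal (2 * Real.pi) := ENNReal.one_le_ofReal.2 hpi
    refine (ENNReal.rpow_le_rpow_of_exponent_le h1 (z := 1) ?_).trans_eq (ENNReal.rpow_one _)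
    rcases hq with rfl | rfl
    · norm_num
    · norm_num
  rw [mixedNorm]
  set I := ∫ v, stdMaxwellian v * majorant R v ^ 2 with hI
  have hI0 : 0 ≤ I := integral_nonneg fun v => mul_nonneg (stdMaxwellian_pos v).le (sq_nonneg _)
  have h2 : ∫⁻ v : Vel, ENNReal.ofReal (stdMaxwellian v) *
      eLpNorm (fun y => f y v) q (volume.restrict (Icc (-Real.pi) Real.pi)) ^ 2
      ≤ ENNReal.ofReal ((2 * Real.pi * A) ^ 2 * I) := by
    rw [hI, ← integral_const_mul, ofReal_integral_eq_lintegral_ofReal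
      ((integrable_majorant R).const_mul _) (ae_of_all _ fun v => mul_nonneg (sq_nonneg _)
        (mul_nonneg (stdMaxwellian_pos v).le (sq_nonneg _)))]
    refine lintegral_mono fun v => ?_
    have h3 := pow_le_pow_left' (h1 v) 2
    rw [← ENNReal.ofReal_pow (mul_nonneg (by positivity) (hm0 v))] at h3
    refine (mul_le_mul_right h3 _).trans ?_
    rw [← ENNReal.ofReal_mul (stdMaxwellian_pos v).le]
    refine ENNReal.ofReal_le_ofReal (le_of_eq ?_)
    ring
  refine (ENNReal.rpow_le_rpow h2 (by norm_num)).trans_eq ?_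
  rw [ENNReal.ofReal_rpow_of_nonneg (by positivity) (by norm_num), ← Real.sqrt_eq_rpow,
    Real.sqrt_mul (sq_nonneg _), Real.sqrt_sq (by positivity)]
  congr 1
  ring

theorem exp_logRatio_le {T s R : ℝ} (hT1 : 1 ≤ T) (hT2 : T ≤ 5 / 4) (hs : |s| ≤ R) (v : Vel) :
    Real.exp (logRatio T s v) ≤ Real.exp (‖v‖ ^ 2 / 8 + R * ‖v‖) := by
  refine Real.exp_le_exp.2 ?_
  have hl : 0 ≤ Real.log T := Real.log_nonneg hT1
  have hT : 0 < T := by linarith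
  have h1 : s * v 0 ≤ R * ‖v‖ := by
    have := mul_le_mul hs (abs_coord_le v 0) (abs_nonneg _) ((abs_nonneg _).trans hs)
    rw [← abs_mul] at this
    exact (le_abs_self _).trans this
  have h0 : 0 ≤ R * ‖v‖ := mul_nonneg ((abs_nonneg _).trans hs) (norm_nonneg v)
  have h2 : ‖v‖ ^ 2 / 2 - (‖v‖ ^ 2 / 8 + R * ‖v‖) ≤ (‖v‖ ^ 2 - 2 * s * v 0 + s ^ 2) / (2 * T) := by
    rw [le_div_iff₀ (by positivity)]
    nlinarith [sq_nonneg s, mul_nonneg (sq_nonneg ‖v‖) (sub_nonneg.2 hT2),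
      mul_nonneg h0 (sub_nonneg.2 hT1)]
  rw [logRatio]
  linarith

theorem abs_logRatio_sub_le {T s s' R : ℝ} (hT1 : 1 ≤ T) (hs : |s| ≤ R) (hs' : |s'| ≤ R) (v : Vel) :
    |logRatio T s v - logRatio 1 s' v|
      ≤ (T - 1) * (5 / 2 + (‖v‖ + R) ^ 2 / 2) + |s - s'| * (‖v‖ + R) := by
  have hT : 0 < T := by linarith
  have hR : 0 ≤ R := (abs_nonneg _).trans hs
  have hl0 : 0 ≤ Real.log T := Real.log_nonneg hT1
  have hl1 : Real.log T ≤ T - 1 := Real.log_le_sub_one_of_pos hT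
  have hv := abs_le.1 (abs_coord_le v 0)
  obtain ⟨hs1, hs2⟩ := abs_le.1 hs
  set Q := ‖v‖ ^ 2 - 2 * s * v 0 + s ^ 2 with hQ
  have hsv : |s * v 0| ≤ R * ‖v‖ := by
    rw [abs_mul]; exact mul_le_mul hs (abs_coord_le v 0) (abs_nonneg _) hR
  obtain ⟨hsv1, hsv2⟩ := abs_le.1 hsv
  have hQ0 : 0 ≤ Q := by
    have : v 0 ^ 2 ≤ ‖v‖ ^ 2 := sq_le_sq' hv.1 hv.2
    nlinarith [sq_nonneg (v 0 - s)]
  have hQ1 : Q ≤ (‖v‖ + R) ^ 2 := by nlinarith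
  have e : logRatio T s v - logRatio 1 s' v
      = -(5 / 2 * Real.log T) + Q / 2 * (1 - T⁻¹) + (s - s') * (v 0 - (s + s') / 2) := by
    rw [logRatio, logRatio, Real.log_one, hQ]
    field_simp
    ring
  have hT' : 0 ≤ 1 - T⁻¹ ∧ 1 - T⁻¹ ≤ T - 1 := by
    have h1 : T⁻¹ ≤ 1 := inv_le_one_of_one_le₀ hT1
    have h2 : T * T⁻¹ = 1 := mul_inv_cancel₀ hT.ne'
    have h3 : 0 < T⁻¹ := inv_pos.2 hT
    constructor <;> nlinarith
  have h1 : |-(5 / 2 * Real.log T)| ≤ 5 / 2 * (T - 1) := by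
    rw [abs_neg, abs_of_nonneg (by positivity)]; linarith
  have h2 : |Q / 2 * (1 - T⁻¹)| ≤ (‖v‖ + R) ^ 2 / 2 * (T - 1) := by
    rw [abs_of_nonneg (mul_nonneg (by positivity) hT'.1)]
    exact mul_le_mul (by linarith) hT'.2 hT'.1 (by positivity)
  have h3 : |(s - s') * (v 0 - (s + s') / 2)| ≤ |s - s'| * (‖v‖ + R) := by
    rw [abs_mul]
    refine mul_le_mul_of_nonneg_left ?_ (abs_nonneg _)
    obtain ⟨hs1', hs2'⟩ := abs_le.1 hs'
    exact abs_le.2 ⟨by linarith, by linarith⟩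
  rw [e]
  calc _ ≤ |-(5 / 2 * Real.log T)| + |Q / 2 * (1 - T⁻¹)| + |(s - s') * (v 0 - (s + s') / 2)| :=
        abs_add_three _ _ _
    _ ≤ _ := by linarith

/-- Maxwellian ratios whose temperatures and mean velocities differ by `O(ε)` differ by `O(ε)`. -/
theorem abs_exp_logRatio_sub_le {T s s' R a b ε : ℝ} (hε : 0 ≤ ε) (ha : 0 ≤ a) (hb : 0 ≤ b)
    (hT1 : 1 ≤ T) (hT2 : T ≤ 5 / 4) (hTε : T - 1 ≤ a * ε) (hs : |s| ≤ R) (hs' : |s'| ≤ R)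
    (hss : |s - s'| ≤ b * ε) (v : Vel) :
    |Real.exp (logRatio T s v) - Real.exp (logRatio 1 s' v)|
      ≤ 2 * ((a + b) * (4 + R + R ^ 2)) * ε * majorant R v := by
  have hR : 0 ≤ R := (abs_nonneg _).trans hs
  set m := Real.exp (‖v‖ ^ 2 / 8 + R * ‖v‖) with hm
  have h1 := abs_exp_sub_exp_le (logRatio T s v) (logRatio 1 s' v)
  have h2 := abs_logRatio_sub_le hT1 hs hs' v
  have h3 : Real.exp (logRatio T s v) + Real.exp (logRatio 1 s' v) ≤ 2 * m := by
    linarith [exp_logRatio_le hT1 hT2 hs v, exp_logRatio_le le_rfl (by norm_num) hs' v]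
  have hv := norm_nonneg v
  have p1 : 5 / 2 + (‖v‖ + R) ^ 2 / 2 ≤ (4 + R + R ^ 2) * (1 + ‖v‖ ^ 2) := by
    nlinarith [sq_nonneg (‖v‖ - R), mul_nonneg (sq_nonneg R) (sq_nonneg ‖v‖),
      mul_nonneg hR (sq_nonneg ‖v‖)]
  have p2 : ‖v‖ + R ≤ (4 + R + R ^ 2) * (1 + ‖v‖ ^ 2) := by
    nlinarith [sq_nonneg (‖v‖ - 1), mul_nonneg (sq_nonneg R) (sq_nonneg ‖v‖),
      mul_nonneg hR (sq_nonneg ‖v‖)]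
  have h4 : (T - 1) * (5 / 2 + (‖v‖ + R) ^ 2 / 2) + |s - s'| * (‖v‖ + R)
      ≤ (a + b) * ε * ((4 + R + R ^ 2) * (1 + ‖v‖ ^ 2)) := by
    have q1 := mul_le_mul hTε p1 (by positivity) (by positivity)
    have q2 := mul_le_mul hss p2 (by positivity) (by positivity)
    linarith
  calc _ ≤ (a + b) * ε * ((4 + R + R ^ 2) * (1 + ‖v‖ ^ 2)) * (2 * m) :=
        h1.trans (mul_le_mul (h2.trans h4) h3 (by positivity) (by positivity))
    _ = _ := by rw [majorant]; ring

theorem logRatio_one_zero (v : Vel) : logRatio 1 0 v = 0 := by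
  simp [logRatio]

theorem laminarVelocity_eq (Um Up y : ℝ) : laminarVelocity Um Up y
    = (1 - (y + Real.pi) / (2 * Real.pi)) * Um + (y + Real.pi) / (2 * Real.pi) * Up := by
  rw [laminarVelocity]; ring

theorem abs_laminarVelocity_le (Um Up : ℝ) {y : ℝ} (hy : y ∈ Icc (-Real.pi) Real.pi) :
    |laminarVelocity Um Up y| ≤ |Um| + |Up| := by
  have hpi := Real.pi_pos
  set t := (y + Real.pi) / (2 * Real.pi) with ht
  have h0 : 0 ≤ t := div_nonneg (by linarith [hy.1]) (by positivity)
  have h1 : t ≤ 1 := (div_le_one (by positivity)).2 (by linarith [hy.2])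
  rw [laminarVelocity_eq]
  refine (abs_add_le _ _).trans ?_
  rw [abs_mul, abs_mul, abs_of_nonneg h0, abs_of_nonneg (by linarith : 0 ≤ 1 - t)]
  nlinarith [abs_nonneg Um, abs_nonneg Up]

theorem abs_le_of_mem_uIcc {Um Up s : ℝ} (hs : s ∈ uIcc Um Up) : |s| ≤ |Um| + |Up| := by
  rcases mem_uIcc.1 hs with h | h <;>
    exact abs_le.2 ⟨by linarith [neg_abs_le Um, neg_abs_le Up, abs_nonneg Um, abs_nonneg Up],
      by linarith [le_abs_self Um, le_abs_self Up, abs_nonneg Um, abs_nonneg Up]⟩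

/-- The coefficient of `δ²` in the bound for the temperature. -/
def heatingCoeff (Um Up : ℝ) : ℝ := viscosity 1 / (2 * conductivity 1) * (Up - Um) ^ 2

theorem heatingCoeff_nonneg (Um Up : ℝ) : 0 ≤ heatingCoeff Um Up :=
  mul_nonneg couetteCoeff_pos.le (sq_nonneg _)

theorem maxwellian_ratio_bounds {W : HydroFields} {σ₁ σ₂ : ℝ → ℝ} {C Um Up δ : ℝ}
    (h : W.IsSolution σ₁ σ₂ C Um Up δ) (hδ : 0 < δ) (hδ1 : δ ≤ 1)
    (hδ2 : δ ^ 2 * heatingCoeff Um Up ≤ 1 / 4) {y : ℝ} (hy : y ∈ Icc (-Real.pi) Real.pi) (v : Vel) :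
    |(stdMaxwellian v)⁻¹ * (hydroMaxwellian W δ y v - laminarMaxwellian Um Up δ y v)|
        ≤ 2 * ((heatingCoeff Um Up + |Up - Um| * heatingCoeff Um Up)
          * (4 + (|Um| + |Up|) + (|Um| + |Up|) ^ 2)) * δ ^ 2 * majorant (|Um| + |Up|) v ∧
    |(stdMaxwellian v)⁻¹ * (laminarMaxwellian Um Up δ y v - stdMaxwellian v)|
        ≤ 2 * ((0 + (|Um| + |Up|)) * (4 + (|Um| + |Up|) + (|Um| + |Up|) ^ 2)) * δ
          * majorant (|Um| + |Up|) v := by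
  set b := heatingCoeff Um Up with hb
  set R := |Um| + |Up| with hR
  have hb0 : 0 ≤ b := heatingCoeff_nonneg Um Up
  have hR0 : 0 ≤ R := by positivity
  obtain ⟨hU, hf⟩ := h.fields
  obtain ⟨-, hρ, -, hT⟩ := hf y hy
  have hmem := hU.mem_uIcc (one_le_couetteRate _ _ _) hy
  have hTle : ∀ s, couetteTemp Um Up δ s ≤ 1 + b * δ ^ 2 := fun s =>
    couetteTemp_le.trans (le_of_eq (by rw [hb, heatingCoeff]; ring))
  have hT1 : 1 ≤ W.temperature δ y := by rw [hT]; exact one_le_couetteTemp hmem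
  have hT2 : W.temperature δ y ≤ 1 + b * δ ^ 2 := by rw [hT]; exact hTle _
  have hlam := hU.abs_sub_laminar_le (one_le_couetteRate _ _ _) (ε := b * δ ^ 2) (fun s hs => by
    rw [couetteRate_eq hs, Real.sqrt_le_left (by positivity)]
    nlinarith [hTle s, sq_nonneg (b * δ ^ 2), mul_nonneg hb0 (sq_nonneg δ)]) hy
  have hδabs : ∀ {x : ℝ}, |x| ≤ R → |δ * x| ≤ R := fun {x} hx => by
    rw [abs_mul, abs_of_pos hδ]; nlinarith [abs_nonneg x]
  have hs : |δ * W.U y| ≤ R := hδabs (abs_le_of_mem_uIcc hmem)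
  have hs' : |δ * laminarVelocity Um Up y| ≤ R := hδabs (abs_laminarVelocity_le Um Up hy)
  have e1 : (stdMaxwellian v)⁻¹ * hydroMaxwellian W δ y v
      = Real.exp (logRatio (W.temperature δ y) (δ * W.U y) v) := by
    rw [← inv_stdMaxwellian_mul (by linarith), hydroMaxwellian, eq_inv_of_mul_eq_one_left hρ]
  have e2 : (stdMaxwellian v)⁻¹ * laminarMaxwellian Um Up δ y v
      = Real.exp (logRatio 1 (δ * laminarVelocity Um Up y) v) := by
    rw [← inv_stdMaxwellian_mul one_pos, laminarMaxwellian, inv_one]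
  have e3 : (stdMaxwellian v)⁻¹ * stdMaxwellian v = Real.exp (logRatio 1 0 v) := by
    rw [logRatio_one_zero, Real.exp_zero, inv_mul_cancel₀ (stdMaxwellian_pos v).ne']
  constructor
  · rw [mul_sub, e1, e2]
    refine abs_exp_logRatio_sub_le (sq_nonneg δ) hb0 (by positivity) hT1 (by linarith)
      (by linarith) hs hs' ?_ v
    rw [← mul_sub, abs_mul, abs_of_pos hδ]
    have := abs_nonneg (W.U y - laminarVelocity Um Up y)
    nlinarith
  · have h4 := abs_exp_logRatio_sub_le (a := 0) (b := R) (T := 1) hδ.le le_rfl hR0 le_rfl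
      (by norm_num) (by norm_num) hs' (s' := 0) (by simpa using hR0) (by
        rw [sub_zero, abs_mul, abs_of_pos hδ, mul_comm]
        exact mul_le_mul_of_nonneg_right (abs_laminarVelocity_le Um Up hy) hδ.le) v
    rw [mul_sub, e2, e3]
    exact h4

end

end GhostCouette

open GhostCouette in
/-- `c` and `δ₀` depend only on the wall velocities `Um`, `Up`. -/
theorem corollary2p2 (Um Up : ℝ) :
    ∃ δ₀ : ℝ, 0 < δ₀ ∧ ∃ c : ℝ, 0 < c ∧
      ∀ (C : ℝ) (_ : 0 < C) (σ₁ σ₂ : ℝ → ℝ)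
        (_ : ContDiffOn ℝ ∞ σ₁ (Ioi 0)) (_ : ContDiffOn ℝ ∞ σ₂ (Ioi 0))
        (δ : ℝ) (_ : 0 < δ) (_ : δ < δ₀),
        (∃ W : HydroFields, W.IsSolution σ₁ σ₂ C Um Up δ) ∧
        (∀ W W' : HydroFields, W.IsSolution σ₁ σ₂ C Um Up δ → W'.IsSolution σ₁ σ₂ C Um Up δ →
          ∀ y ∈ Icc (-Real.pi) Real.pi,
            W.U y = W'.U y ∧ W.u y = W'.u y ∧ W.r y = W'.r y ∧ W.τ y = W'.τ y) ∧
        ∀ W : HydroFields, W.IsSolution σ₁ σ₂ C Um Up δ →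
          ∀ q : ℝ≥0∞, q = 2 ∨ q = ⊤ →
            mixedNorm q (fun y v => (stdMaxwellian v)⁻¹ *
                (hydroMaxwellian W δ y v - laminarMaxwellian Um Up δ y v))
              ≤ ENNReal.ofReal (c * δ ^ 2) ∧
            mixedNorm q (fun y v => (stdMaxwellian v)⁻¹ *
                (laminarMaxwellian Um Up δ y v - stdMaxwellian v))
              ≤ ENNReal.ofReal (c * δ) := by
  set b := heatingCoeff Um Up with hb
  set R := |Um| + |Up| with hR
  have hb0 : 0 ≤ b := heatingCoeff_nonneg Um Up
  have hR0 : 0 ≤ R := by positivity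
  set A₁ := 2 * ((b + |Up - Um| * b) * (4 + R + R ^ 2)) with hA₁
  set A₂ := 2 * ((0 + R) * (4 + R + R ^ 2)) with hA₂
  set N := 2 * Real.pi * √(∫ v, stdMaxwellian v * majorant R v ^ 2) with hN
  have hN0 : 0 ≤ N := by positivity
  have hA₁0 : 0 ≤ A₁ := by positivity
  have hA₂0 : 0 ≤ A₂ := by positivity
  -- this `δ₀` ensures `δ ≤ 1` and `T ≤ 5/4`, which keeps the Maxwellian ratios in the weighted space
  refine ⟨1 / (2 * (1 + b)), by positivity, (A₁ + A₂) * N + 1, by positivity, ?_⟩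
  intro C _ σ₁ σ₂ hσ₁ hσ₂ δ hδ hδ₀
  have hδb : δ * (2 * (1 + b)) < 1 := by rwa [lt_div_iff₀ (by positivity)] at hδ₀
  have hδ1 : δ ≤ 1 := by nlinarith
  have hδ2 : δ ^ 2 * b ≤ 1 / 4 := by nlinarith [mul_nonneg hδ.le hb0]
  refine ⟨exists_isSolution C Um Up hδ hσ₁ hσ₂, fun W W' h h' y hy => h.unique hδ h' hy,
    fun W h q hq => ⟨?_, ?_⟩⟩
  · refine (mixedNorm_le (R := R) (A := A₁ * δ ^ 2) (by positivity) hq fun y hy v =>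
      (maxwellian_ratio_bounds h hδ hδ1 hδ2 hy v).1).trans (ENNReal.ofReal_le_ofReal ?_)
    rw [← hN]
    have : 0 ≤ (A₂ * N + 1) * δ ^ 2 := by positivity
    linarith
  · refine (mixedNorm_le (R := R) (A := A₂ * δ) (by positivity) hq fun y hy v =>
      (maxwellian_ratio_bounds h hδ hδ1 hδ2 hy v).2).trans (ENNReal.ofReal_le_ofReal ?_)
    rw [← hN]
    have : 0 ≤ (A₁ * N + 1) * δ := by positivity
    linarith
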